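/- Fix a universe; "small" is meant relative to it, and $\mathsf{CAT}$ denotes the 2-category of small categories, functors and natural transformations. Let $\mathcal A,\mathcal B$ be small 2-categories (with small hom-categories) and let $\mathcal H$ be a 2-category, possibly with a large class of objects, whose hom-categories are small. For 2-categories $\mathcal X,\mathcal Y$ write $[\mathcal X,\mathcal Y]_{PS}$ for the 2-category of pseudofunctors $\mathcal X\to\mathcal Y$, pseudonatural transformations and modifications; a pseudonatural equivalence is an equivalence in such a 2-category. Let $A:\mathcal A\to\mathcal H$ and $t:\mathcal A\to\mathcal B$ be pseudofunctors. *Pseudo-Kan extensions.* A right pseudo-Kan extension of $A$ along $t$ is a pair $(R,\varepsilon)$ of a pseudofunctor $R:\mathcal B\to\mathcal H$ and a pseudonatural transformation $\varepsilon:R\circ t\to A$ (the universal arrow) that is a right bicategorical reflection of $A$ along $[t,\mathcal H]_{PS}:[\mathcal B,\mathcal H]_{PS}\to[\mathcal A,\mathcal H]_{PS}$; that is, there is an equivalence $[\mathcal B,\mathcal H]_{PS}(S,R)\simeq[\mathcal A,\mathcal H]_{PS}(S\circ t,A)$, pseudonatural in $S$, which for $S=R$ sends $\mathrm{Id}_R$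 to $\varepsilon$ (up to an invertible modification). One writes $R=\mathrm{PsRan}_tA$. It is preserved by a pseudofunctor $U:\mathcal H\to\mathcal H'$ if $(U\circ R,\,U\varepsilon)$ is a right pseudo-Kan extension of $U\circ A$ along $t$, and it is pointwise if it is preserved by every representable pseudofunctor $\mathcal H(X,-):\mathcal H\to\mathsf{CAT}$, $X\in\mathcal H$. *Weighted bilimits.* For a pseudofunctor $W:\mathcal A\to\mathsf{CAT}$, an object $P$ of $\mathcal H$ is a weighted bilimit $\mathrm{bilim}(W,A)$ if it is a bicategorical representation of $X\mapsto[\mathcal A,\mathsf{CAT}]_{PS}(W,\mathcal H(X,A-))$, i.e. if there is an equivalence $\mathcal H(X,P)\simeq[\mathcal A,\mathsf{CAT}]_{PS}(W,\mathcal H(X,A-))$ pseudonatural in $X$. We say that a pseudofunctor $L:\mathcal B\to\mathcal H$ is *the pseudofunctor $b\mapsto\mathrm{bilim}(\mathcal B(b,t-),A)$* if there are equivalences $$\mathcal H(X,L(b))\simeq[\mathcal A,\mathsf{CAT}]_{PS}(\mathcal B(b,t-),\mathcal H(X,A-))$$ pseudonatural in $X$ and in $b$ (that is, an equivalence in $[\mathcal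 B,[\mathcal H^{\mathrm{op}},\mathsf{CAT}]_{PS}]_{PS}$). **Theorem.** 1. $A$ has a pointwise right pseudo-Kan extension along $t$ if and only if $\mathcal H$ has the weighted bilimit $\mathrm{bilim}(\mathcal B(b,t-),A)$ for every object $b$ of $\mathcal B$. 2. In this case there is an equivalence $\mathrm{PsRan}_tA(b)\simeq\mathrm{bilim}(\mathcal B(b,t-),A)$ pseudonatural in $b$. Explicitly: for every choice of weighted bilimits $P_b=\mathrm{bilim}(\mathcal B(b,t-),A)$, $b\in\mathcal B$, there is a pseudofunctor $L:\mathcal B\to\mathcal H$ with $L(b)=P_b$ for all $b$ that is the pseudofunctor $b\mapsto\mathrm{bilim}(\mathcal B(b,t-),A)$; and every right pseudo-Kan extension $\mathrm{PsRan}_tA$ of $A$ along $t$ is pseudonaturally equivalent to every such pseudofunctor $L$. -/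

import Mathlib

open CategoryTheory Bicategory
open scoped CategoryTheory.Pseudofunctor.StrongTrans

namespace PseudoKan

open Opposite Bicategory.Opposite Pseudofunctor

universe w v u w₁ v₁ u₁ w₂ v₂ u₂ w₃ v₃ u₃

section Representable

variable {C : Type u} [Bicategory.{w, v} C]

theorem catHom₂_ext {X Y : Cat.{v, u}} {F G : X ⟶ Y} {η θ : F ⟶ G}
    (h : ∀ x : X, η.toNatTrans.app x = θ.toNatTrans.app x) : η = θ :=
  Cat.Hom₂.ext (NatTrans.ext (funext h))

/-- The representable pseudofunctor `C(x, -) : C ⥤ᵖ Cat`. -/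
def representable (x : C) : C ⥤ᵖ Cat.{w, v} where
  obj y := Cat.of (x ⟶ y)
  map g := (postcomposingCat x _ _).obj g
  map₂ η := (postcomposingCat x _ _).map η
  map₂_id g := (postcomposingCat x _ _).map_id g
  map₂_comp η θ := (postcomposingCat x _ _).map_comp η θ
  mapId y := rightUnitorNatIsoCat x y
  mapComp f g := (associatorNatIsoLeftCat x f g).symm
  map₂_whisker_left f g h η := catHom₂_ext fun (k : x ⟶ _) => by
    have : k ◁ f ◁ η = (α_ k f g).inv ≫ (k ≫ f) ◁ η ≫ (α_ k f h).hom := by simp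
    exact this
  map₂_whisker_right {_ _ _ f g} η h := catHom₂_ext fun (k : x ⟶ _) => by
    have : k ◁ η ▷ h = (α_ k f h).inv ≫ (k ◁ η) ▷ h ≫ (α_ k g h).hom := by simp
    exact this
  map₂_associator f g h := catHom₂_ext fun (k : x ⟶ _) => by
    have : k ◁ (α_ f g h).hom = (α_ k (f ≫ g) h).inv ≫ (α_ k f g).inv ▷ h ≫ 𝟙 _ ≫
      (α_ (k ≫ f) g h).hom ≫ (α_ k f (g ≫ h)).hom := by simp
    exact this
  map₂_left_unitor {a b} f := catHom₂_ext fun (k : x ⟶ _) => by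
    have : k ◁ (λ_ f).hom = (α_ k (𝟙 a) f).inv ≫ (ρ_ k).hom ▷ f ≫ 𝟙 _ := by simp
    exact this
  map₂_right_unitor {a b} f := catHom₂_ext fun (k : x ⟶ _) => by
    have : k ◁ (ρ_ f).hom = (α_ k f (𝟙 b)).inv ≫ (ρ_ (k ≫ f)).hom ≫ 𝟙 _ := by simp
    exact this

/-- Precomposition with `f : x ⟶ y`, as a pseudonatural transformation `C(y, -) ⟶ C(x, -)`. -/
def representableMap {x y : C} (f : x ⟶ y) : representable y ⟶ representable x where
  app z := (precomposingCat x y z).obj f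
  naturality g := (associatorNatIsoMiddleCat f g).symm
  naturality_naturality {_ _ g h} η := catHom₂_ext fun (k : y ⟶ _) => by
    have : f ◁ k ◁ η ≫ (α_ f k h).inv = (α_ f k g).inv ≫ (f ≫ k) ◁ η := by simp
    exact this
  naturality_id a := catHom₂_ext fun (k : y ⟶ _) => by
    have : (α_ f k (𝟙 a)).inv ≫ (ρ_ (f ≫ k)).hom = f ◁ (ρ_ k).hom ≫ 𝟙 _ ≫ 𝟙 _ := by simp
    exact this
  naturality_comp g h := catHom₂_ext fun (k : y ⟶ _) => by
    have : (α_ f k (g ≫ h)).inv ≫ (α_ (f ≫ k) g h).inv =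
      f ◁ (α_ k g h).inv ≫ 𝟙 _ ≫ (α_ f (k ≫ g) h).inv ≫ 𝟙 _ ≫ (α_ f k g).inv ▷ h ≫ 𝟙 _ := by simp
    exact this

/-- The pseudofunctor `Cᵒᵖ ⥤ᵖ [C, Cat]`, `x ↦ C(x, -)`. -/
def representables (C : Type u) [Bicategory.{w, v} C] : Cᵒᵖ ⥤ᵖ (C ⥤ᵖ Cat.{w, v}) where
  obj x := representable (unop x)
  map f := representableMap f.unop
  map₂ {x _ f g} η :=
    { as :=
      { app := fun z => (precomposingCat _ _ z).map η.unop2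
        naturality := fun {a b} h => catHom₂_ext fun (k : unop x ⟶ a) => by
          have : η.unop2 ▷ (k ≫ h) ≫ (α_ g.unop k h).inv =
            (α_ f.unop k h).inv ≫ (η.unop2 ▷ k) ▷ h := by simp
          exact this } }
  map₂_id f := StrongTrans.homCategory.ext fun z => (precomposingCat _ _ z).map_id f.unop
  map₂_comp η θ := StrongTrans.homCategory.ext fun z =>
    (precomposingCat _ _ z).map_comp η.unop2 θ.unop2
  mapId x := StrongTrans.isoMk (fun z => leftUnitorNatIsoCat (unop x) z)
    (fun {a b} f => catHom₂_ext fun (k : unop x ⟶ a) => by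
      have : (λ_ (k ≫ f)).hom ≫ 𝟙 _ ≫ 𝟙 _ = (α_ (𝟙 (unop x)) k f).inv ≫ (λ_ k).hom ▷ f := by simp
      exact this)
  mapComp {x _ _} f g := StrongTrans.isoMk (fun z => associatorNatIsoRightCat g.unop f.unop z)
    (fun {a b} h => catHom₂_ext fun (k : unop x ⟶ a) => by
      have : (α_ g.unop f.unop (k ≫ h)).hom ≫ 𝟙 _ ≫ g.unop ◁ (α_ f.unop k h).inv ≫ 𝟙 _ ≫
          (α_ g.unop (f.unop ≫ k) h).inv ≫ 𝟙 _ =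
        (α_ (g.unop ≫ f.unop) k h).inv ≫ (α_ g.unop f.unop k).hom ▷ h := by simp
      exact this)
  map₂_whisker_left {x _ _} f g h η := StrongTrans.homCategory.ext fun z =>
    catHom₂_ext fun (k : unop x ⟶ z) => by
      have : (η.unop2 ▷ f.unop) ▷ k = (α_ g.unop f.unop k).hom ≫ η.unop2 ▷ (f.unop ≫ k) ≫
        (α_ h.unop f.unop k).inv := by simp
      exact this
  map₂_whisker_right {x _ _ f g} η h := StrongTrans.homCategory.ext fun z =>
    catHom₂_ext fun (k : unop x ⟶ z) => by
      have : (h.unop ◁ η.unop2) ▷ k = (α_ h.unop f.unop k).hom ≫ h.unop ◁ η.unop2 ▷ k ≫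
        (α_ h.unop g.unop k).inv := by simp
      exact this
  map₂_associator {x _ _ _} f g h := StrongTrans.homCategory.ext fun z =>
    catHom₂_ext fun (k : unop x ⟶ z) => by
      have : (α_ h.unop g.unop f.unop).inv ▷ k = (α_ h.unop (g.unop ≫ f.unop) k).hom ≫
        h.unop ◁ (α_ g.unop f.unop k).hom ≫ 𝟙 _ ≫ (α_ h.unop g.unop (f.unop ≫ k)).inv ≫
        (α_ (h.unop ≫ g.unop) f.unop k).inv := by simp
      exact this
  map₂_left_unitor {x _} f := StrongTrans.homCategory.ext fun z =>
    catHom₂_ext fun (k : unop x ⟶ z) => by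
      have : (ρ_ f.unop).hom ▷ k = (α_ f.unop (𝟙 _) k).hom ≫ f.unop ◁ (λ_ k).hom ≫ 𝟙 _ := by simp
      exact this
  map₂_right_unitor {x _} f := StrongTrans.homCategory.ext fun z =>
    catHom₂_ext fun (k : unop x ⟶ z) => by
      have : (λ_ f.unop).hom ▷ k = (α_ (𝟙 _) f.unop k).hom ≫ (λ_ (f.unop ≫ k)).hom ≫ 𝟙 _ := by
        simp
      exact this

end Representable

section Precomposition

variable {A : Type u₁} [Bicategory.{w₁, v₁} A] {B : Type u₂} [Bicategory.{w₂, v₂} B]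

theorem map₂_associator_inv' (F : A ⥤ᵖ B) {a b c d : A} (f : a ⟶ b) (g : b ⟶ c) (h : c ⟶ d) :
    F.map₂ (α_ f g h).inv = (F.mapComp f (g ≫ h)).hom ≫ F.map f ◁ (F.mapComp g h).hom ≫
      (α_ (F.map f) (F.map g) (F.map h)).inv ≫ (F.mapComp f g).inv ▷ F.map h ≫
      (F.mapComp (f ≫ g) h).inv := by
  rw [F.mapComp_assoc_right_hom_assoc]
  simp


/-- The whiskering `α t` of a pseudonatural transformation `α` with a pseudofunctor `t`. -/
def precompMap (t : A ⥤ᵖ B) {H : Type u₃} [Bicategory.{w₃, v₃} H] {S S' : B ⥤ᵖ H} (α : S ⟶ S') :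
    t.comp S ⟶ t.comp S' where
  app a := α.app (t.obj a)
  naturality f := α.naturality (t.map f)
  naturality_naturality η := α.naturality_naturality (t.map₂ η)
  naturality_id a := by
    have h1 := α.naturality_naturality (t.mapId a).hom
    have h2 := α.naturality_id (t.obj a)
    have : (α.naturality (t.map (𝟙 a))).hom ≫ α.app (t.obj a) ◁ (S'.map₂ (t.mapId a).hom ≫
        (S'.mapId (t.obj a)).hom) = (S.map₂ (t.mapId a).hom ≫ (S.mapId (t.obj a)).hom) ▷
        α.app (t.obj a) ≫ (λ_ (α.app (t.obj a))).hom ≫ (ρ_ (α.app (t.obj a))).inv := by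
      rw [Bicategory.whiskerLeft_comp, Bicategory.comp_whiskerRight, Category.assoc, ← h2,
        reassoc_of% h1]
    exact this
  naturality_comp {a b c} f g := by
    have h1 := α.naturality_naturality (t.mapComp f g).hom
    have h2 := α.naturality_comp (t.map f) (t.map g)
    have : (α.naturality (t.map (f ≫ g))).hom ≫ α.app (t.obj a) ◁ (S'.map₂ (t.mapComp f g).hom ≫
        (S'.mapComp (t.map f) (t.map g)).hom) =
        (S.map₂ (t.mapComp f g).hom ≫ (S.mapComp (t.map f) (t.map g)).hom) ▷ α.app (t.obj c) ≫
        (α_ _ _ _).hom ≫ S.map (t.map f) ◁ (α.naturality (t.map g)).hom ≫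
        (α_ _ _ _).inv ≫ (α.naturality (t.map f)).hom ▷ S'.map (t.map g) ≫ (α_ _ _ _).hom := by
      rw [Bicategory.whiskerLeft_comp, Bicategory.comp_whiskerRight, Category.assoc, ← h2,
        reassoc_of% h1]
    exact this

/-- The pseudofunctor `[t, H] : [B, H] ⥤ᵖ [A, H]`, `S ↦ S ∘ t`, where `[B, H]` is the bicategory of
pseudofunctors, pseudonatural transformations and modifications. -/
def precomposition (t : A ⥤ᵖ B) (H : Type u₃) [Bicategory.{w₃, v₃} H] :
    (B ⥤ᵖ H) ⥤ᵖ (A ⥤ᵖ H) where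
  obj S := t.comp S
  map α := precompMap t α
  map₂ Γ :=
    { as :=
      { app := fun a => Γ.as.app (t.obj a)
        naturality := fun f => Γ.as.naturality (t.map f) } }
  map₂_id α := rfl
  map₂_comp Γ Θ := rfl
  mapId S := StrongTrans.isoMk (fun a => Iso.refl _) (fun {a b} f => by
    have : S.map (t.map f) ◁ 𝟙 (𝟙 (S.obj (t.obj b))) ≫ (ρ_ _).hom ≫ (λ_ (S.map (t.map f))).inv =
      ((ρ_ _).hom ≫ (λ_ _).inv) ≫ 𝟙 (𝟙 (S.obj (t.obj a))) ▷ S.map (t.map f) := by simp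
    exact this)
  mapComp {S S' T} α β := StrongTrans.isoMk (fun a => Iso.refl _) (fun {a b} f => by
    have h (x : S.map (t.map f) ≫ α.app (t.obj b) ≫ β.app (t.obj b) ⟶
        (α.app (t.obj a) ≫ β.app (t.obj a)) ≫ T.map (t.map f)) :
        S.map (t.map f) ◁ 𝟙 (α.app (t.obj b) ≫ β.app (t.obj b)) ≫ x =
        x ≫ 𝟙 (α.app (t.obj a) ≫ β.app (t.obj a)) ▷ T.map (t.map f) := by simp
    exact h _)
  map₂_whisker_left {S S' T} α β γ Γ := StrongTrans.homCategory.ext fun a => by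
    have : α.app (t.obj a) ◁ Γ.as.app (t.obj a) =
      𝟙 _ ≫ α.app (t.obj a) ◁ Γ.as.app (t.obj a) ≫ 𝟙 _ := by simp
    exact this
  map₂_whisker_right {S S' T α β} Γ γ := StrongTrans.homCategory.ext fun a => by
    have : Γ.as.app (t.obj a) ▷ γ.app (t.obj a) =
      𝟙 _ ≫ Γ.as.app (t.obj a) ▷ γ.app (t.obj a) ≫ 𝟙 _ := by simp
    exact this
  map₂_associator α β γ := StrongTrans.homCategory.ext fun a => by
    have : (α_ (α.app (t.obj a)) (β.app (t.obj a)) (γ.app (t.obj a))).hom =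
      𝟙 _ ≫ 𝟙 _ ▷ γ.app (t.obj a) ≫ (α_ _ _ _).hom ≫ α.app (t.obj a) ◁ 𝟙 _ ≫ 𝟙 _ := by simp
    exact this
  map₂_left_unitor {S S'} α := StrongTrans.homCategory.ext fun a => by
    have : (λ_ (α.app (t.obj a))).hom = 𝟙 _ ≫ 𝟙 _ ▷ α.app (t.obj a) ≫ (λ_ _).hom := by simp
    exact this
  map₂_right_unitor {S S'} α := StrongTrans.homCategory.ext fun a => by
    have : (ρ_ (α.app (t.obj a))).hom = 𝟙 _ ≫ α.app (t.obj a) ◁ 𝟙 _ ≫ (ρ_ _).hom := by simp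
    exact this

section

variable {H : Type u₃} [Bicategory.{w₃, v₃} H] {H' : Type u} [Bicategory.{w, v} H']
  (U : H ⥤ᵖ H')

theorem map_naturality_aux {S F : A ⥤ᵖ H} (e : S ⟶ F) {a b : A} {f g : a ⟶ b} (η : f ⟶ g) :
    U.map₂ (S.map₂ η) ▷ U.map (e.app b) ≫
        (U.mapComp (S.map g) (e.app b)).inv ≫ U.map₂ (e.naturality g).hom ≫
          (U.mapComp (e.app a) (F.map g)).hom =
      ((U.mapComp (S.map f) (e.app b)).inv ≫ U.map₂ (e.naturality f).hom ≫
        (U.mapComp (e.app a) (F.map f)).hom) ≫ U.map (e.app a) ◁ U.map₂ (F.map₂ η) := by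
  have h := congrArg U.map₂ (e.naturality_naturality η)
  simp only [PrelaxFunctor.map₂_comp, map₂_whisker_left, map₂_whisker_right,
    Category.assoc] at h
  rw [← cancel_epi (U.mapComp (S.map f) (e.app b)).hom]
  simp [reassoc_of% h]

theorem map_naturality_id_aux {S F : A ⥤ᵖ H} (e : S ⟶ F) (a : A) :
    ((U.mapComp (S.map (𝟙 a)) (e.app a)).inv ≫ U.map₂ (e.naturality (𝟙 a)).hom ≫
          (U.mapComp (e.app a) (F.map (𝟙 a))).hom) ≫
          U.map (e.app a) ◁ (U.map₂ (F.mapId a).hom ≫ (U.mapId (F.obj a)).hom) =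
      (U.map₂ (S.mapId a).hom ≫ (U.mapId (S.obj a)).hom) ▷ U.map (e.app a) ≫
          (λ_ (U.map (e.app a))).hom ≫ (ρ_ (U.map (e.app a))).inv := by
  have h := congrArg U.map₂ (e.naturality_id a)
  simp only [PrelaxFunctor.map₂_comp, map₂_whisker_left, map₂_whisker_right, map₂_left_unitor,
    Category.assoc] at h
  rw [← cancel_epi (U.mapComp (S.map (𝟙 a)) (e.app a)).hom]
  have hr : U.map₂ (ρ_ (e.app a)).inv ≫ (U.mapComp (e.app a) (𝟙 _)).hom ≫
      U.map (e.app a) ◁ (U.mapId _).hom = (ρ_ (U.map (e.app a))).inv := by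
    rw [← cancel_epi (U.map₂ (ρ_ (e.app a)).hom), ← PrelaxFunctor.map₂_comp_assoc]
    simp
  have h' := h =≫ ((U.mapComp (e.app a) (𝟙 _)).hom ≫ U.map (e.app a) ◁ (U.mapId _).hom)
  simp only [Category.assoc, hr, Iso.inv_hom_id_assoc] at h'
  simp [h']

theorem map_naturality_comp_aux {S F : A ⥤ᵖ H} (e : S ⟶ F) {a b c : A} (f : a ⟶ b) (g : b ⟶ c) :
    ((U.mapComp (S.map (f ≫ g)) (e.app c)).inv ≫ U.map₂ (e.naturality (f ≫ g)).hom ≫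
          (U.mapComp (e.app a) (F.map (f ≫ g))).hom) ≫
          U.map (e.app a) ◁ (U.map₂ (F.mapComp f g).hom ≫ (U.mapComp (F.map f) (F.map g)).hom) =
      (U.map₂ (S.mapComp f g).hom ≫ (U.mapComp (S.map f) (S.map g)).hom) ▷ U.map (e.app c) ≫
        (α_ _ _ _).hom ≫ U.map (S.map f) ◁ ((U.mapComp (S.map g) (e.app c)).inv ≫
          U.map₂ (e.naturality g).hom ≫ (U.mapComp (e.app b) (F.map g)).hom) ≫ (α_ _ _ _).inv ≫
        ((U.mapComp (S.map f) (e.app b)).inv ≫ U.map₂ (e.naturality f).hom ≫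
          (U.mapComp (e.app a) (F.map f)).hom) ▷ U.map (F.map g) ≫ (α_ _ _ _).hom := by
  have h := congrArg U.map₂ (e.naturality_comp f g)
  simp only [PrelaxFunctor.map₂_comp, map₂_whisker_left, map₂_whisker_right, map₂_associator,
    map₂_associator_inv', Category.assoc] at h
  have h' := h =≫ ((U.mapComp (e.app a) (F.map f ≫ F.map g)).hom ≫
    U.map (e.app a) ◁ (U.mapComp (F.map f) (F.map g)).hom)
  simp only [Category.assoc, Iso.inv_hom_id_assoc] at h'
  rw [← cancel_epi (U.mapComp (S.map (f ≫ g)) (e.app c)).hom]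
  simp [h']

/-- The whiskering `U e : (U ∘ R) ∘ t ⟶ U ∘ F` of a pseudonatural transformation `e : R ∘ t ⟶ F` with
a pseudofunctor `U`. -/
def postcompMap {t : A ⥤ᵖ B} {R : B ⥤ᵖ H} {F : A ⥤ᵖ H} (e : t.comp R ⟶ F) :
    t.comp (R.comp U) ⟶ F.comp U where
  app a := U.map (e.app a)
  naturality {a b} f := (U.mapComp (R.map (t.map f)) (e.app b)).symm ≪≫
    U.map₂Iso (e.naturality f) ≪≫ U.mapComp (e.app a) (F.map f)
  naturality_naturality {a b f g} η := map_naturality_aux U e η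
  naturality_id a := by
    have h : U.map₂ (R.map₂ (t.mapId a).hom ≫ (R.mapId (t.obj a)).hom) ≫
      (U.mapId _).hom =
      U.map₂ (R.map₂ (t.mapId a).hom) ≫ U.map₂ (R.mapId (t.obj a)).hom ≫ (U.mapId _).hom := by simp
    exact (map_naturality_id_aux U e a).trans
      (congrArg (fun x => x ▷ U.map (e.app a) ≫ (λ_ _).hom ≫ (ρ_ _).inv) h)
  naturality_comp {a b c} f g := by
    have h : U.map₂ (R.map₂ (t.mapComp f g).hom ≫ (R.mapComp (t.map f) (t.map g)).hom) ≫
      (U.mapComp _ _).hom =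
      U.map₂ (R.map₂ (t.mapComp f g).hom) ≫ U.map₂ (R.mapComp (t.map f) (t.map g)).hom ≫
        (U.mapComp _ _).hom := by simp
    exact (map_naturality_comp_aux U e f g).trans
      (congrArg (fun x => x ▷ U.map (e.app c) ≫ (α_ _ _ _).hom ≫ _ ) h)

end

end Precomposition

section Op

variable {C : Type u₁} [Bicategory.{w₁, v₁} C] {D : Type u₂} [Bicategory.{w₂, v₂} D]

/-- The pseudofunctor `Cᵒᵖ ⥤ᵖ Dᵒᵖ` induced by `F` (1-cells are reversed, 2-cells are not). -/
def opPseudofunctor (F : C ⥤ᵖ D) : Cᵒᵖ ⥤ᵖ Dᵒᵖ where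
  obj x := op (F.obj (unop x))
  map f := (F.map f.unop).op
  map₂ η := op2 (F.map₂ η.unop2)
  map₂_id f := congrArg op2 (F.map₂_id f.unop)
  map₂_comp η θ := congrArg op2 (F.map₂_comp η.unop2 θ.unop2)
  mapId x := (F.mapId (unop x)).op2
  mapComp f g := (F.mapComp g.unop f.unop).op2
  map₂_whisker_left f g h η := congrArg op2 (F.map₂_whisker_right η.unop2 f.unop)
  map₂_whisker_right η h := congrArg op2 (F.map₂_whisker_left h.unop η.unop2)
  map₂_associator f g h := congrArg op2 (by
    exact map₂_associator_inv' F h.unop g.unop f.unop)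
  map₂_left_unitor f := congrArg op2 (F.map₂_right_unitor f.unop)
  map₂_right_unitor f := congrArg op2 (F.map₂_left_unitor f.unop)

/-- A pseudofunctor `Cᵒᵖ ⥤ᵖ D` viewed as a pseudofunctor `C ⥤ᵖ Dᵒᵖ`. -/
def leftOpPseudofunctor (F : Cᵒᵖ ⥤ᵖ D) : C ⥤ᵖ Dᵒᵖ where
  obj x := op (F.obj (op x))
  map f := (F.map f.op).op
  map₂ η := op2 (F.map₂ (op2 η))
  map₂_id f := congrArg op2 (F.map₂_id f.op)
  map₂_comp η θ := congrArg op2 (F.map₂_comp (op2 η) (op2 θ))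
  mapId x := (F.mapId (op x)).op2
  mapComp f g := (F.mapComp g.op f.op).op2
  map₂_whisker_left f g h η := congrArg op2 (F.map₂_whisker_right (op2 η) f.op)
  map₂_whisker_right η h := congrArg op2 (F.map₂_whisker_left h.op (op2 η))
  map₂_associator f g h := congrArg op2 (by
    exact map₂_associator_inv' F h.op g.op f.op)
  map₂_left_unitor f := congrArg op2 (F.map₂_right_unitor f.op)
  map₂_right_unitor f := congrArg op2 (F.map₂_left_unitor f.op)

end Op

/-- For `N : C ⥤ᵖ D`, the pseudofunctor `Dᵒᵖ ⥤ᵖ [C, Cat]`, `d ↦ D(d, N -)`. -/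
def restrictedRepresentables {C : Type u₁} [Bicategory.{w₁, v₁} C] {D : Type u₂}
    [Bicategory.{w₂, v₂} D] (N : C ⥤ᵖ D) : Dᵒᵖ ⥤ᵖ (C ⥤ᵖ Cat.{w₂, v₂}) :=
  (representables D).comp (precomposition N Cat.{w₂, v₂})

section Reflection

variable {C : Type u₁} [Bicategory.{w, v} C] {D : Type u₂} [Bicategory.{w, v} D]

/-- `x` is a bicategorical representation of the pseudofunctor `F : Cᵒᵖ ⥤ᵖ Cat`: there is an
equivalence `C(-, x) ≃ F` in the bicategory of pseudofunctors `Cᵒᵖ ⥤ᵖ Cat`, pseudonatural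
transformations and modifications. -/
def IsBirepresentedBy (F : Cᵒᵖ ⥤ᵖ Cat.{w, v}) (x : C) : Prop :=
  Nonempty (yoneda₀ x ≌ F)

/-- `D(L -, X) : Cᵒᵖ ⥤ᵖ Cat`. -/
def homInto (L : C ⥤ᵖ D) (X : D) : Cᵒᵖ ⥤ᵖ Cat.{w, v} :=
  (opPseudofunctor L).comp (yoneda₀ X)

/-- `(U, e)` is a right bicategorical reflection of `X` along `L`: there is a pseudonatural
equivalence `C(-, U) ≃ D(L -, X)` whose component at `U` sends `𝟙 U` to `e` (up to an
invertible 2-cell). -/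
def IsRightReflection (L : C ⥤ᵖ D) (X : D) (U : C) (e : L.obj U ⟶ X) : Prop :=
  ∃ E : yoneda₀ U ≌ homInto L X,
    Nonempty (((E.hom.app (op U)).toFunctor.obj (𝟙 U) : L.obj U ⟶ X) ≅ e)

end Reflection

section KanAndBilimits

universe s

variable {A B : Type s} [Bicategory.{s, s} A] [Bicategory.{s, s} B]
  {H : Type u} [Bicategory.{s, s} H]

/-- The pseudofunctor `X ↦ [A, Cat](W, H(X, F -))`, which is also pseudofunctorial in the
weight `W`. -/
def weightedCones (F : A ⥤ᵖ H) : (A ⥤ᵖ Cat.{s, s})ᵒᵖ ⥤ᵖ (Hᵒᵖ ⥤ᵖ Cat.{s, s}) :=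
  restrictedRepresentables (restrictedRepresentables F)

/-- `P` is a bilimit of `F` with weight `W`. -/
def IsWeightedBilimit (W : A ⥤ᵖ Cat.{s, s}) (F : A ⥤ᵖ H) (P : H) : Prop :=
  IsBirepresentedBy ((weightedCones F).obj (op W)) P

/-- `H` has the bilimit of `F` with weight `W`. -/
def HasWeightedBilimit (W : A ⥤ᵖ Cat.{s, s}) (F : A ⥤ᵖ H) : Prop :=
  ∃ P : H, IsWeightedBilimit W F P

/-- The weight `B(b, t -) : A ⥤ᵖ Cat`. -/
def homWeight (t : A ⥤ᵖ B) (b : B) : A ⥤ᵖ Cat.{s, s} :=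
  t.comp (representable b)

/-- `R` with `e : R ∘ t ⟶ F` is a right pseudo-Kan extension of `F` along `t`. -/
def IsPseudoRan (t : A ⥤ᵖ B) (F : A ⥤ᵖ H) (R : B ⥤ᵖ H) (e : t.comp R ⟶ F) : Prop :=
  IsRightReflection (precomposition t H) F R e

/-- The pseudofunctor `U` preserves the right pseudo-Kan extension `(R, e)` of `F` along `t`:
`U ∘ R` with `U e` is a right pseudo-Kan extension of `U ∘ F` along `t`. -/
def PreservesPseudoRan {H' : Type w} [Bicategory.{s, s} H'] (U : H ⥤ᵖ H') (t : A ⥤ᵖ B)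
    (F : A ⥤ᵖ H) (R : B ⥤ᵖ H) (e : t.comp R ⟶ F) : Prop :=
  IsPseudoRan t (F.comp U) (R.comp U) (postcompMap U e)

/-- A right pseudo-Kan extension of `F` along `t` exists that is preserved by all
representable pseudofunctors `H(X, -) : H ⥤ᵖ Cat`. -/
def HasPointwisePseudoRan (t : A ⥤ᵖ B) (F : A ⥤ᵖ H) : Prop :=
  ∃ (R : B ⥤ᵖ H) (e : t.comp R ⟶ F), IsPseudoRan t F R e ∧
    ∀ X : H, PreservesPseudoRan (representable X) t F R e

/-- The pseudofunctor `L : B ⥤ᵖ H` is `b ↦ bilim(B(b, t -), F)`: there is an equivalence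
`H(X, L b) ≃ [A, Cat](B(b, t -), H(X, F -))`, pseudonatural in `X` and in `b`. -/
def IsBilimitPseudofunctor (t : A ⥤ᵖ B) (F : A ⥤ᵖ H) (L : B ⥤ᵖ H) : Prop :=
  Nonempty (L.comp yoneda ≌
    (leftOpPseudofunctor (restrictedRepresentables t)).comp (weightedCones F))

end KanAndBilimits

end PseudoKan

universe s u

/-!
# Pointwise pseudo-Kan extensions and weighted bilimits

Let `F : A ⥤ᵖ H` and `t : A ⥤ᵖ B`. Write `N : H ⥤ᵖ [A, Cat]ᵒᵖ`, `x ↦ H(x, F -)`, and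
`G : B ⥤ᵖ [A, Cat]ᵒᵖ`, `b ↦ B(b, t -)`. Everything is expressed by *universal arrows*
(`IsUniversal`): an arrow `e : y P ⟶ Z` is universal from a pseudofunctor `y` to `Z` if
`v ↦ y v ≫ e` is an equivalence `H(S, P) ≃ K(y S, Z)` for every `S`. By the bicategorical Yoneda
lemma (`exists_yoneda_equivalence`), right reflections are the same as universal arrows
(`isRightReflection_iff`), and `P` is a bilimit of `F` with weight `B(b, t -)` as soon as there is a
universal arrow `N P ⟶ G b`. No pseudonaturality in `S` has to be carried along.

Two general facts about universal arrows carry the proof. Universal arrows `y (P b) ⟶ G b`, one for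
each `b`, assemble into a pseudofunctor `b ↦ P b` and a pseudonatural transformation
(`universalLift`, `universalLiftArrow`); applied to the Yoneda embedding of `H`, this turns chosen
bilimits into the pseudofunctor `b ↦ bilim(B(b, t -), F)`. And a transformation `y L ⟶ G` whose
components are universal is universal among transformations
(`CompTrans.isEquivalence_transComparison`).

The middle term between extensions and bilimits is the transformation `N L ⟶ G` given by a
transformation `e : L t ⟶ F`. Its component at `b` consists of the functors
`B(b, t a) ⥤ H(L b, F a)`, `f ↦ L f ≫ e`, which form a cone with vertex `L b`; these are called the
*legs* of `e` (`legs`). The theorem comes down to the condition that the legs be universal at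
every `b`.

* For `L` the pseudofunctor of bilimits, the equivalence
  `H(X, L b) ≃ [A, Cat](B(b, t -), H(X, F -))` is transposed by the Yoneda lemma, first in `X`, to a
  transformation `N L ⟶ G` with universal components, and then in `b`, to a transformation
  `L t ⟶ F` with the former as its legs (`IsBilimitPseudofunctor.exists_isUniversal_legs`). Both
  transpositions evaluate a two-sided transformation (`BiTrans`) at identities.
* If the legs of `e` are universal, `e` is a right pseudo-Kan extension
  (`isUniversal_precomposition`): passing to legs is a fully faithful functor `legsFunctor`, and it
  carries the comparison functor of `e` to that of a transformation with universal components.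
* Universal legs are preserved by the representables `H(X, -)` (`isUniversal_legs_postcompMap`),
  because `[A, Cat](W, Cat(C, V -))` and `Cat(C, [A, Cat](W, V))` agree up to a fully faithful
  functor. So the extension is pointwise.
* Conversely, if `H(X, e)` is a right pseudo-Kan extension for all `X`, testing it on the
  representables `B(b, -)` shows that the legs of `e` are universal
  (`isUniversal_legs_of_forall_representable`), and hence that the bilimits exist.

Uniqueness of right pseudo-Kan extensions is that of the source of a universal arrow
(`IsUniversal.nonempty_equivalence`).
-/

namespace PseudoKan

open Opposite Bicategory.Opposite Pseudofunctor

universe w v w₁ v₁ u₁ w₂ v₂ u₂ w₃ v₃ u₃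

/-! ### Exchange laws for whiskered 2-cells between composites -/

section Exchange

variable {K : Type u} [Bicategory.{w, v} K] {a b b' c d d' : K}

theorem whiskerLeft_exchange {f f' : a ⟶ b} (x : f ⟶ f') {g : b ⟶ c} {h : c ⟶ d}
    {k : b ⟶ b'} {l : b' ⟶ d} (θ : g ≫ h ⟶ k ≫ l) :
    f ◁ θ ≫ (α_ _ _ _).inv ≫ x ▷ k ▷ l =
      (α_ _ _ _).inv ≫ x ▷ g ▷ h ≫ (α_ _ _ _).hom ≫ f' ◁ θ ≫ (α_ _ _ _).inv := by
  have := whisker_exchange x θ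
  simp only [whiskerRight_comp, Category.assoc] at this
  simp [← reassoc_of% this]

theorem whiskerLeft_exchange' {f f' : a ⟶ b} (x : f ⟶ f') {g : b ⟶ c} {h : c ⟶ d}
    {k : b ⟶ d} (θ : g ≫ h ⟶ k) :
    f ◁ θ ≫ x ▷ k = (α_ _ _ _).inv ≫ x ▷ g ▷ h ≫ (α_ _ _ _).hom ≫ f' ◁ θ := by
  simp [whisker_exchange]

theorem whiskerRight_exchange {f : a ⟶ b} {g : b ⟶ c} {h : a ⟶ b'} {k : b' ⟶ c}
    (θ : f ≫ g ⟶ h ≫ k) {l l' : c ⟶ d} (x : l ⟶ l') :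
    θ ▷ l ≫ (α_ _ _ _).hom ≫ h ◁ k ◁ x =
      (α_ _ _ _).hom ≫ f ◁ g ◁ x ≫ (α_ _ _ _).inv ≫ θ ▷ l' ≫ (α_ _ _ _).hom := by
  have := whisker_exchange θ x
  simp only [comp_whiskerLeft, Category.assoc] at this
  simp [reassoc_of% this]

end Exchange

/-! ### Universal arrows and pseudofunctors into them -/

section Universal

variable {H : Type u₁} [Bicategory.{w₁, v₁} H] {K : Type u₂} [Bicategory.{w₂, v₂} K]

/-- The functor `H(S, P) ⥤ K(y S, Z)`, `v ↦ y v ≫ e`, induced by `e : y P ⟶ Z`. -/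
def comparison (y : H ⥤ᵖ K) {P : H} {Z : K} (e : y.obj P ⟶ Z) (S : H) :
    (S ⟶ P) ⥤ (y.obj S ⟶ Z) where
  obj v := y.map v ≫ e
  map η := y.map₂ η ▷ e

/-- `e : y P ⟶ Z` is a universal arrow from `y` to `Z` in the bicategorical sense: all the
functors `H(S, P) ⥤ K(y S, Z)`, `v ↦ y v ≫ e`, are equivalences. -/
structure IsUniversal (y : H ⥤ᵖ K) {P : H} {Z : K} (e : y.obj P ⟶ Z) : Prop where
  isEquivalence (S : H) : (comparison y e S).IsEquivalence

namespace IsUniversal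

variable {y : H ⥤ᵖ K} {P : H} {Z : K} {e : y.obj P ⟶ Z}

theorem hom_ext (h : IsUniversal y e) {S : H} {v v' : S ⟶ P} {η θ : v ⟶ v'}
    (w : y.map₂ η ▷ e = y.map₂ θ ▷ e) : η = θ :=
  have := h.isEquivalence S
  (comparison y e S).map_injective w

/-- The isomorphism of `H` lying over a given isomorphism `y v ≫ e ≅ y v' ≫ e`. -/
noncomputable def liftIso (h : IsUniversal y e) {S : H} {v v' : S ⟶ P}
    (σ : y.map v ≫ e ≅ y.map v' ≫ e) : v ≅ v' :=
  have := h.isEquivalence S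
  (comparison y e S).preimageIso σ

@[simp]
theorem map₂_liftIso_hom (h : IsUniversal y e) {S : H} {v v' : S ⟶ P}
    (σ : y.map v ≫ e ≅ y.map v' ≫ e) : y.map₂ (h.liftIso σ).hom ▷ e = σ.hom :=
  have := h.isEquivalence S
  (comparison y e S).map_preimage σ.hom

/-- The 2-cell of `H` lying over a given 2-cell `y v ≫ e ⟶ y v' ≫ e`. -/
noncomputable def lift₂ (h : IsUniversal y e) {S : H} {v v' : S ⟶ P}
    (σ : y.map v ≫ e ⟶ y.map v' ≫ e) : v ⟶ v' :=
  have := h.isEquivalence S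
  (comparison y e S).preimage σ

@[simp]
theorem map₂_lift₂ (h : IsUniversal y e) {S : H} {v v' : S ⟶ P}
    (σ : y.map v ≫ e ⟶ y.map v' ≫ e) : y.map₂ (h.lift₂ σ) ▷ e = σ :=
  have := h.isEquivalence S
  (comparison y e S).map_preimage σ

/-- A 1-cell `S ⟶ P` over `z : y S ⟶ Z`. -/
noncomputable def lift (h : IsUniversal y e) {S : H} (z : y.obj S ⟶ Z) : S ⟶ P :=
  have := h.isEquivalence S
  (comparison y e S).objPreimage z

/-- The isomorphism exhibiting `h.lift z` as a 1-cell over `z`. -/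
noncomputable def fac (h : IsUniversal y e) {S : H} (z : y.obj S ⟶ Z) :
    y.map (h.lift z) ≫ e ≅ z :=
  have := h.isEquivalence S
  (comparison y e S).objObjPreimageIso z

end IsUniversal

section Lift

variable {B : Type u₃} [Bicategory.{w₃, v₃} B] {y : H ⥤ᵖ K} {G : B ⥤ᵖ K} {P : B → H}
  {e : ∀ b, y.obj (P b) ⟶ G.obj b} (h : ∀ b, IsUniversal y (e b))

namespace UniversalLift

/-- The value at `g` of the lifted pseudofunctor: a 1-cell over `e b ≫ G g`. -/
noncomputable def map {b b' : B} (g : b ⟶ b') : P b ⟶ P b' :=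
  (h b').lift (e b ≫ G.map g)

/-- The isomorphism `y (L g) ≫ e b' ≅ e b ≫ G g` defining `L g`; it is also the naturality
isomorphism of `e`. -/
noncomputable def natIso {b b' : B} (g : b ⟶ b') :
    y.map (map h g) ≫ e b' ≅ e b ≫ G.map g :=
  (h b').fac (e b ≫ G.map g)

/-- The 2-cell `L g ⟶ L g'` over `G η`. -/
noncomputable def map₂ {b b' : B} {g g' : b ⟶ b'} (η : g ⟶ g') : map h g ⟶ map h g' :=
  (h b').lift₂ ((natIso h g).hom ≫ e b ◁ G.map₂ η ≫ (natIso h g').inv)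

theorem map₂_spec {b b' : B} {g g' : b ⟶ b'} (η : g ⟶ g') :
    y.map₂ (map₂ h η) ▷ e b' ≫ (natIso h g').hom = (natIso h g).hom ≫ e b ◁ G.map₂ η := by
  have := (h b').map₂_lift₂ ((natIso h g).hom ≫ e b ◁ G.map₂ η ≫ (natIso h g').inv)
  rw [map₂, this]
  simp

/-- The unit constraint, lying over that of `G`. -/
noncomputable def mapId (b : B) : map h (𝟙 b) ≅ 𝟙 (P b) :=
  (h b).liftIso (natIso h (𝟙 b) ≪≫ whiskerLeftIso (e b) (G.mapId b) ≪≫ ρ_ _ ≪≫ (λ_ _).symm ≪≫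
    whiskerRightIso (y.mapId _).symm (e b))

theorem mapId_spec (b : B) : y.map₂ (mapId h b).hom ▷ e b ≫ (y.mapId (P b)).hom ▷ e b ≫
    (λ_ _).hom ≫ (ρ_ _).inv = (natIso h (𝟙 b)).hom ≫ e b ◁ (G.mapId b).hom := by
  rw [mapId, IsUniversal.map₂_liftIso_hom]
  simp

/-- The composition constraint, lying over that of `G`. -/
noncomputable def mapComp {a b c : B} (f : a ⟶ b) (g : b ⟶ c) :
    map h (f ≫ g) ≅ map h f ≫ map h g :=
  (h c).liftIso (natIso h (f ≫ g) ≪≫ whiskerLeftIso (e a) (G.mapComp f g) ≪≫ (α_ _ _ _).symm ≪≫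
    whiskerRightIso (natIso h f).symm (G.map g) ≪≫ α_ _ _ _ ≪≫
    whiskerLeftIso (y.map (map h f)) (natIso h g).symm ≪≫ (α_ _ _ _).symm ≪≫
    whiskerRightIso (y.mapComp _ _).symm (e c))

/-- The isomorphism `y (L f ≫ L g) ≫ e ≅ e ≫ G f ≫ G g` obtained by pasting the squares `natIso`.
The pseudofunctor laws of the lift are checked after composing with such pastings. -/
noncomputable def paste {a b c : B} (f : a ⟶ b) (g : b ⟶ c) :
    y.map (map h f ≫ map h g) ≫ e c ≅ e a ≫ G.map f ≫ G.map g :=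
  whiskerRightIso (y.mapComp _ _) (e c) ≪≫ α_ _ _ _ ≪≫
    whiskerLeftIso (y.map (map h f)) (natIso h g) ≪≫ (α_ _ _ _).symm ≪≫
    whiskerRightIso (natIso h f) (G.map g) ≪≫ α_ _ _ _

theorem mapComp_spec {a b c : B} (f : a ⟶ b) (g : b ⟶ c) :
    y.map₂ (mapComp h f g).hom ▷ e c ≫ (paste h f g).hom =
      (natIso h (f ≫ g)).hom ≫ e a ◁ (G.mapComp f g).hom := by
  rw [mapComp, IsUniversal.map₂_liftIso_hom]
  simp [paste]

theorem paste_hom {a b c : B} (f : a ⟶ b) (g : b ⟶ c) :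
    (paste h f g).hom = (y.mapComp (map h f) (map h g)).hom ▷ e c ≫ (α_ _ _ _).hom ≫
      y.map (map h f) ◁ (natIso h g).hom ≫ (α_ _ _ _).inv ≫ (natIso h f).hom ▷ G.map g ≫
      (α_ _ _ _).hom := by
  simp [paste]

theorem whiskerLeft_paste {a b c : B} (f : a ⟶ b) {g g' : b ⟶ c} (η : g ⟶ g') :
    y.map₂ (map h f ◁ map₂ h η) ▷ e c ≫ (paste h f g').hom =
      (paste h f g).hom ≫ e a ◁ G.map f ◁ G.map₂ η := by
  have h1 := congrArg (y.map (map h f) ◁ ·) (map₂_spec h η)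
  simp only [whiskerLeft_comp] at h1
  simp [paste_hom, reassoc_of% h1, whiskerRight_exchange]

theorem whiskerRight_paste {a b c : B} {f f' : a ⟶ b} (η : f ⟶ f') (g : b ⟶ c) :
    y.map₂ (map₂ h η ▷ map h g) ▷ e c ≫ (paste h f' g).hom =
      (paste h f g).hom ≫ e a ◁ G.map₂ η ▷ G.map g := by
  have h1 := congrArg (· ▷ G.map g) (map₂_spec h η) =≫ (α_ _ _ _).hom
  simp only [comp_whiskerRight, Category.assoc, whisker_assoc, Iso.inv_hom_id,
    Category.comp_id] at h1
  simp [paste_hom, ← h1, reassoc_of% whiskerLeft_exchange]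

theorem leftUnitor_paste {a b : B} (f : a ⟶ b) :
    y.map₂ ((mapId h a).hom ▷ map h f ≫ (λ_ _).hom) ▷ e b ≫ (natIso h f).hom =
      (paste h (𝟙 a) f).hom ≫ e a ◁ ((G.mapId a).hom ▷ G.map f ≫ (λ_ _).hom) := by
  have h1 := congrArg (· ▷ G.map f) (mapId_spec h a) =≫ (α_ _ _ _).hom
  simp only [comp_whiskerRight, Category.assoc, whisker_assoc, Iso.inv_hom_id,
    Category.comp_id] at h1
  simp only [paste_hom, whiskerLeft_comp, Category.assoc, ← reassoc_of% h1]
  simp [reassoc_of% whiskerLeft_exchange]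

theorem rightUnitor_paste {a b : B} (f : a ⟶ b) :
    y.map₂ (map h f ◁ (mapId h b).hom ≫ (ρ_ _).hom) ▷ e b ≫ (natIso h f).hom =
      (paste h f (𝟙 b)).hom ≫ e a ◁ (G.map f ◁ (G.mapId b).hom ≫ (ρ_ _).hom) := by
  have h1 := congrArg (y.map (map h f) ◁ ·) (mapId_spec h b)
  simp only [whiskerLeft_comp] at h1
  simp only [paste_hom, whiskerLeft_comp, Category.assoc, reassoc_of% whiskerRight_exchange,
    Iso.inv_hom_id_assoc]
  rw [← reassoc_of% h1]
  simp

/-- The isomorphism `y (L f ≫ L g ≫ L k) ≫ e ≅ e ≫ G f ≫ G g ≫ G k` obtained by pasting. -/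
noncomputable def paste₃ {a b c d : B} (f : a ⟶ b) (g : b ⟶ c) (k : c ⟶ d) :
    y.map (map h f ≫ map h g ≫ map h k) ≫ e d ≅ e a ≫ G.map f ≫ G.map g ≫ G.map k :=
  whiskerRightIso (y.mapComp _ _) (e d) ≪≫ α_ _ _ _ ≪≫
    whiskerLeftIso (y.map (map h f)) (paste h g k) ≪≫ (α_ _ _ _).symm ≪≫
    whiskerRightIso (natIso h f) (G.map g ≫ G.map k) ≪≫ α_ _ _ _

theorem paste₃_hom {a b c d : B} (f : a ⟶ b) (g : b ⟶ c) (k : c ⟶ d) :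
    (paste₃ h f g k).hom = (y.mapComp _ _).hom ▷ e d ≫ (α_ _ _ _).hom ≫
      y.map (map h f) ◁ (paste h g k).hom ≫ (α_ _ _ _).inv ≫
      (natIso h f).hom ▷ (G.map g ≫ G.map k) ≫ (α_ _ _ _).hom := by
  simp [paste₃]

theorem whiskerLeft_mapComp_paste₃ {a b c d : B} (f : a ⟶ b) (g : b ⟶ c) (k : c ⟶ d) :
    y.map₂ (map h f ◁ (mapComp h g k).hom) ▷ e d ≫ (paste₃ h f g k).hom =
      (paste h f (g ≫ k)).hom ≫ e a ◁ G.map f ◁ (G.mapComp g k).hom := by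
  have h1 := congrArg (y.map (map h f) ◁ ·) (mapComp_spec h g k)
  simp only [whiskerLeft_comp] at h1
  simp only [paste₃_hom]
  rw [paste_hom h f (g ≫ k)]
  simp [reassoc_of% h1, whiskerRight_exchange]

theorem whiskerRight_mapComp_paste₃ {a b c d : B} (f : a ⟶ b) (g : b ⟶ c) (k : c ⟶ d) :
    y.map₂ ((mapComp h f g).hom ▷ map h k ≫ (α_ _ _ _).hom) ▷ e d ≫ (paste₃ h f g k).hom =
      (paste h (f ≫ g) k).hom ≫ e a ◁ ((G.mapComp f g).hom ▷ G.map k ≫ (α_ _ _ _).hom) := by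
  have h1 := congrArg (· ▷ G.map k) (mapComp_spec h f g) =≫ (α_ _ _ _).hom
  simp only [comp_whiskerRight, Category.assoc, whisker_assoc, Iso.inv_hom_id,
    Category.comp_id] at h1
  rw [paste_hom h (f ≫ g) k]
  simp only [paste₃_hom, whiskerLeft_comp, Category.assoc, ← reassoc_of% h1]
  simp only [paste_hom, whiskerLeft_comp, Category.assoc, comp_whiskerRight]
  simp [reassoc_of% whiskerLeft_exchange]

theorem map₂_id {a b : B} (f : a ⟶ b) : map₂ h (𝟙 f) = 𝟙 _ := by
  apply (h b).hom_ext
  rw [← cancel_mono (natIso h f).hom, map₂_spec]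
  simp

theorem map₂_comp {a b : B} {f f' f'' : a ⟶ b} (η : f ⟶ f') (θ : f' ⟶ f'') :
    map₂ h (η ≫ θ) = map₂ h η ≫ map₂ h θ := by
  apply (h b).hom_ext
  rw [← cancel_mono (natIso h f'').hom, map₂_spec]
  simp [map₂_spec, reassoc_of% map₂_spec]

theorem whisker_left {a b c : B} (f : a ⟶ b) {g g' : b ⟶ c} (η : g ⟶ g') :
    map₂ h (f ◁ η) ≫ (mapComp h f g').hom = (mapComp h f g).hom ≫ map h f ◁ map₂ h η := by
  apply (h c).hom_ext
  rw [← cancel_mono (paste h f g').hom]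
  simp only [PrelaxFunctor.map₂_comp, comp_whiskerRight, Category.assoc, mapComp_spec,
    whiskerLeft_paste, reassoc_of% mapComp_spec, reassoc_of% map₂_spec]
  simp

theorem whisker_right {a b c : B} {f f' : a ⟶ b} (η : f ⟶ f') (g : b ⟶ c) :
    map₂ h (η ▷ g) ≫ (mapComp h f' g).hom = (mapComp h f g).hom ≫ map₂ h η ▷ map h g := by
  apply (h c).hom_ext
  rw [← cancel_mono (paste h f' g).hom]
  simp only [PrelaxFunctor.map₂_comp, comp_whiskerRight, Category.assoc, mapComp_spec,
    whiskerRight_paste, reassoc_of% mapComp_spec, reassoc_of% map₂_spec]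
  simp

theorem left_unitor {a b : B} (f : a ⟶ b) :
    map₂ h (λ_ f).hom = (mapComp h (𝟙 a) f).hom ≫ (mapId h a).hom ▷ map h f ≫ (λ_ _).hom := by
  apply (h b).hom_ext
  rw [← cancel_mono (natIso h f).hom, map₂_spec, PrelaxFunctor.map₂_comp, comp_whiskerRight,
    Category.assoc, leftUnitor_paste, reassoc_of% mapComp_spec, ← whiskerLeft_comp]
  simp

theorem right_unitor {a b : B} (f : a ⟶ b) :
    map₂ h (ρ_ f).hom = (mapComp h f (𝟙 b)).hom ≫ map h f ◁ (mapId h b).hom ≫ (ρ_ _).hom := by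
  apply (h b).hom_ext
  rw [← cancel_mono (natIso h f).hom, map₂_spec, PrelaxFunctor.map₂_comp, comp_whiskerRight,
    Category.assoc, rightUnitor_paste, reassoc_of% mapComp_spec, ← whiskerLeft_comp]
  simp

theorem associator {a b c d : B} (f : a ⟶ b) (g : b ⟶ c) (k : c ⟶ d) :
    map₂ h (α_ f g k).hom ≫ (mapComp h f (g ≫ k)).hom ≫ map h f ◁ (mapComp h g k).hom =
      (mapComp h (f ≫ g) k).hom ≫ (mapComp h f g).hom ▷ map h k ≫ (α_ _ _ _).hom := by
  apply (h d).hom_ext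
  rw [← cancel_mono (paste₃ h f g k).hom]
  rw [PrelaxFunctor.map₂_comp, PrelaxFunctor.map₂_comp, PrelaxFunctor.map₂_comp,
    comp_whiskerRight, comp_whiskerRight, comp_whiskerRight, Category.assoc, Category.assoc,
    Category.assoc, whiskerLeft_mapComp_paste₃, whiskerRight_mapComp_paste₃,
    reassoc_of% mapComp_spec, reassoc_of% mapComp_spec, reassoc_of% map₂_spec]
  simp [← whiskerLeft_comp]

end UniversalLift

/-- Universal arrows `e b : y (P b) ⟶ G b` make `b ↦ P b` into a pseudofunctor; on objects it is
`P` on the nose. -/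
noncomputable def universalLift : B ⥤ᵖ H where
  obj := P
  map := UniversalLift.map h
  map₂ := UniversalLift.map₂ h
  map₂_id := UniversalLift.map₂_id h
  map₂_comp := UniversalLift.map₂_comp h
  mapId := UniversalLift.mapId h
  mapComp := UniversalLift.mapComp h
  map₂_whisker_left f _ _ η := by
    rw [← reassoc_of% UniversalLift.whisker_left]; simp
  map₂_whisker_right η g := by
    rw [← reassoc_of% UniversalLift.whisker_right]; simp
  map₂_associator f g k := by
    rw [← reassoc_of% UniversalLift.associator]; simp
  map₂_left_unitor := UniversalLift.left_unitor h
  map₂_right_unitor := UniversalLift.right_unitor h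

/-- The universal arrows `e b` are the components of a pseudonatural transformation. -/
noncomputable def universalLiftArrow : (universalLift h).comp y ⟶ G where
  app := e
  naturality := UniversalLift.natIso h
  naturality_naturality := UniversalLift.map₂_spec h
  naturality_id a := by
    have := UniversalLift.mapId_spec h a
    rw [← comp_whiskerRight_assoc] at this
    exact this.symm
  naturality_comp {_ _ c} f g := by
    have := UniversalLift.mapComp_spec h f g
    rw [UniversalLift.paste_hom, ← comp_whiskerRight_assoc] at this
    exact this.symm

end Lift
end Universal

/-! ### Pointwise universal transformations -/

section Trans

variable {H : Type u₁} [Bicategory.{w₁, v₁} H] {K : Type u₂} [Bicategory.{w₂, v₂} K]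
  {B : Type u₃} [Bicategory.{w₃, v₃} B]

/-- The whiskering `y α : y S ⟶ y L` of a pseudonatural transformation `α : S ⟶ L`. -/
def whiskerTrans (y : H ⥤ᵖ K) {S L : B ⥤ᵖ H} (α : S ⟶ L) : S.comp y ⟶ L.comp y where
  app b := y.map (α.app b)
  naturality f := (y.mapComp _ _).symm ≪≫ y.map₂Iso (α.naturality f) ≪≫ y.mapComp _ _
  naturality_naturality η := map_naturality_aux y α η
  naturality_id a := map_naturality_id_aux y α a
  naturality_comp f g := map_naturality_comp_aux y α f g

/-- The whiskering of a modification with `y`. -/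
def whiskerTrans₂ (y : H ⥤ᵖ K) {S L : B ⥤ᵖ H} {α β : S ⟶ L} (Γ : α ⟶ β) :
    whiskerTrans y α ⟶ whiskerTrans y β where
  as :=
    { app b := y.map₂ (Γ.as.app b)
      naturality {a b} f := by
        have h := congrArg y.map₂ (Γ.as.naturality f)
        simp only [PrelaxFunctor.map₂_comp, map₂_whisker_left, map₂_whisker_right,
          Category.assoc] at h
        have : y.map (S.map f) ◁ y.map₂ (Γ.as.app b) ≫ (y.mapComp (S.map f) (β.app b)).inv ≫
            y.map₂ (β.naturality f).hom ≫ (y.mapComp (β.app a) (L.map f)).hom =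
            ((y.mapComp (S.map f) (α.app b)).inv ≫ y.map₂ (α.naturality f).hom ≫
              (y.mapComp (α.app a) (L.map f)).hom) ≫ y.map₂ (Γ.as.app a) ▷ y.map (L.map f) := by
          rw [← cancel_epi (y.mapComp (S.map f) (α.app b)).hom]
          simp [reassoc_of% h]
        exact this }

section

variable {y : H ⥤ᵖ K} {L : B ⥤ᵖ H} {G : B ⥤ᵖ K} (e : L.comp y ⟶ G)

/-- The functor `[B, H](S, L) ⥤ [B, K](y S, G)`, `α ↦ y α ≫ e`, induced by `e : y L ⟶ G`. -/
def transComparison (S : B ⥤ᵖ H) : (S ⟶ L) ⥤ (S.comp y ⟶ G) where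
  obj α := whiskerTrans y α ≫ e
  map Γ := whiskerTrans₂ y Γ ▷ e
  map_id α := StrongTrans.homCategory.ext fun b => by
    have {Z : K} (x : y.obj (L.obj b) ⟶ Z) : y.map₂ (𝟙 (α.app b)) ▷ x = 𝟙 _ := by simp
    exact this _
  map_comp {α β γ} Γ Θ := StrongTrans.homCategory.ext fun b => by
    have {Z : K} (x : y.obj (L.obj b) ⟶ Z) : y.map₂ (Γ.as.app b ≫ Θ.as.app b) ▷ x =
      y.map₂ (Γ.as.app b) ▷ x ≫ y.map₂ (Θ.as.app b) ▷ x := by simp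
    exact this _

end

theorem map₂_hom_inv_whiskerRight (y : H ⥤ᵖ K) {X P : H} {Z : K} {v v' : X ⟶ P} (i : v ≅ v')
    (x : y.obj P ⟶ Z) : y.map₂ i.hom ▷ x ≫ y.map₂ i.inv ▷ x = 𝟙 _ := by
  simp [← comp_whiskerRight, ← PrelaxFunctor.map₂_comp]

theorem map₂_inv_hom_whiskerRight (y : H ⥤ᵖ K) {X P : H} {Z : K} {v v' : X ⟶ P} (i : v ≅ v')
    (x : y.obj P ⟶ Z) : y.map₂ i.inv ▷ x ≫ y.map₂ i.hom ▷ x = 𝟙 _ :=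
  map₂_hom_inv_whiskerRight y i.symm x

/-- A pseudonatural transformation `y L ⟶ G` given by its components, with the data and laws of the
composite pseudofunctor `y L` spelled out: this is `StrongTrans` up to the definitional unfolding
of `L.comp y`, in a form on which rewriting works. -/
structure CompTrans (y : H ⥤ᵖ K) (L : B ⥤ᵖ H) (G : B ⥤ᵖ K) where
  /-- The components. -/
  app (b : B) : y.obj (L.obj b) ⟶ G.obj b
  /-- The naturality isomorphisms. -/
  nat {b b' : B} (g : b ⟶ b') : y.map (L.map g) ≫ app b' ≅ app b ≫ G.map g
  nat_nat {b b' : B} {g g' : b ⟶ b'} (η : g ⟶ g') :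
    y.map₂ (L.map₂ η) ▷ app b' ≫ (nat g').hom = (nat g).hom ≫ app b ◁ G.map₂ η
  nat_id (b : B) :
    (nat (𝟙 b)).hom ≫ app b ◁ (G.mapId b).hom =
      y.map₂ (L.mapId b).hom ▷ app b ≫ (y.mapId (L.obj b)).hom ▷ app b ≫
        (λ_ (app b)).hom ≫ (ρ_ (app b)).inv
  nat_comp {a b c : B} (f : a ⟶ b) (g : b ⟶ c) :
    (nat (f ≫ g)).hom ≫ app a ◁ (G.mapComp f g).hom =
      y.map₂ (L.mapComp f g).hom ▷ app c ≫ (y.mapComp (L.map f) (L.map g)).hom ▷ app c ≫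
        (α_ _ _ _).hom ≫ y.map (L.map f) ◁ (nat g).hom ≫ (α_ _ _ _).inv ≫
        (nat f).hom ▷ G.map g ≫ (α_ _ _ _).hom

namespace CompTrans

variable {y : H ⥤ᵖ K} {L : B ⥤ᵖ H} {G : B ⥤ᵖ K}

/-- The pseudonatural transformation with the given components. -/
def toTrans (e : CompTrans y L G) : L.comp y ⟶ G where
  app := e.app
  naturality := e.nat
  naturality_naturality := e.nat_nat
  naturality_id a := by
    have := e.nat_id a
    rw [← comp_whiskerRight_assoc] at this
    exact this
  naturality_comp f g := by
    have := e.nat_comp f g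
    rw [← comp_whiskerRight_assoc] at this
    exact this

/-- The components of a pseudonatural transformation `y L ⟶ G`. -/
def ofTrans (e : L.comp y ⟶ G) : CompTrans y L G where
  app := e.app
  nat := e.naturality
  nat_nat := e.naturality_naturality
  nat_id b := by
    refine (e.naturality_id b).trans ?_
    -- stated for a variable `x`, so that `simp` does not see through `L.comp y`
    have (x : y.obj (L.obj b) ⟶ G.obj b) : (y.map₂ (L.mapId b).hom ≫ (y.mapId _).hom) ▷ x ≫
        (λ_ x).hom ≫ (ρ_ x).inv = y.map₂ (L.mapId b).hom ▷ x ≫ (y.mapId _).hom ▷ x ≫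
        (λ_ x).hom ≫ (ρ_ x).inv := by simp
    exact this _
  nat_comp {a b c} f g := by
    refine (e.naturality_comp f g).trans ?_
    have {Z : K} (x : y.obj (L.obj c) ⟶ Z) {W} (z : _ ⟶ W) :
        (y.map₂ (L.mapComp f g).hom ≫ (y.mapComp _ _).hom) ▷ x ≫ z =
        y.map₂ (L.mapComp f g).hom ▷ x ≫ (y.mapComp _ _).hom ▷ x ≫ z := by simp
    exact this _ _

section Paste

variable (e : CompTrans y L G)

/-- The isomorphism `y (v ≫ L g) ≫ e ≅ (y v ≫ e) ≫ G g`. -/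
def pasteIso {X : H} {b b' : B} (v : X ⟶ L.obj b) (g : b ⟶ b') :
    y.map (v ≫ L.map g) ≫ e.app b' ≅ (y.map v ≫ e.app b) ≫ G.map g :=
  whiskerRightIso (y.mapComp _ _) _ ≪≫ α_ _ _ _ ≪≫ whiskerLeftIso (y.map v) (e.nat g) ≪≫
    (α_ _ _ _).symm

theorem pasteIso_hom {X : H} {b b' : B} (v : X ⟶ L.obj b) (g : b ⟶ b') :
    (e.pasteIso v g).hom = (y.mapComp v (L.map g)).hom ▷ e.app b' ≫
      (α_ (y.map v) (y.map (L.map g)) (e.app b')).hom ≫ y.map v ◁ (e.nat g).hom ≫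
      (α_ _ _ _).inv :=
  rfl

theorem pasteIso_naturality_right {X : H} {b b' : B} (v : X ⟶ L.obj b) {g g' : b ⟶ b'}
    (η : g ⟶ g') : y.map₂ (v ◁ L.map₂ η) ▷ e.app b' ≫ (e.pasteIso v g').hom =
      (e.pasteIso v g).hom ≫ (y.map v ≫ e.app b) ◁ G.map₂ η := by
  have h1 := congrArg (y.map v ◁ ·) (e.nat_nat η)
  simp only [whiskerLeft_comp] at h1
  simp [pasteIso_hom, reassoc_of% h1]

theorem pasteIso_naturality_left {X : H} {b b' : B} {v v' : X ⟶ L.obj b} (σ : v ⟶ v')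
    (g : b ⟶ b') : y.map₂ (σ ▷ L.map g) ▷ e.app b' ≫ (e.pasteIso v' g).hom =
      (e.pasteIso v g).hom ≫ y.map₂ σ ▷ e.app b ▷ G.map g := by
  simp [pasteIso_hom, whiskerLeft_exchange]

theorem pasteIso_id {X : H} {b : B} (v : X ⟶ L.obj b) :
    (e.pasteIso v (𝟙 b)).hom ≫ (y.map v ≫ e.app b) ◁ (G.mapId b).hom ≫ (ρ_ _).hom =
      y.map₂ (v ◁ (L.mapId b).hom ≫ (ρ_ v).hom) ▷ e.app b := by
  have h1 := congrArg (y.map v ◁ ·) (e.nat_id b)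
  simp only [whiskerLeft_comp] at h1
  simp [pasteIso_hom, reassoc_of% h1]

theorem pasteIso_comp {X : H} {a b c : B} (v : X ⟶ L.obj a) (f : a ⟶ b) (g : b ⟶ c) :
    (e.pasteIso v (f ≫ g)).hom ≫ (y.map v ≫ e.app a) ◁ (G.mapComp f g).hom ≫ (α_ _ _ _).inv =
      y.map₂ (v ◁ (L.mapComp f g).hom ≫ (α_ _ _ _).inv) ▷ e.app c ≫
        (e.pasteIso (v ≫ L.map f) g).hom ≫ (e.pasteIso v f).hom ▷ G.map g := by
  have h1 := congrArg (y.map v ◁ ·) (e.nat_comp f g)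
  simp only [whiskerLeft_comp] at h1
  simp [pasteIso_hom, reassoc_of% h1, reassoc_of% whiskerLeft_exchange, map₂_associator_inv']

/-- Compatibility of `pasteIso` with composition on the left. -/
theorem pasteIso_pre {X Y : H} {b b' : B} (u : Y ⟶ X) (v : X ⟶ L.obj b) (g : b ⟶ b') :
    y.map₂ (α_ u v (L.map g)).inv ▷ e.app b' ≫ (e.pasteIso (u ≫ v) g).hom ≫
      (y.mapComp u v).hom ▷ e.app b ▷ G.map g ≫ (α_ _ _ _).hom ▷ G.map g =
    (y.mapComp _ _).hom ▷ e.app b' ≫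
      (α_ _ _ _).hom ≫ y.map u ◁ (e.pasteIso v g).hom ≫ (α_ _ _ _).inv := by
  simp [pasteIso_hom, reassoc_of% whiskerLeft_exchange, map₂_associator_inv']

end Paste

section Lift

variable {e : CompTrans y L G} (h : ∀ b, IsUniversal y (e.app b)) {S : B ⥤ᵖ H}
  (β : CompTrans y S G)

/-- The naturality isomorphism of the lift of `β : y S ⟶ G` along `e`. -/
noncomputable def liftNat {b b' : B} (g : b ⟶ b') :
    S.map g ≫ (h b').lift (β.app b') ≅ (h b).lift (β.app b) ≫ L.map g :=
  (h b').liftIso (whiskerRightIso (y.mapComp _ _) _ ≪≫ α_ _ _ _ ≪≫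
    whiskerLeftIso _ ((h b').fac _) ≪≫ β.nat g ≪≫ whiskerRightIso ((h b).fac _).symm _ ≪≫
    (e.pasteIso _ g).symm)

theorem liftNat_spec {b b' : B} (g : b ⟶ b') :
    y.map₂ (liftNat h β g).hom ▷ e.app b' ≫ (e.pasteIso _ g).hom ≫
      ((h b).fac (β.app b)).hom ▷ G.map g =
    (y.mapComp _ _).hom ▷ e.app b' ≫ (α_ _ _ _).hom ≫
      y.map (S.map g) ◁ ((h b').fac (β.app b')).hom ≫ (β.nat g).hom := by
  simp [liftNat]

/-- The lift of `β : y S ⟶ G` along `e : y L ⟶ G`. -/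
noncomputable def lift : S ⟶ L where
  app b := (h b).lift (β.app b)
  naturality g := liftNat h β g
  naturality_naturality {b b' g g'} η := by
    apply (h b').hom_ext
    rw [← cancel_mono ((e.pasteIso _ g').hom ≫ ((h b).fac (β.app b)).hom ▷ G.map g')]
    rw [PrelaxFunctor.map₂_comp, comp_whiskerRight, Category.assoc, liftNat_spec,
      PrelaxFunctor.map₂_comp, comp_whiskerRight, Category.assoc,
      reassoc_of% pasteIso_naturality_right, whisker_exchange, reassoc_of% liftNat_spec,
      ← β.nat_nat]
    simp [reassoc_of% whiskerLeft_exchange']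
  naturality_id b := by
    apply (h b).hom_ext
    rw [← cancel_mono (y.map₂ (ρ_ ((h b).lift (β.app b))).hom ▷ e.app b ≫
      ((h b).fac (β.app b)).hom)]
    have h1 := e.pasteIso_id ((h b).lift (β.app b)) =≫ ((h b).fac (β.app b)).hom
    simp only [PrelaxFunctor.map₂_comp, comp_whiskerRight, Category.assoc] at h1 ⊢
    rw [← h1, ← rightUnitor_naturality, whisker_exchange_assoc, reassoc_of% liftNat_spec,
      reassoc_of% β.nat_id b, reassoc_of% map₂_inv_hom_whiskerRight]
    simp [reassoc_of% whiskerLeft_exchange']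
  naturality_comp {a b c} f g := by
    apply (h c).hom_ext
    rw [← cancel_mono (y.map₂ (α_ _ _ _).inv ▷ e.app c ≫ (e.pasteIso _ g).hom ≫
      (e.pasteIso _ f).hom ▷ G.map g ≫ ((h a).fac (β.app a)).hom ▷ G.map f ▷ G.map g)]
    have h1 := e.pasteIso_comp ((h a).lift (β.app a)) f g =≫
      ((h a).fac (β.app a)).hom ▷ G.map f ▷ G.map g
    have h2 := congrArg (· ▷ G.map g) (liftNat_spec h β f)
    have h3 := congrArg (y.map (S.map f) ◁ ·) (liftNat_spec h β g)
    simp only [PrelaxFunctor.map₂_comp, comp_whiskerRight, whiskerLeft_comp,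
      Category.assoc] at h1 h2 h3 ⊢
    have h4 : y.map₂ (α_ (S.map f) (S.map g) ((h c).lift (β.app c))).hom ▷ e.app c ≫
        (y.mapComp _ _).hom ▷ e.app c ≫ (α_ _ _ _).hom ≫
          y.map (S.map f) ◁ (y.mapComp _ _).hom ▷ e.app c = (y.mapComp _ _).hom ▷ e.app c ≫
        (y.mapComp _ _).hom ▷ _ ▷ e.app c ≫ (α_ _ _ _).hom ▷ e.app c ≫ (α_ _ _ _).hom := by
      simp
    rw [← h1, ← associator_inv_naturality_left, whisker_exchange_assoc, reassoc_of% liftNat_spec,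
      reassoc_of% β.nat_comp, reassoc_of% map₂_hom_inv_whiskerRight,
      reassoc_of% pasteIso_naturality_left, h2, reassoc_of% pasteIso_pre]
    simp only [map₂_whisker_left, comp_whiskerRight, Category.assoc, whisker_assoc,
      Iso.inv_hom_id_assoc, ← comp_whiskerRight_assoc (y.mapComp _ _).inv, Iso.inv_hom_id,
      id_whiskerRight, Category.id_comp, reassoc_of% h3, reassoc_of% h4, map₂_whisker_right]
    simp [reassoc_of% whiskerLeft_exchange']

theorem nonempty_whiskerTrans_lift_iso :
    Nonempty (whiskerTrans y (lift h β) ≫ e.toTrans ≅ β.toTrans) := by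
  refine ⟨StrongTrans.isoMk (fun b => (h b).fac (β.app b)) fun {b b'} f => ?_⟩
  have h1 := liftNat_spec h β f
  have h2 : y.map (S.map f) ◁ ((h b').fac (β.app b')).hom ≫ (β.nat f).hom =
    ((α_ _ _ _).inv ≫ ((y.mapComp _ _).inv ≫ y.map₂ (liftNat h β f).hom ≫
      (y.mapComp _ _).hom) ▷ e.app b' ≫ (α_ _ _ _).hom ≫ _ ◁ (e.nat f).hom ≫ (α_ _ _ _).inv) ≫
      ((h b).fac (β.app b)).hom ▷ G.map f := by
    rw [← cancel_epi (α_ _ _ _).hom, ← cancel_epi ((y.mapComp _ _).hom ▷ e.app b'), ← h1]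
    simp [pasteIso_hom]
  exact h2

end Lift

section Comparison

variable {e : CompTrans y L G} {S : B ⥤ᵖ H}

theorem faithful_transComparison (h : ∀ b, IsUniversal y (e.app b)) :
    (transComparison e.toTrans S).Faithful where
  map_injective {_ _ _ _} w := StrongTrans.homCategory.ext fun b =>
    (h b).hom_ext (congrArg (fun m => m.as.app b) w)

theorem full_transComparison (h : ∀ b, IsUniversal y (e.app b)) :
    (transComparison e.toTrans S).Full where
  map_surjective {α β} m := by
    let m' (b : B) : y.map (α.app b) ≫ e.app b ⟶ y.map (β.app b) ≫ e.app b := m.as.app b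
    refine ⟨⟨⟨fun b => (h b).lift₂ (m' b), fun {b b'} f => ?_⟩⟩,
      StrongTrans.homCategory.ext fun b => (h b).map₂_lift₂ _⟩
    apply (h b').hom_ext
    have h0 : y.map (S.map f) ◁ m' b' ≫ ((α_ _ _ _).inv ≫ ((y.mapComp _ _).inv ≫
        y.map₂ (β.naturality f).hom ≫
      (y.mapComp _ _).hom) ▷ e.app b' ≫ (α_ _ _ _).hom ≫ _ ◁ (e.nat f).hom ≫ (α_ _ _ _).inv) =
      ((α_ _ _ _).inv ≫ ((y.mapComp _ _).inv ≫ y.map₂ (α.naturality f).hom ≫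
      (y.mapComp _ _).hom) ▷ e.app b' ≫ (α_ _ _ _).hom ≫ _ ◁ (e.nat f).hom ≫ (α_ _ _ _).inv) ≫
      m' b ▷ G.map f := m.as.naturality f
    rw [← cancel_mono (e.pasteIso _ f).hom, PrelaxFunctor.map₂_comp, comp_whiskerRight,
      PrelaxFunctor.map₂_comp, comp_whiskerRight, Category.assoc, Category.assoc,
      pasteIso_naturality_left, (h b).map₂_lift₂]
    rw [← cancel_epi (α_ _ _ _).hom, ← cancel_epi ((y.mapComp _ _).hom ▷ e.app b')] at h0
    simp only [Category.assoc, Iso.hom_inv_id_assoc, comp_whiskerRight,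
      ← comp_whiskerRight_assoc (y.mapComp _ _).hom, Iso.hom_inv_id, id_whiskerRight,
      Category.id_comp] at h0
    simp [pasteIso_hom, ← h0]

/-- A transformation `e : y L ⟶ G` whose components are universal arrows is itself universal:
every transformation `y S ⟶ G` factors through `e`, uniquely up to a unique isomorphism. -/
theorem isEquivalence_transComparison (h : ∀ b, IsUniversal y (e.app b)) :
    (transComparison e.toTrans S).IsEquivalence where
  faithful := faithful_transComparison h
  full := full_transComparison h
  essSurj := ⟨fun β => ⟨lift h (ofTrans β), nonempty_whiskerTrans_lift_iso h (ofTrans β)⟩⟩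

end Comparison

end CompTrans

end Trans

/-! ### Equivalences in a bicategory -/

section Equivalences

variable {K : Type u₁} [Bicategory.{w₁, v₁} K]

/-- A 1-cell is an equivalence if it has an inverse up to invertible 2-cells. -/
def IsEquiv {a b : K} (f : a ⟶ b) : Prop :=
  ∃ g : b ⟶ a, Nonempty (𝟙 a ≅ f ≫ g) ∧ Nonempty (g ≫ f ≅ 𝟙 b)

theorem isEquiv_hom {a b : K} (E : a ≌ b) : IsEquiv E.hom :=
  ⟨E.inv, ⟨E.unit⟩, ⟨E.counit⟩⟩

theorem IsEquiv.exists_hom_eq {a b : K} {f : a ⟶ b} (h : IsEquiv f) : ∃ E : a ≌ b, E.hom = f := by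
  obtain ⟨g, ⟨η⟩, ⟨θ⟩⟩ := h
  exact ⟨Equivalence.mkOfAdjointifyCounit η θ, rfl⟩

theorem IsEquiv.isEquivalence_postcomp {a b : K} {f : a ⟶ b} (h : IsEquiv f) (S : K) :
    (postcomp S f).IsEquivalence := by
  obtain ⟨g, ⟨η⟩, ⟨θ⟩⟩ := h
  refine .mk' (postcomp S g) (NatIso.ofComponents
      (fun x => (ρ_ x).symm ≪≫ whiskerLeftIso x η ≪≫ (α_ _ _ _).symm) fun {x y} σ => ?_)
    (NatIso.ofComponents
      (fun x => α_ _ _ _ ≪≫ whiskerLeftIso x θ ≪≫ ρ_ x) fun {x y} σ => ?_)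
  · have : σ ≫ (ρ_ y).inv ≫ y ◁ η.hom ≫ (α_ y f g).inv =
        ((ρ_ x).inv ≫ x ◁ η.hom ≫ (α_ x f g).inv) ≫ σ ▷ f ▷ g := by
      rw [rightUnitor_inv_naturality_assoc, ← whisker_exchange_assoc]; simp
    exact this
  · have : σ ▷ g ▷ f ≫ (α_ y g f).hom ≫ y ◁ θ.hom ≫ (ρ_ y).hom =
        ((α_ x g f).hom ≫ x ◁ θ.hom ≫ (ρ_ x).hom) ≫ σ := by
      rw [associator_naturality_left_assoc, ← whisker_exchange_assoc, rightUnitor_naturality]; simp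
    exact this

theorem IsEquiv.isEquivalence_precomp {a b : K} {f : a ⟶ b} (h : IsEquiv f) (S : K) :
    (precomp S f).IsEquivalence := by
  obtain ⟨g, ⟨η⟩, ⟨θ⟩⟩ := h
  refine .mk' (precomp S g) (NatIso.ofComponents
      (fun x => (λ_ x).symm ≪≫ whiskerRightIso θ.symm x ≪≫ α_ _ _ _) fun {x y} σ => ?_)
    (NatIso.ofComponents
      (fun x => (α_ _ _ _).symm ≪≫ whiskerRightIso η.symm x ≪≫ λ_ x) fun {x y} σ => ?_)
  · have : σ ≫ (λ_ y).inv ≫ θ.inv ▷ y ≫ (α_ g f y).hom =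
        ((λ_ x).inv ≫ θ.inv ▷ x ≫ (α_ g f x).hom) ≫ g ◁ f ◁ σ := by
      rw [leftUnitor_inv_naturality_assoc, whisker_exchange_assoc]; simp
    exact this
  · have : f ◁ g ◁ σ ≫ (α_ f g y).inv ≫ η.inv ▷ y ≫ (λ_ y).hom =
        ((α_ f g x).inv ≫ η.inv ▷ x ≫ (λ_ x).hom) ≫ σ := by
      rw [associator_inv_naturality_right_assoc, whisker_exchange_assoc, leftUnitor_naturality]
      simp
    exact this

theorem isEquiv_of_isEquivalence_postcomp {a b : K} {f : a ⟶ b}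
    (h : ∀ S, (postcomp S f).IsEquivalence) : IsEquiv f := by
  have := h a
  have := h b
  refine ⟨(postcomp b f).objPreimage (𝟙 b), ⟨(postcomp a f).preimageIso ?_⟩,
    ⟨(postcomp b f).objObjPreimageIso (𝟙 b)⟩⟩
  exact λ_ f ≪≫ (ρ_ f).symm ≪≫ whiskerLeftIso f ((postcomp b f).objObjPreimageIso (𝟙 b)).symm ≪≫
    (α_ _ _ _).symm

theorem isEquiv_toCatHom {C D : Cat.{v, u}} {F : C ⟶ D} (h : F.toFunctor.IsEquivalence) :
    IsEquiv F :=
  ⟨(F.toFunctor.asEquivalence).inverse.toCatHom,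
    ⟨Cat.Hom.isoMk F.toFunctor.asEquivalence.unitIso⟩,
    ⟨Cat.Hom.isoMk F.toFunctor.asEquivalence.counitIso⟩⟩

theorem IsEquiv.isEquivalence_toFunctor {C D : Cat.{v, u}} {F : C ⟶ D} (h : IsEquiv F) :
    F.toFunctor.IsEquivalence := by
  obtain ⟨G, ⟨η⟩, ⟨θ⟩⟩ := h
  exact .mk' G.toFunctor (Cat.Hom.toNatIso η) (Cat.Hom.toNatIso θ)

variable {B : Type u₂} [Bicategory.{w₂, v₂} B]

theorem IsEquiv.app {F G : B ⥤ᵖ K} {α : F ⟶ G} (h : IsEquiv α) (b : B) : IsEquiv (α.app b) := by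
  obtain ⟨g, ⟨η⟩, ⟨θ⟩⟩ := h
  refine ⟨g.app b, ⟨⟨η.hom.as.app b, η.inv.as.app b, ?_, ?_⟩⟩,
    ⟨⟨θ.hom.as.app b, θ.inv.as.app b, ?_, ?_⟩⟩⟩
  · exact congrArg (fun m => m.as.app b) η.hom_inv_id
  · exact congrArg (fun m => m.as.app b) η.inv_hom_id
  · exact congrArg (fun m => m.as.app b) θ.hom_inv_id
  · exact congrArg (fun m => m.as.app b) θ.inv_hom_id

/-- A pseudonatural transformation `F ⟶ G`, viewed as a transformation from the composite of `F`
with the identity pseudofunctor. -/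
def compIdTrans {F G : B ⥤ᵖ K} (α : F ⟶ G) : CompTrans (Pseudofunctor.id K) F G where
  app := α.app
  nat := α.naturality
  nat_nat := α.naturality_naturality
  nat_id b := by
    have : (α.naturality (𝟙 b)).hom ≫ α.app b ◁ (G.mapId b).hom =
      (F.mapId b).hom ▷ α.app b ≫ 𝟙 _ ▷ α.app b ≫ (λ_ (α.app b)).hom ≫ (ρ_ (α.app b)).inv := by
      simp
    exact this
  nat_comp {a b c} f g := by
    have : (α.naturality (f ≫ g)).hom ≫ α.app a ◁ (G.mapComp f g).hom =
      (F.mapComp f g).hom ▷ α.app c ≫ 𝟙 _ ▷ α.app c ≫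
        (α_ _ _ _).hom ≫ F.map f ◁ (α.naturality g).hom ≫ (α_ _ _ _).inv ≫
        (α.naturality f).hom ▷ G.map g ≫ (α_ _ _ _).hom := by simp
    exact this

/-- A pseudonatural transformation whose components are equivalences is an equivalence. -/
theorem isEquiv_of_app {F G : B ⥤ᵖ K} {α : F ⟶ G} (h : ∀ b, IsEquiv (α.app b)) : IsEquiv α := by
  have hu (b : B) : IsUniversal (Pseudofunctor.id K) ((compIdTrans α).app b) :=
    ⟨fun S => (h b).isEquivalence_postcomp S⟩
  refine isEquiv_of_isEquivalence_postcomp fun S => ?_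
  -- `postcomp S α` and the comparison functor of `compIdTrans α` differ only by the constraints of
  -- the identity pseudofunctor, which `key` removes
  have hS := CompTrans.isEquivalence_transComparison hu (S := S)
  have key {β : S ⟶ F} {a b : B} (f : a ⟶ b) : ((whiskerTrans (Pseudofunctor.id K) β ≫
      (compIdTrans α).toTrans).naturality f).hom = ((β ≫ α).naturality f).hom := by
    have : (α_ (S.map f) (β.app b) (α.app b)).inv ≫ (𝟙 (S.map f ≫ β.app b) ≫
        (β.naturality f).hom ≫ 𝟙 (β.app a ≫ F.map f)) ▷ α.app b ≫ (α_ _ _ _).hom ≫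
          β.app a ◁ (α.naturality f).hom ≫
        (α_ _ _ _).inv = (α_ _ _ _).inv ≫ (β.naturality f).hom ▷ α.app b ≫ (α_ _ _ _).hom ≫
          β.app a ◁ (α.naturality f).hom ≫
        (α_ _ _ _).inv := by simp
    exact this
  refine { faithful := ⟨fun {β γ Γ Θ} w => ?_⟩, full := ⟨fun {β γ} m => ?_⟩,
           essSurj := ⟨fun β => ?_⟩ }
  · exact (transComparison (compIdTrans α).toTrans S).map_injective
      (StrongTrans.homCategory.ext fun b => congrArg (fun m => m.as.app b) w)
  · obtain ⟨Γ, hΓ⟩ := (transComparison (compIdTrans α).toTrans S).map_surjective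
      (X := β) (Y := γ) ⟨⟨m.as.app, fun {a b} f => by
        have := m.as.naturality f
        have h1 := key (β := β) f
        have h2 := key (β := γ) f
        exact (congrArg (_ ≫ ·) h2).trans (this.trans (congrArg (· ≫ _) h1.symm))⟩⟩
    exact ⟨Γ, StrongTrans.homCategory.ext fun b => congrArg (fun m => m.as.app b) hΓ⟩
  · obtain ⟨i⟩ := CompTrans.nonempty_whiskerTrans_lift_iso hu (compIdTrans β)
    refine ⟨CompTrans.lift hu (compIdTrans β), ⟨StrongTrans.isoMk (fun b => ⟨i.hom.as.app b,
      i.inv.as.app b, congrArg (fun m => m.as.app b) i.hom_inv_id,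
      congrArg (fun m => m.as.app b) i.inv_hom_id⟩) fun {a b} f => ?_⟩⟩
    exact (i.hom.as.naturality f).trans (congrArg (· ≫ _) (key f))

end Equivalences

/-! ### The Yoneda lemma -/

section Yoneda

variable {C : Type u} [Bicategory.{w, v} C]

section Orbit

variable (V : C ⥤ᵖ Cat.{w, v}) {c : C} (x : V.obj c)

/-- For `x : V c`, the functor `C(c, d) ⥤ V d`, `f ↦ V f x`. -/
def orbit (d : C) : (c ⟶ d) ⥤ V.obj d where
  obj f := (V.map f).toFunctor.obj x
  map η := (V.map₂ η).toNatTrans.app x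
  map_id f := by simp
  map_comp η θ := by simp

/-- The pseudonatural transformation `C(c, -) ⟶ V` corresponding to `x : V c`. -/
def yonedaTrans : representable c ⟶ V where
  app d := (orbit V x d).toCatHom
  naturality {d d'} g := Cat.Hom.isoMk (NatIso.ofComponents
    (fun f => (Cat.Hom.toNatIso (V.mapComp f g)).app x) (fun {f f'} σ => by
      have {f f' : c ⟶ d} (σ : f ⟶ f') :
          (V.map₂ (σ ▷ g)).toNatTrans.app x ≫ (V.mapComp f' g).hom.toNatTrans.app x =
          (V.mapComp f g).hom.toNatTrans.app x ≫ (V.map g).toFunctor.map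
            ((V.map₂ σ).toNatTrans.app x) := by
        simp
      exact this σ))
  naturality_naturality {d d' g g'} η := catHom₂_ext fun (f : c ⟶ d) => by
    have : (V.map₂ (f ◁ η)).toNatTrans.app x ≫ (V.mapComp f g').hom.toNatTrans.app x =
        (V.mapComp f g).hom.toNatTrans.app x ≫
          (V.map₂ η).toNatTrans.app ((V.map f).toFunctor.obj x) := by
      simp
    exact this
  naturality_id d := catHom₂_ext fun (f : c ⟶ d) => by
    have : (V.mapComp f (𝟙 d)).hom.toNatTrans.app x ≫
        (V.mapId d).hom.toNatTrans.app ((V.map f).toFunctor.obj x) =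
          (V.map₂ (ρ_ f).hom).toNatTrans.app x ≫ 𝟙 _ ≫ 𝟙 _ := by
      simp
    exact this
  naturality_comp {a b d} g h := catHom₂_ext fun (f : c ⟶ a) => by
    have : (V.mapComp f (g ≫ h)).hom.toNatTrans.app x ≫
        (V.mapComp g h).hom.toNatTrans.app ((V.map f).toFunctor.obj x) =
        (V.map₂ (α_ f g h).inv).toNatTrans.app x ≫ 𝟙 _ ≫
          (V.mapComp (f ≫ g) h).hom.toNatTrans.app x ≫ 𝟙 _ ≫
          (V.map h).toFunctor.map ((V.mapComp f g).hom.toNatTrans.app x) ≫ 𝟙 _ := by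
      have := congrArg (fun m => m.toNatTrans.app x) (V.mapComp_assoc_right_hom f g h)
      simpa using this
    exact this

end Orbit

section Eval

variable {c : C} {V : C ⥤ᵖ Cat.{w, v}} (θ : representable c ⟶ V)

/-- The values of a transformation out of a representable. -/
def value {d : C} (f : c ⟶ d) : V.obj d := (θ.app d).toFunctor.obj f

/-- The action of the components of `θ` on 2-cells. -/
def valueMap {d : C} {f f' : c ⟶ d} (σ : f ⟶ f') : value θ f ⟶ value θ f' :=
  (θ.app d).toFunctor.map σ

/-- The naturality isomorphism `θ (f ≫ g) ≅ V g (θ f)`. -/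
def valueNat {d d' : C} (f : c ⟶ d) (g : d ⟶ d') :
    value θ (f ≫ g) ≅ (V.map g).toFunctor.obj (value θ f) :=
  (Cat.Hom.toNatIso (θ.naturality g)).app f

@[simp]
theorem valueMap_id {d : C} (f : c ⟶ d) : valueMap θ (𝟙 f) = 𝟙 _ :=
  (θ.app d).toFunctor.map_id f

theorem valueMap_comp {d : C} {f f' f'' : c ⟶ d} (σ : f ⟶ f') (τ : f' ⟶ f'') :
    valueMap θ (σ ≫ τ) = valueMap θ σ ≫ valueMap θ τ :=
  (θ.app d).toFunctor.map_comp σ τ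

theorem valueNat_naturality_left {d d' : C} {f f' : c ⟶ d} (σ : f ⟶ f') (g : d ⟶ d') :
    valueMap θ (σ ▷ g) ≫ (valueNat θ f' g).hom =
      (valueNat θ f g).hom ≫ (V.map g).toFunctor.map (valueMap θ σ) :=
  (θ.naturality g).hom.toNatTrans.naturality σ

theorem valueNat_naturality_right {d d' : C} (f : c ⟶ d) {g g' : d ⟶ d'} (η : g ⟶ g') :
    valueMap θ (f ◁ η) ≫ (valueNat θ f g').hom =
      (valueNat θ f g).hom ≫ (V.map₂ η).toNatTrans.app (value θ f) :=
  congrArg (fun m => m.toNatTrans.app f) (θ.naturality_naturality η)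

theorem valueNat_comp {d d' d'' : C} (f : c ⟶ d) (g : d ⟶ d') (h : d' ⟶ d'') :
    (valueNat θ f (g ≫ h)).hom ≫ (V.mapComp g h).hom.toNatTrans.app (value θ f) =
      valueMap θ (α_ f g h).inv ≫ (valueNat θ (f ≫ g) h).hom ≫
        (V.map h).toFunctor.map (valueNat θ f g).hom := by
  refine (congrArg (fun m => m.toNatTrans.app f) (θ.naturality_comp g h)).trans ?_
  have {x y z u : V.obj d''} (p : x ⟶ y) (q : y ⟶ z) (r : z ⟶ u) :
    p ≫ 𝟙 _ ≫ q ≫ 𝟙 _ ≫ r ≫ 𝟙 _ = p ≫ q ≫ r := by simp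
  exact this _ _ _

/-- The isomorphism `θ f ≅ V f (θ 𝟙)`, by which `θ` is determined by its value at the identity. -/
def valueIso {d : C} (f : c ⟶ d) : value θ f ≅ (V.map f).toFunctor.obj (value θ (𝟙 c)) :=
  (θ.app d).toFunctor.mapIso (λ_ f).symm ≪≫ valueNat θ (𝟙 c) f

theorem valueIso_hom {d : C} (f : c ⟶ d) :
    (valueIso θ f).hom = valueMap θ (λ_ f).inv ≫ (valueNat θ (𝟙 c) f).hom := rfl

theorem valueIso_naturality {d : C} {f f' : c ⟶ d} (σ : f ⟶ f') :
    valueMap θ σ ≫ (valueIso θ f').hom =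
      (valueIso θ f).hom ≫ (V.map₂ σ).toNatTrans.app (value θ (𝟙 c)) := by
  simp only [valueIso_hom, Category.assoc, ← valueNat_naturality_right, ← reassoc_of% valueMap_comp]
  simp

theorem valueIso_comp {d d' : C} (f : c ⟶ d) (g : d ⟶ d') :
    (valueIso θ (f ≫ g)).hom ≫ (V.mapComp f g).hom.toNatTrans.app (value θ (𝟙 c)) =
      (valueNat θ f g).hom ≫ (V.map g).toFunctor.map (valueIso θ f).hom := by
  simp only [valueIso_hom, Category.assoc, valueNat_comp, Functor.map_comp,
    ← reassoc_of% valueNat_naturality_left, ← reassoc_of% valueMap_comp]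
  simp

variable {θ}

theorem valueNat_id {d : C} (f : c ⟶ d) :
    (valueNat θ f (𝟙 d)).hom ≫ (V.mapId d).hom.toNatTrans.app (value θ f) =
      valueMap θ (ρ_ f).hom := by
  refine (congrArg (fun m => m.toNatTrans.app f) (θ.naturality_id d)).trans ?_
  have {x y : V.obj d} (p : x ⟶ y) : p ≫ 𝟙 _ ≫ 𝟙 _ = p := by simp
  exact this _

theorem valueIso_id : (valueIso θ (𝟙 c)).hom ≫
    (V.mapId c).hom.toNatTrans.app (value θ (𝟙 c)) = 𝟙 _ := by
  rw [valueIso_hom, Category.assoc, valueNat_id, ← valueMap_comp, unitors_inv_equal,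
    Iso.inv_hom_id, valueMap_id]

section

variable {θ' θ'' : representable c ⟶ V} (m : θ ⟶ θ')

/-- The values of a modification between transformations out of a representable. -/
def modValue {d : C} (f : c ⟶ d) : value θ f ⟶ value θ' f := (m.as.app d).toNatTrans.app f

theorem modValue_naturality {d : C} {f f' : c ⟶ d} (σ : f ⟶ f') :
    valueMap θ σ ≫ modValue m f' = modValue m f ≫ valueMap θ' σ :=
  (m.as.app d).toNatTrans.naturality σ

theorem valueNat_modification {d d' : C} (f : c ⟶ d)
    (g : d ⟶ d') : modValue m (f ≫ g) ≫ (valueNat θ' f g).hom =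
      (valueNat θ f g).hom ≫ (V.map g).toFunctor.map (modValue m f) :=
  congrArg (fun k => k.toNatTrans.app f) (m.as.naturality g)

theorem valueIso_modification {d : C} (f : c ⟶ d) : modValue m f ≫ (valueIso θ' f).hom =
    (valueIso θ f).hom ≫ (V.map f).toFunctor.map (modValue m (𝟙 c)) := by
  simp only [valueIso_hom, Category.assoc, ← valueNat_modification, reassoc_of% modValue_naturality]

theorem modification_ext {m m' : θ ⟶ θ'}
    (h : ∀ {d : C} (f : c ⟶ d), modValue m f = modValue m' f) : m = m' :=
  StrongTrans.homCategory.ext fun _ => catHom₂_ext fun f => h f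

end

/-- Evaluation `[C, Cat](C(c, -), V) ⥤ V c` at the identity. -/
def yonedaEval (c : C) (V : C ⥤ᵖ Cat.{w, v}) : (representable c ⟶ V) ⥤ V.obj c where
  obj θ := value θ (𝟙 c)
  map m := modValue m (𝟙 c)

/-- The bicategorical Yoneda lemma. A preimage of `m : θ 𝟙 ⟶ θ' 𝟙` has the components
`θ f ≅ V f (θ 𝟙) ⟶ V f (θ' 𝟙) ≅ θ' f`. -/
instance : (yonedaEval c V).IsEquivalence where
  faithful := ⟨fun {θ θ' m m'} (w : modValue m (𝟙 c) = modValue m' (𝟙 c)) =>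
    modification_ext fun f => by
      rw [← cancel_mono (valueIso θ' f).hom, valueIso_modification, w, valueIso_modification]⟩
  full := ⟨fun {θ θ'} (m : value θ (𝟙 c) ⟶ value θ' (𝟙 c)) => by
    let φ {d : C} (f : c ⟶ d) : value θ f ⟶ value θ' f :=
      (valueIso θ f).hom ≫ (V.map f).toFunctor.map m ≫ (valueIso θ' f).inv
    have hφ {d : C} {f f' : c ⟶ d} (σ : f ⟶ f') :
        valueMap θ σ ≫ φ f' = φ f ≫ valueMap θ' σ := by
      simp only [φ, reassoc_of% valueIso_naturality, Category.assoc]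
      rw [← cancel_mono (valueIso θ' f').hom]
      simp only [Category.assoc, valueIso_naturality, Iso.inv_hom_id, Iso.inv_hom_id_assoc,
        Category.comp_id]
      rw [(V.map₂ σ).toNatTrans.naturality]
    have hφ' {d d' : C} (f : c ⟶ d) (g : d ⟶ d') : φ (f ≫ g) ≫ (valueNat θ' f g).hom =
        (valueNat θ f g).hom ≫ (V.map g).toFunctor.map (φ f) := by
      rw [← cancel_mono ((V.map g).toFunctor.map (valueIso θ' f).hom), Category.assoc,
        ← valueIso_comp, Category.assoc]
      simp only [φ, Category.assoc, Iso.inv_hom_id_assoc, Functor.map_comp,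
        ← reassoc_of% valueIso_comp]
      rw [← (V.map g).toFunctor.map_comp (valueIso θ' f).inv, Iso.inv_hom_id,
        CategoryTheory.Functor.map_id, Category.comp_id]
      exact congrArg (_ ≫ ·) ((V.mapComp f g).hom.toNatTrans.naturality m)
    refine ⟨⟨⟨fun d => ⟨⟨fun f => φ f, fun f f' σ => hφ σ⟩⟩, fun {d d'} g =>
      catHom₂_ext fun f => hφ' f g⟩⟩, ?_⟩
    change φ (𝟙 c) = m
    have h1 := (V.mapId c).hom.toNatTrans.naturality m
    rw [← cancel_mono ((valueIso θ' (𝟙 c)).hom ≫ (V.mapId c).hom.toNatTrans.app _)]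
    simp only [φ, Category.assoc, Iso.inv_hom_id_assoc]
    rw [h1, valueIso_id, ← Category.assoc, valueIso_id, Category.comp_id, Category.id_comp]
    rfl⟩
  essSurj := ⟨fun x => ⟨yonedaTrans V x, ⟨(Cat.Hom.toNatIso (V.mapId c)).app x⟩⟩⟩

end Eval

section Contravariant

/-- The identification of the two forms of the presheaf `C(-, c)`: as the Yoneda presheaf of `C` and
as a representable of `Cᵒᵖ`, whose hom-categories agree only up to `op2`. -/
def yonedaToRepresentable (c : C) : yoneda₀ c ⟶ representable (op c) where
  app d := (opFunctor (unop d) c).toCatHom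
  naturality {d d'} g := Cat.Hom.isoMk (NatIso.ofComponents
    (fun (f : unop d ⟶ c) => Iso.refl (f.op ≫ g)) (fun {f f'} σ => by
      have {f f' : unop d ⟶ c} (σ : f ⟶ f') : op2 (g.unop ◁ σ) ≫ 𝟙 (f'.op ≫ g) =
        𝟙 (f.op ≫ g) ≫ op2 σ ▷ g := by simp
      exact this σ))
  naturality_naturality {d d' g g'} η := catHom₂_ext fun (f : unop d ⟶ c) => by
    have : op2 (η.unop2 ▷ f) ≫ 𝟙 (f.op ≫ g') = 𝟙 (f.op ≫ g) ≫ f.op ◁ η := by simp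
    exact this
  naturality_id d := catHom₂_ext fun (f : unop d ⟶ c) => by
    have : 𝟙 (f.op ≫ 𝟙 d) ≫ (ρ_ f.op).hom = op2 (λ_ f).hom ≫ 𝟙 _ ≫ 𝟙 _ := by simp
    exact this
  naturality_comp {a b d} g h := catHom₂_ext fun (f : unop a ⟶ c) => by
    have : 𝟙 (f.op ≫ g ≫ h) ≫ (α_ f.op g h).inv =
      op2 (α_ h.unop g.unop f).hom ≫ 𝟙 _ ≫ 𝟙 _ ≫ 𝟙 _ ≫ 𝟙 (f.op ≫ g) ▷ h ≫ 𝟙 _ := by simp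
    exact this

instance isEquivalence_opFunctor (a b : C) : (opFunctor a b).IsEquivalence :=
  .mk' (unopFunctor (op b) (op a)) (Iso.refl _) (Iso.refl _)

instance isEquivalence_unopFunctor (a b : Cᵒᵖ) : (unopFunctor a b).IsEquivalence :=
  .mk' (opFunctor (unop b) (unop a)) (Iso.refl _) (Iso.refl _)

theorem isEquiv_yonedaToRepresentable (c : C) : IsEquiv (yonedaToRepresentable c) :=
  isEquiv_of_app fun d => isEquiv_toCatHom (inferInstanceAs (opFunctor (unop d) c).IsEquivalence)

variable {c : C} {V : Cᵒᵖ ⥤ᵖ Cat.{w, v}}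

/-- Evaluation `[Cᵒᵖ, Cat](C(-, c), V) ⥤ V c` at the identity. -/
def presheafEval (c : C) (V : Cᵒᵖ ⥤ᵖ Cat.{w, v}) : (yoneda₀ c ⟶ V) ⥤ V.obj (op c) where
  obj θ := (θ.app (op c)).toFunctor.obj (𝟙 c)
  map m := (m.as.app (op c)).toNatTrans.app (𝟙 c)

/-- The Yoneda lemma for presheaves, deduced from that for `Cᵒᵖ`. -/
instance isEquivalence_presheafEval : (presheafEval c V).IsEquivalence := by
  have h1 := (isEquiv_yonedaToRepresentable c).isEquivalence_precomp V
  have h2 : (precomp V (yonedaToRepresentable c) ⋙ presheafEval c V).IsEquivalence :=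
    inferInstanceAs (yonedaEval (op c) V).IsEquivalence
  exact Functor.isEquivalence_of_comp_left (precomp V (yonedaToRepresentable c)) _

/-- For `x : V c`, the functor `C(d, c) ⥤ V d`, `f ↦ V f x`. -/
def presheafOrbit (V : Cᵒᵖ ⥤ᵖ Cat.{w, v}) (x : V.obj (op c)) (d : C) :
    (d ⟶ c) ⥤ V.obj (op d) where
  obj f := (V.map f.op).toFunctor.obj x
  map η := (V.map₂ (op2 η)).toNatTrans.app x
  map_id f := by simp
  map_comp η θ := by simp

/-- The components of a transformation `C(-, c) ⟶ V`. -/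
def presheafValue (θ : yoneda₀ c ⟶ V) (d : C) : (d ⟶ c) ⥤ V.obj (op d) :=
  (θ.app (op d)).toFunctor

/-- The components at the identity of the naturality isomorphisms of a transformation
`C(-, c) ⟶ V`. -/
def presheafValueNat (θ : yoneda₀ c ⟶ V) {d : C} (f : d ⟶ c) :
    (presheafValue θ d).obj (f ≫ 𝟙 c) ≅
      (V.map f.op).toFunctor.obj ((presheafEval c V).obj θ) :=
  (Cat.Hom.toNatIso (θ.naturality f.op)).app (𝟙 c)

theorem presheafValueNat_naturality (θ : yoneda₀ c ⟶ V) {d : C} {f f' : d ⟶ c} (σ : f ⟶ f') :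
    (presheafValue θ d).map (σ ▷ 𝟙 c) ≫ (presheafValueNat θ f').hom =
      (presheafValueNat θ f).hom ≫
        (V.map₂ (op2 σ)).toNatTrans.app ((presheafEval c V).obj θ) :=
  congrArg (fun m => m.toNatTrans.app (𝟙 c)) (θ.naturality_naturality (op2 σ))

/-- A transformation `C(-, c) ⟶ V` is determined by its value at the identity. -/
def presheafOrbitIso (θ : yoneda₀ c ⟶ V) (d : C) :
    (θ.app (op d)).toFunctor ≅ presheafOrbit V ((presheafEval c V).obj θ) d :=
  NatIso.ofComponents
    (fun (f : d ⟶ c) => (presheafValue θ d).mapIso (ρ_ f).symm ≪≫ presheafValueNat θ f)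
    (fun {f f'} σ => by
      have {f f' : d ⟶ c} (σ : f ⟶ f') : (presheafValue θ d).map σ ≫
          (presheafValue θ d).map (ρ_ f').inv ≫ (presheafValueNat θ f').hom =
        ((presheafValue θ d).map (ρ_ f).inv ≫ (presheafValueNat θ f).hom) ≫
          (V.map₂ (op2 σ)).toNatTrans.app ((presheafEval c V).obj θ) := by
        rw [Category.assoc, ← presheafValueNat_naturality, ← Functor.map_comp_assoc,
          ← Functor.map_comp_assoc, rightUnitor_inv_naturality]
      exact this σ)

/-- Isomorphic elements have isomorphic orbits. -/
def presheafOrbitMapIso {x y : V.obj (op c)} (i : x ≅ y) (d : C) :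
    presheafOrbit V x d ≅ presheafOrbit V y d :=
  NatIso.ofComponents (fun f => (V.map f.op).toFunctor.mapIso i)
    (fun {_ _} η => ((V.map₂ (op2 η)).toNatTrans.naturality i.hom).symm)

/-- A presheaf `V` is represented by `c` as soon as some `x : V c` induces equivalences
`C(d, c) ⥤ V d`. -/
theorem exists_yoneda_equivalence (x : V.obj (op c))
    (h : ∀ d, (presheafOrbit V x d).IsEquivalence) :
    ∃ E : yoneda₀ c ≌ V, Nonempty ((presheafEval c V).obj E.hom ≅ x) := by
  let θ := (presheafEval c V).objPreimage x
  let i : (presheafEval c V).obj θ ≅ x := (presheafEval c V).objObjPreimageIso x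
  have hθ : IsEquiv θ := isEquiv_of_app fun d => isEquiv_toCatHom <| by
    have h := h (unop d)
    exact @Functor.isEquivalence_of_iso _ _ _ _ _ _
      (presheafOrbitIso θ (unop d) ≪≫ presheafOrbitMapIso i (unop d)).symm h
  obtain ⟨E, hE⟩ := hθ.exists_hom_eq
  exact ⟨E, ⟨eqToIso (congrArg _ hE) ≪≫ i⟩⟩

theorem isEquivalence_presheafOrbit (E : yoneda₀ c ≌ V) (d : C) :
    (presheafOrbit V ((presheafEval c V).obj E.hom) d).IsEquivalence := by
  have h := ((isEquiv_hom E).app (op d)).isEquivalence_toFunctor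
  exact @Functor.isEquivalence_of_iso _ _ _ _ _ _ (presheafOrbitIso E.hom d) h

end Contravariant

end Yoneda

/-! ### Reflections and universal arrows -/

section Reflections

variable {C : Type u₁} [Bicategory.{w, v} C] {D : Type u₂} [Bicategory.{w, v} D] {L : C ⥤ᵖ D}
  {X : D} {U : C} {e : L.obj U ⟶ X}

/-- A right bicategorical reflection is the same as a universal arrow: by the Yoneda lemma, an
equivalence `C(-, U) ≃ D(L -, X)` is composition with its value at `𝟙 U`. -/
theorem isRightReflection_iff : IsRightReflection L X U e ↔ IsUniversal L e := by
  constructor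
  · rintro ⟨E, ⟨i⟩⟩
    refine ⟨fun S => ?_⟩
    have h := isEquivalence_presheafOrbit E S
    exact @Functor.isEquivalence_of_iso _ _ _ _ _ _
      (presheafOrbitMapIso (V := homInto L X) (c := U) (y := e) i S) h
  · intro h
    exact exists_yoneda_equivalence (V := homInto L X) (c := U) e h.isEquivalence

/-- The sources of two universal arrows to `X` are equivalent. -/
theorem IsUniversal.nonempty_equivalence {U' : C} {e' : L.obj U' ⟶ X} (h : IsUniversal L e)
    (h' : IsUniversal L e') : Nonempty (U ≌ U') := by
  obtain ⟨f, ⟨i⟩⟩ : ∃ f : U ⟶ U', Nonempty (L.map f ≫ e' ≅ e) := ⟨h'.lift e, ⟨h'.fac e⟩⟩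
  obtain ⟨g, ⟨j⟩⟩ : ∃ f : U' ⟶ U, Nonempty (L.map f ≫ e ≅ e') := ⟨h.lift e', ⟨h.fac e'⟩⟩
  have key {U U' : C} {e : L.obj U ⟶ X} {e' : L.obj U' ⟶ X} {f : U ⟶ U'} {g : U' ⟶ U}
      (i : L.map f ≫ e' ≅ e) (j : L.map g ≫ e ≅ e') (h : IsUniversal L e) :
      Nonempty (f ≫ g ≅ 𝟙 U) :=
    ⟨h.liftIso (whiskerRightIso (L.mapComp f g) e ≪≫ α_ _ _ _ ≪≫ whiskerLeftIso (L.map f) j ≪≫ i ≪≫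
      (λ_ e).symm ≪≫ whiskerRightIso (L.mapId U).symm e)⟩
  obtain ⟨a⟩ := key i j h
  obtain ⟨b⟩ := key j i h'
  exact ⟨Equivalence.mkOfAdjointifyCounit a.symm b⟩

theorem IsUniversal.of_iso {e' : L.obj U ⟶ X} (h : IsUniversal L e) (i : e ≅ e') :
    IsUniversal L e' :=
  ⟨fun S => by
    have := h.isEquivalence S
    exact Functor.isEquivalence_of_iso (F := comparison L e S) (NatIso.ofComponents
      (fun v => whiskerLeftIso (L.map v) i) fun {v v'} σ => (whisker_exchange _ _).symm)⟩

/-- A pseudonatural equivalence from `C(-, P)` is universal for the Yoneda embedding. -/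
theorem isUniversal_yoneda {P : C} {Z : Cᵒᵖ ⥤ᵖ Cat.{w, v}} {e : yoneda₀ P ⟶ Z} (h : IsEquiv e) :
    IsUniversal (yoneda (B := C)) (P := P) e := by
  refine ⟨fun S => ?_⟩
  have h1 := (h.app (op S)).isEquivalence_toFunctor
  have i : presheafValue e S ≅ comparison (yoneda (B := C)) (P := P) e S ⋙ presheafEval S Z :=
    NatIso.ofComponents (fun f => (presheafValue e S).mapIso (λ_ f).symm) (fun {f f'} σ => by
      have : (presheafValue e S).map σ ≫ (presheafValue e S).map (λ_ f').inv =
        (presheafValue e S).map (λ_ f).inv ≫ (presheafValue e S).map (𝟙 S ◁ σ) := by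
        rw [← CategoryTheory.Functor.map_comp, ← CategoryTheory.Functor.map_comp,
          leftUnitor_inv_naturality]
      exact this)
  have h2 := @Functor.isEquivalence_of_iso _ _ _ _ _ _ i h1
  exact @Functor.isEquivalence_of_comp_right _ _ _ _ _ _ _ (presheafEval S Z)
    isEquivalence_presheafEval h2

end Reflections

/-! ### Two-sided pseudonatural transformations -/

section BiTrans

variable {A : Type u₁} [Bicategory.{w₁, v₁} A] {C : Type u₂} [Bicategory.{w₂, v₂} C]
  {D : Type u₃} [Bicategory.{w₃, v₃} D]

/-- A family of functors `C(x, L a) ⥤ D(P x, Q a)`, pseudonatural in `x : C` and in `a : A`. The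
fields `left` and `right` are the naturality isomorphisms in the two variables; `middle` says that
they commute with each other. -/
structure BiTrans (P : C ⥤ᵖ D) (L : A ⥤ᵖ C) (Q : A ⥤ᵖ D) where
  /-- The action on 1-cells. -/
  app {x : C} {a : A} (f : x ⟶ L.obj a) : P.obj x ⟶ Q.obj a
  /-- The action on 2-cells. -/
  map {x : C} {a : A} {f f' : x ⟶ L.obj a} (σ : f ⟶ f') : app f ⟶ app f'
  map_id {x : C} {a : A} (f : x ⟶ L.obj a) : map (𝟙 f) = 𝟙 _
  map_comp {x : C} {a : A} {f f' f'' : x ⟶ L.obj a} (σ : f ⟶ f') (τ : f' ⟶ f'') :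
    map (σ ≫ τ) = map σ ≫ map τ
  /-- Naturality in the first variable. -/
  left {x x' : C} {a : A} (g : x ⟶ x') (f : x' ⟶ L.obj a) : P.map g ≫ app f ≅ app (g ≫ f)
  /-- Naturality in the second variable. -/
  right {x : C} {a a' : A} (f : x ⟶ L.obj a) (k : a ⟶ a') :
    app f ≫ Q.map k ≅ app (f ≫ L.map k)
  left_naturality_left {x x' : C} {a : A} {g g' : x ⟶ x'} (η : g ⟶ g') (f : x' ⟶ L.obj a) :
    P.map₂ η ▷ app f ≫ (left g' f).hom = (left g f).hom ≫ map (η ▷ f)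
  left_naturality_right {x x' : C} {a : A} (g : x ⟶ x') {f f' : x' ⟶ L.obj a} (σ : f ⟶ f') :
    P.map g ◁ map σ ≫ (left g f').hom = (left g f).hom ≫ map (g ◁ σ)
  left_id {x : C} {a : A} (f : x ⟶ L.obj a) :
    (left (𝟙 x) f).hom ≫ map (λ_ f).hom = (P.mapId x).hom ▷ app f ≫ (λ_ _).hom
  left_comp {x y z : C} {a : A} (g : x ⟶ y) (h : y ⟶ z) (f : z ⟶ L.obj a) :
    (left (g ≫ h) f).hom ≫ map (α_ g h f).hom = (P.mapComp g h).hom ▷ app f ≫ (α_ _ _ _).hom ≫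
      P.map g ◁ (left h f).hom ≫ (left g (h ≫ f)).hom
  right_naturality_left {x : C} {a a' : A} {f f' : x ⟶ L.obj a} (σ : f ⟶ f') (k : a ⟶ a') :
    map σ ▷ Q.map k ≫ (right f' k).hom = (right f k).hom ≫ map (σ ▷ L.map k)
  right_naturality_right {x : C} {a a' : A} (f : x ⟶ L.obj a) {k k' : a ⟶ a'} (θ : k ⟶ k') :
    app f ◁ Q.map₂ θ ≫ (right f k').hom = (right f k).hom ≫ map (f ◁ L.map₂ θ)
  right_id {x : C} {a : A} (f : x ⟶ L.obj a) :
    (right f (𝟙 a)).hom ≫ map (f ◁ (L.mapId a).hom) ≫ map (ρ_ f).hom =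
      app f ◁ (Q.mapId a).hom ≫ (ρ_ _).hom
  right_comp {x : C} {a b c : A} (f : x ⟶ L.obj a) (k : a ⟶ b) (l : b ⟶ c) :
    (right f (k ≫ l)).hom ≫ map (f ◁ (L.mapComp k l).hom) = app f ◁ (Q.mapComp k l).hom ≫
      (α_ _ _ _).inv ≫ (right f k).hom ▷ Q.map l ≫ (right (f ≫ L.map k) l).hom ≫
      map (α_ _ _ _).hom
  middle {x x' : C} {a a' : A} (g : x ⟶ x') (f : x' ⟶ L.obj a) (k : a ⟶ a') :
    P.map g ◁ (right f k).hom ≫ (left g (f ≫ L.map k)).hom =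
      (α_ _ _ _).inv ≫ (left g f).hom ▷ Q.map k ≫ (right (g ≫ f) k).hom ≫ map (α_ _ _ _).hom

namespace BiTrans

attribute [simp] map_id

variable {P : C ⥤ᵖ D} {L : A ⥤ᵖ C} {Q : A ⥤ᵖ D} (τ : BiTrans P L Q)

/-- The functor `C(x, L a) ⥤ D(P x, Q a)`. -/
def functor (x : C) (a : A) : (x ⟶ L.obj a) ⥤ (P.obj x ⟶ Q.obj a) where
  obj f := τ.app f
  map σ := τ.map σ
  map_id := τ.map_id
  map_comp := τ.map_comp

/-- The image of an invertible 2-cell. -/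
def mapIso {x : C} {a : A} {f f' : x ⟶ L.obj a} (i : f ≅ f') : τ.app f ≅ τ.app f' where
  hom := τ.map i.hom
  inv := τ.map i.inv
  hom_inv_id := by rw [← map_comp]; simp
  inv_hom_id := by rw [← map_comp]; simp

/-- The isomorphism `P f ≫ τ 𝟙 ≅ τ f`, by which a two-sided transformation is determined by its
values at identities. -/
def unitIso {x : C} {a : A} (f : x ⟶ L.obj a) : P.map f ≫ τ.app (𝟙 (L.obj a)) ≅ τ.app f :=
  τ.left f (𝟙 _) ≪≫ τ.mapIso (ρ_ f)

theorem unitIso_hom {x : C} {a : A} (f : x ⟶ L.obj a) :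
    (τ.unitIso f).hom = (τ.left f (𝟙 _)).hom ≫ τ.map (ρ_ f).hom := rfl

theorem unitIso_naturality {x : C} {a : A} {f f' : x ⟶ L.obj a} (σ : f ⟶ f') :
    P.map₂ σ ▷ τ.app (𝟙 (L.obj a)) ≫ (τ.unitIso f').hom = (τ.unitIso f).hom ≫ τ.map σ := by
  rw [unitIso_hom, unitIso_hom, reassoc_of% left_naturality_left, Category.assoc, ← map_comp,
    ← map_comp, rightUnitor_naturality]

theorem unitIso_id (a : A) :
    (τ.unitIso (𝟙 (L.obj a))).hom = (P.mapId _).hom ▷ τ.app (𝟙 (L.obj a)) ≫ (λ_ _).hom := by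
  rw [unitIso_hom, ← unitors_equal, left_id]

theorem unitIso_comp {x x' : C} {a : A} (g : x ⟶ x') (f : x' ⟶ L.obj a) :
    (τ.unitIso (g ≫ f)).hom = (P.mapComp g f).hom ▷ τ.app (𝟙 (L.obj a)) ≫ (α_ _ _ _).hom ≫
      P.map g ◁ (τ.unitIso f).hom ≫ (τ.left g f).hom := by
  have := τ.left_comp g f (𝟙 _) =≫ τ.map (g ◁ (ρ_ f).hom)
  simp only [Category.assoc, ← left_naturality_right, ← map_comp] at this
  rw [unitIso_hom, unitIso_hom, Bicategory.whiskerLeft_comp, Category.assoc, ← this]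
  simp

/-- Naturality in the second variable at an identity, `τ 𝟙 ≫ Q k ≅ τ (L k)`. -/
def counitIso {a a' : A} (k : a ⟶ a') : τ.app (𝟙 (L.obj a)) ≫ Q.map k ≅ τ.app (L.map k) :=
  τ.right (𝟙 _) k ≪≫ τ.mapIso (λ_ _)

theorem counitIso_hom {a a' : A} (k : a ⟶ a') :
    (τ.counitIso k).hom = (τ.right (𝟙 _) k).hom ≫ τ.map (λ_ _).hom := rfl

theorem counitIso_naturality {a a' : A} {k k' : a ⟶ a'} (θ : k ⟶ k') :
    τ.app (𝟙 (L.obj a)) ◁ Q.map₂ θ ≫ (τ.counitIso k').hom =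
      (τ.counitIso k).hom ≫ τ.map (L.map₂ θ) := by
  rw [counitIso_hom, counitIso_hom, reassoc_of% right_naturality_right, Category.assoc,
    ← map_comp, ← map_comp, leftUnitor_naturality]

theorem counitIso_id (a : A) : (τ.counitIso (𝟙 a)).hom ≫ τ.map (L.mapId a).hom =
    τ.app (𝟙 (L.obj a)) ◁ (Q.mapId a).hom ≫ (ρ_ _).hom := by
  rw [counitIso_hom, ← right_id, Category.assoc, ← map_comp, ← map_comp,
    ← leftUnitor_naturality, unitors_equal]

theorem counitIso_comp {a b c : A} (k : a ⟶ b) (l : b ⟶ c) :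
    (τ.counitIso (k ≫ l)).hom ≫ τ.map (L.mapComp k l).hom =
      τ.app (𝟙 (L.obj a)) ◁ (Q.mapComp k l).hom ≫ (α_ _ _ _).inv ≫
        (τ.counitIso k).hom ▷ Q.map l ≫ (τ.right (L.map k) l).hom := by
  have := τ.right_comp (𝟙 _) k l =≫ τ.map (λ_ _).hom
  simp only [Category.assoc, ← map_comp] at this
  rw [counitIso_hom, counitIso_hom, comp_whiskerRight, Category.assoc, Category.assoc,
    right_naturality_left, ← map_comp, ← leftUnitor_naturality, this]
  simp

theorem left_counitIso {x : C} {a a' : A} (g : x ⟶ L.obj a) (k : a ⟶ a') :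
    P.map g ◁ (τ.counitIso k).hom ≫ (τ.left g (L.map k)).hom =
      (α_ _ _ _).inv ≫ (τ.unitIso g).hom ▷ Q.map k ≫ (τ.right g k).hom := by
  have := τ.middle g (𝟙 _) k =≫ τ.map (g ◁ (λ_ _).hom)
  simp only [Category.assoc, ← left_naturality_right, ← map_comp] at this
  rw [counitIso_hom, unitIso_hom, Bicategory.whiskerLeft_comp, Category.assoc, this,
    comp_whiskerRight, Category.assoc, right_naturality_left]
  simp

/-- The pseudonatural transformation `P L ⟶ Q` with components `τ 𝟙` determined by a two-sided
transformation. -/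
def toCompTrans : CompTrans P L Q where
  app a := τ.app (𝟙 (L.obj a))
  nat k := τ.unitIso (L.map k) ≪≫ (τ.counitIso k).symm
  nat_nat {a b k l} η := by
    rw [← cancel_mono (τ.counitIso l).hom]
    simp [unitIso_naturality, counitIso_naturality]
  nat_id a := by
    rw [← cancel_mono (ρ_ _).hom, Category.assoc, ← counitIso_id]
    simp [← unitIso_naturality, unitIso_id]
  nat_comp {a b c} f g := by
    have h := τ.counitIso_comp f g
    rw [← Iso.eq_inv_comp] at h
    have h' := τ.left_counitIso (L.map f) g
    rw [← cancel_mono ((α_ _ _ _).inv ≫ (τ.counitIso f).hom ▷ Q.map g ≫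
      (τ.right (L.map f) g).hom)]
    have h2 : (τ.unitIso (L.map (f ≫ g))).hom ≫ τ.map (L.mapComp f g).hom =
      P.map₂ (L.mapComp f g).hom ▷ _ ≫ (τ.unitIso (L.map f ≫ L.map g)).hom :=
      (τ.unitIso_naturality _).symm
    simp only [Iso.trans_hom, Iso.symm_hom, Category.assoc, ← h,
      Iso.hom_inv_id_assoc, comp_whiskerRight, Bicategory.whiskerLeft_comp, h2, unitIso_comp,
      inv_hom_whiskerRight_assoc]
    congr 4
    rw [← cancel_epi (P.map (L.map f) ◁ (τ.counitIso g).hom)]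
    simp [h', ← Bicategory.whiskerLeft_comp_assoc]

theorem pasteIso_unitIso {x : C} {a a' : A} (f : x ⟶ L.obj a) (k : a ⟶ a') :
    (τ.toCompTrans.pasteIso f k).hom ≫ (τ.unitIso f).hom ▷ Q.map k ≫ (τ.right f k).hom =
      (τ.unitIso (f ≫ L.map k)).hom := by
  rw [unitIso_comp, CompTrans.pasteIso_hom]
  have : ((P.mapComp f (L.map k)).hom ▷ τ.app (𝟙 (L.obj a')) ≫ (α_ _ _ _).hom ≫
      P.map f ◁ ((τ.unitIso (L.map k)).hom ≫ (τ.counitIso k).inv) ≫ (α_ _ _ _).inv) ≫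
        (τ.unitIso f).hom ▷ Q.map k ≫ (τ.right f k).hom =
      (P.mapComp f (L.map k)).hom ▷ τ.app (𝟙 (L.obj a')) ≫ (α_ _ _ _).hom ≫
        P.map f ◁ (τ.unitIso (L.map k)).hom ≫ (τ.left f (L.map k)).hom := by
    simp only [Category.assoc, Bicategory.whiskerLeft_comp]
    rw [← left_counitIso, whiskerLeft_inv_hom_assoc]
  exact this

/-- Up to isomorphism, a two-sided transformation is composition with the corresponding
components. -/
def comparisonIso (x : C) (a : A) : comparison P (τ.app (𝟙 (L.obj a))) x ≅ τ.functor x a :=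
  NatIso.ofComponents (fun f => τ.unitIso f) (fun σ => τ.unitIso_naturality σ)

end BiTrans

end BiTrans

/-! ### Two-sided transformations from representations of presheaves -/

section Currying

variable {B : Type u₁} [Bicategory.{w₁, v₁} B] {H : Type u₂} [Bicategory.{w, v} H]
  {M : Type u₃} [Bicategory.{w, v} M] {N : Hᵒᵖ ⥤ᵖ M} {L : B ⥤ᵖ H} {G : B ⥤ᵖ Mᵒᵖ}
  (Φ : L.comp yoneda ⟶ G.comp (restrictedRepresentables N))

/-- The components `H(x, L b) ⥤ M(G b, N x)` of `Φ`. Here `G` takes values in `Mᵒᵖ`, and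
`restrictedRepresentables N` is `m ↦ M(m, N -)`. -/
def cell (x : H) (b : B) : (x ⟶ L.obj b) ⥤ (unop (G.obj b) ⟶ N.obj (op x)) :=
  ((Φ.app b).app (op x)).toFunctor

/-- Naturality of `cell` in the object of `H`. -/
def cellLeft {x x' : H} {b : B} (g : x ⟶ x') (f : x' ⟶ L.obj b) :
    (cell Φ x b).obj (g ≫ f) ≅ (cell Φ x' b).obj f ≫ N.map g.op :=
  (Cat.Hom.toNatIso ((Φ.app b).naturality g.op)).app f

/-- Naturality of `cell` in the object of `B`. -/
def cellRight {x : H} {b b' : B} (f : x ⟶ L.obj b) (k : b ⟶ b') :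
    (cell Φ x b').obj (f ≫ L.map k) ≅ (G.map k).unop ≫ (cell Φ x b).obj f where
  hom := ((Φ.naturality k).hom.as.app (op x)).toNatTrans.app f
  inv := ((Φ.naturality k).inv.as.app (op x)).toNatTrans.app f
  hom_inv_id := congrArg (fun m => (m.as.app (op x)).toNatTrans.app f) (Φ.naturality k).hom_inv_id
  inv_hom_id := congrArg (fun m => (m.as.app (op x)).toNatTrans.app f) (Φ.naturality k).inv_hom_id

theorem cellLeft_naturality_left {x x' : H} {b : B} {g g' : x ⟶ x'} (η : g ⟶ g')
    (f : x' ⟶ L.obj b) : (cell Φ x b).map (η ▷ f) ≫ (cellLeft Φ g' f).hom =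
      (cellLeft Φ g f).hom ≫ (cell Φ x' b).obj f ◁ N.map₂ (op2 η) :=
  congrArg (fun m => m.toNatTrans.app f) ((Φ.app b).naturality_naturality (op2 η))

theorem cellLeft_naturality_right {x x' : H} {b : B} (g : x ⟶ x') {f f' : x' ⟶ L.obj b}
    (σ : f ⟶ f') : (cell Φ x b).map (g ◁ σ) ≫ (cellLeft Φ g f').hom =
      (cellLeft Φ g f).hom ≫ (cell Φ x' b).map σ ▷ N.map g.op :=
  ((Φ.app b).naturality g.op).hom.toNatTrans.naturality σ

theorem cellLeft_id {x : H} {b : B} (f : x ⟶ L.obj b) :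
    (cellLeft Φ (𝟙 x) f).hom ≫ (cell Φ x b).obj f ◁ (N.mapId (op x)).hom ≫ (ρ_ _).hom =
      (cell Φ x b).map (λ_ f).hom := by
  refine (congrArg (fun m => m.toNatTrans.app f) ((Φ.app b).naturality_id (op x))).trans ?_
  have {X Y : unop (G.obj b) ⟶ N.obj (op x)} (p : X ⟶ Y) : p ≫ 𝟙 _ ≫ 𝟙 _ = p := by simp
  exact this _

theorem cellLeft_comp {x y z : H} {b : B} (g : x ⟶ y) (h : y ⟶ z) (f : z ⟶ L.obj b) :
    (cellLeft Φ (g ≫ h) f).hom ≫ (cell Φ z b).obj f ◁ (N.mapComp h.op g.op).hom ≫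
      (α_ _ _ _).inv = (cell Φ x b).map (α_ g h f).hom ≫ (cellLeft Φ g (h ≫ f)).hom ≫
        (cellLeft Φ h f).hom ▷ N.map g.op := by
  refine (congrArg (fun m => m.toNatTrans.app f) ((Φ.app b).naturality_comp h.op g.op)).trans ?_
  have {X Y Z U : unop (G.obj b) ⟶ N.obj (op x)} (p : X ⟶ Y) (q : Y ⟶ Z) (r : Z ⟶ U) :
    p ≫ 𝟙 _ ≫ q ≫ 𝟙 _ ≫ r ≫ 𝟙 _ = p ≫ q ≫ r := by simp
  exact this _ _ _

theorem cellRight_naturality_left {x : H} {b b' : B} {f f' : x ⟶ L.obj b} (σ : f ⟶ f')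
    (k : b ⟶ b') : (cell Φ x b').map (σ ▷ L.map k) ≫ (cellRight Φ f' k).hom =
      (cellRight Φ f k).hom ≫ (G.map k).unop ◁ (cell Φ x b).map σ :=
  ((Φ.naturality k).hom.as.app (op x)).toNatTrans.naturality σ

theorem cellRight_naturality_right {x : H} {b b' : B} (f : x ⟶ L.obj b) {k k' : b ⟶ b'}
    (θ : k ⟶ k') : (cell Φ x b').map (f ◁ L.map₂ θ) ≫ (cellRight Φ f k').hom =
      (cellRight Φ f k).hom ≫ (G.map₂ θ).unop2 ▷ (cell Φ x b).obj f :=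
  congrArg (fun m => (m.as.app (op x)).toNatTrans.app f) (Φ.naturality_naturality θ)

theorem cellRight_id {x : H} {b : B} (f : x ⟶ L.obj b) :
    (cellRight Φ f (𝟙 b)).hom ≫ (G.mapId b).hom.unop2 ▷ (cell Φ x b).obj f ≫ (λ_ _).hom =
      (cell Φ x b).map (f ◁ (L.mapId b).hom ≫ (ρ_ f).hom) := by
  have h {X Y Z U : unop (G.obj b) ⟶ N.obj (op x)} (p : X ⟶ Y) (q : Y ⟶ Z) (r : Z ⟶ U) :
    p ≫ q ≫ r = p ≫ q ≫ r ≫ 𝟙 _ := by simp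
  refine (h _ _ _).trans
    ((congrArg (fun m => (m.as.app (op x)).toNatTrans.app f) (Φ.naturality_id b)).trans ?_)
  have {X Y : unop (G.obj b) ⟶ N.obj (op x)} (p : X ⟶ Y) : p ≫ 𝟙 _ ≫ 𝟙 _ = p := by simp
  exact this _

theorem cellRight_comp {x : H} {a b c : B} (f : x ⟶ L.obj a) (k : a ⟶ b) (l : b ⟶ c) :
    (cellRight Φ f (k ≫ l)).hom ≫ (G.mapComp k l).hom.unop2 ▷ (cell Φ x a).obj f ≫
      (α_ _ _ _).hom = (cell Φ x c).map (f ◁ (L.mapComp k l).hom ≫ (α_ _ _ _).inv) ≫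
        (cellRight Φ (f ≫ L.map k) l).hom ≫ (G.map l).unop ◁ (cellRight Φ f k).hom := by
  have h {X Y Z U : unop (G.obj c) ⟶ N.obj (op x)} (p : X ⟶ Y) (q : Y ⟶ Z) (r : Z ⟶ U) :
    p ≫ q ≫ r = p ≫ q ≫ r ≫ 𝟙 _ := by simp
  refine (h _ _ _).trans
    ((congrArg (fun m => (m.as.app (op x)).toNatTrans.app f) (Φ.naturality_comp k l)).trans ?_)
  have {X Y Z U : unop (G.obj c) ⟶ N.obj (op x)} (p : X ⟶ Y) (q : Y ⟶ Z) (r : Z ⟶ U) :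
    p ≫ 𝟙 _ ≫ q ≫ 𝟙 _ ≫ r ≫ 𝟙 _ = p ≫ q ≫ r := by simp
  exact this _ _ _

theorem cell_middle {x x' : H} {b b' : B} (g : x ⟶ x') (f : x' ⟶ L.obj b) (k : b ⟶ b') :
    (cellLeft Φ g (f ≫ L.map k)).hom ≫ (cellRight Φ f k).hom ▷ N.map g.op =
      (cell Φ x b').map (α_ g f (L.map k)).inv ≫ (cellRight Φ (g ≫ f) k).hom ≫
        (G.map k).unop ◁ (cellLeft Φ g f).hom ≫ (α_ _ _ _).inv := by
  have h : (cellRight Φ (g ≫ f) k).hom ≫ 𝟙 _ ≫ (G.map k).unop ◁ (cellLeft Φ g f).hom ≫ 𝟙 _ ≫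
      (α_ _ _ _).inv ≫ 𝟙 _ = (𝟙 _ ≫ (cell Φ x b').map (α_ g f (L.map k)).hom ≫ 𝟙 _ ≫
      (cellLeft Φ g (f ≫ L.map k)).hom ≫ 𝟙 _) ≫ (cellRight Φ f k).hom ▷ N.map g.op :=
    congrArg (fun m => m.toNatTrans.app f) ((Φ.naturality k).hom.as.naturality g.op)
  simp only [Category.id_comp, Category.comp_id, Category.assoc] at h
  rw [h, ← CategoryTheory.Functor.map_comp_assoc, Iso.inv_hom_id, CategoryTheory.Functor.map_id,
    Category.id_comp]

/-- A pseudonatural transformation `H(-, L b) ⟶ M(G b, N -)` as a two-sided transformation. -/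
def biTransOfCells : BiTrans (leftOpPseudofunctor N) L G where
  app f := ((cell Φ _ _).obj f).op
  map σ := op2 ((cell Φ _ _).map σ)
  map_id f := congrArg op2 (CategoryTheory.Functor.map_id _ _)
  map_comp σ τ := congrArg op2 (CategoryTheory.Functor.map_comp _ _ _)
  left g f := (cellLeft Φ g f).symm.op2
  right f k := (cellRight Φ f k).symm.op2
  left_naturality_left {x x' b g g'} η f := congrArg op2 <| by
    have : (cell Φ x' b).obj f ◁ N.map₂ (op2 η) ≫ (cellLeft Φ g' f).inv =
        (cellLeft Φ g f).inv ≫ (cell Φ x b).map (η ▷ f) := by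
      rw [Iso.comp_inv_eq, Category.assoc, cellLeft_naturality_left, Iso.inv_hom_id_assoc]
    exact this
  left_naturality_right {x x' b} g {f f'} σ := congrArg op2 <| by
    have : (cell Φ x' b).map σ ▷ N.map g.op ≫ (cellLeft Φ g f').inv =
        (cellLeft Φ g f).inv ≫ (cell Φ x b).map (g ◁ σ) := by
      rw [Iso.comp_inv_eq, Category.assoc, cellLeft_naturality_right, Iso.inv_hom_id_assoc]
    exact this
  left_id f := congrArg op2 <| by
    have : (cellLeft Φ (𝟙 _) f).inv ≫ (cell Φ _ _).map (λ_ f).hom =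
      (cell Φ _ _).obj f ◁ (N.mapId _).hom ≫ (ρ_ _).hom := by
      rw [← cellLeft_id, Iso.inv_hom_id_assoc]
    exact this
  left_comp {x y z b} g h f := congrArg op2 <| by
    have : (cellLeft Φ (g ≫ h) f).inv ≫ (cell Φ x b).map (α_ g h f).hom =
        (cell Φ z b).obj f ◁ (N.mapComp h.op g.op).hom ≫ (α_ _ _ _).inv ≫
          (cellLeft Φ h f).inv ▷ N.map g.op ≫ (cellLeft Φ g (h ≫ f)).inv := by
      rw [Iso.inv_comp_eq, reassoc_of% cellLeft_comp Φ g h f]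
      simp
    exact this
  right_naturality_left {x b b' f f'} σ k := congrArg op2 <| by
    have : (G.map k).unop ◁ (cell Φ x b).map σ ≫ (cellRight Φ f' k).inv =
        (cellRight Φ f k).inv ≫ (cell Φ x b').map (σ ▷ L.map k) := by
      rw [Iso.comp_inv_eq, Category.assoc, cellRight_naturality_left, Iso.inv_hom_id_assoc]
    exact this
  right_naturality_right {x b b'} f {k k'} θ := congrArg op2 <| by
    have : (G.map₂ θ).unop2 ▷ (cell Φ x b).obj f ≫ (cellRight Φ f k').inv =
        (cellRight Φ f k).inv ≫ (cell Φ x b').map (f ◁ L.map₂ θ) := by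
      rw [Iso.comp_inv_eq, Category.assoc, cellRight_naturality_right, Iso.inv_hom_id_assoc]
    exact this
  right_id {x b} f := congrArg op2 <| by
    have : (cellRight Φ f (𝟙 b)).inv ≫ (cell Φ x b).map (f ◁ (L.mapId b).hom) ≫
        (cell Φ x b).map (ρ_ f).hom = (G.mapId b).hom.unop2 ▷ (cell Φ x b).obj f ≫
          (λ_ _).hom := by
      rw [← CategoryTheory.Functor.map_comp, ← cellRight_id, Iso.inv_hom_id_assoc]
    exact this
  right_comp {x a b c} f k l := congrArg op2 <| by
    have : (cellRight Φ f (k ≫ l)).inv ≫ (cell Φ x c).map (f ◁ (L.mapComp k l).hom) =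
        (G.mapComp k l).hom.unop2 ▷ (cell Φ x a).obj f ≫ (α_ _ _ _).hom ≫
          (G.map l).unop ◁ (cellRight Φ f k).inv ≫ (cellRight Φ (f ≫ L.map k) l).inv ≫
            (cell Φ x c).map (α_ _ _ _).hom := by
      rw [Iso.inv_comp_eq, reassoc_of% cellRight_comp Φ f k l]
      simp [← CategoryTheory.Functor.map_comp]
    exact this
  middle {x x' b b'} g f k := congrArg op2 <| by
    have : (cellRight Φ f k).inv ▷ N.map g.op ≫ (cellLeft Φ g (f ≫ L.map k)).inv =
        (α_ _ _ _).hom ≫ (G.map k).unop ◁ (cellLeft Φ g f).inv ≫ (cellRight Φ (g ≫ f) k).inv ≫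
        (cell Φ x b').map (α_ g f (L.map k)).hom := by
      have h : cellLeft Φ g (f ≫ L.map k) ≪≫ whiskerRightIso (cellRight Φ f k) (N.map g.op) =
          (cell Φ x b').mapIso (α_ g f (L.map k)).symm ≪≫ cellRight Φ (g ≫ f) k ≪≫
            whiskerLeftIso (G.map k).unop (cellLeft Φ g f) ≪≫ (α_ _ _ _).symm :=
        Iso.ext (cell_middle Φ g f k)
      simpa using congrArg Iso.inv h
    exact this

/-- If `Φ` is an equivalence at `b`, the arrow `N (L b) ⟶ G b` in `Mᵒᵖ` that it determines is
universal, since composing with it is, up to isomorphism and duality, the component of `Φ`. -/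
theorem isUniversal_biTransOfCells (b : B) (h : IsEquiv (Φ.app b)) :
    IsUniversal (leftOpPseudofunctor N) ((biTransOfCells Φ).toCompTrans.app b) := by
  refine ⟨fun x => ?_⟩
  have h1 := (h.app (op x)).isEquivalence_toFunctor
  have h2 : (cell Φ x b ⋙ opFunctor (unop (G.obj b)) (N.obj (op x))).IsEquivalence :=
    @Functor.isEquivalence_trans _ _ _ _ _ _ _ _ h1 _
  exact @Functor.isEquivalence_of_iso _ _ _ _ _ _ ((biTransOfCells Φ).comparisonIso x b).symm h2

end Currying

/-! ### Two-sided transformations from the legs of cones -/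

section Evaluation

variable {A : Type u₁} [Bicategory.{w₁, v₁} A] {B : Type u₂} [Bicategory.{w, v} B]
  {H : Type u₃} [Bicategory.{w, v} H] {t : A ⥤ᵖ B} {F : A ⥤ᵖ H} {L : B ⥤ᵖ H}
  (e : CompTrans (leftOpPseudofunctor (restrictedRepresentables F)) L
    (leftOpPseudofunctor (restrictedRepresentables t)))

/-- The functor `B(b, t a) ⥤ H(L b, F a)` underlying the component at `b` of
`e : H(L b, F -) ⟶ B(b, t -)` in `[A, Cat]ᵒᵖ`; its values are the legs of a cone with vertex
`L b`. -/
def leg (b : B) (a : A) : (b ⟶ t.obj a) ⥤ (L.obj b ⟶ F.obj a) :=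
  ((e.app b).unop.app a).toFunctor

/-- Naturality of `leg` in the object of `B`. -/
def legLeft {b b' : B} {a : A} (g : b ⟶ b') (f : b' ⟶ t.obj a) :
    L.map g ≫ (leg e b' a).obj f ≅ (leg e b a).obj (g ≫ f) where
  hom := ((e.nat g).hom.unop2.as.app a).toNatTrans.app f
  inv := ((e.nat g).inv.unop2.as.app a).toNatTrans.app f
  hom_inv_id := congrArg (fun m => (m.unop2.as.app a).toNatTrans.app f) (e.nat g).hom_inv_id
  inv_hom_id := congrArg (fun m => (m.unop2.as.app a).toNatTrans.app f) (e.nat g).inv_hom_id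

/-- Naturality of `leg` in the object of `A`. -/
def legRight {b : B} {a a' : A} (f : b ⟶ t.obj a) (k : a ⟶ a') :
    (leg e b a').obj (f ≫ t.map k) ≅ (leg e b a).obj f ≫ F.map k :=
  (Cat.Hom.toNatIso ((e.app b).unop.naturality k)).app f

/-- A transformation `H(L b, F -) ⟶ B(b, t -)` in `[A, Cat]ᵒᵖ`, natural in `b`, as a two-sided
transformation with components `B(b, t a) ⥤ H(L b, F a)`. -/
def biTransOfLegs : BiTrans L t F where
  app f := (leg e _ _).obj f
  map σ := (leg e _ _).map σ
  map_id f := CategoryTheory.Functor.map_id _ _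
  map_comp σ τ := CategoryTheory.Functor.map_comp _ _ _
  left g f := legLeft e g f
  right f k := (legRight e f k).symm
  left_naturality_left {x x' a g g'} η f :=
    congrArg (fun m => (m.unop2.as.app a).toNatTrans.app f) (e.nat_nat η)
  left_naturality_right {x x' b} g {f f'} σ :=
    ((e.nat g).hom.unop2.as.app b).toNatTrans.naturality σ
  left_id {b a} f := by
    have h : (legLeft e (𝟙 b) f).hom ≫ (leg e b a).map ((λ_ f).hom ≫ 𝟙 _) =
        (L.mapId b).hom ▷ (leg e b a).obj f ≫ ((λ_ _).hom ≫ 𝟙 _) ≫ 𝟙 _ ≫ 𝟙 _ :=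
      congrArg (fun m => (m.unop2.as.app a).toNatTrans.app f) (e.nat_id b)
    simp only [Category.comp_id] at h
    exact h
  left_comp {x y z a} g h f := by
    have h : (legLeft e (g ≫ h) f).hom ≫ (leg e x a).map ((α_ g h f).hom ≫ 𝟙 _) =
        (L.mapComp g h).hom ▷ (leg e z a).obj f ≫ ((α_ _ _ _).hom ≫ 𝟙 _) ≫ 𝟙 _ ≫
          L.map g ◁ (legLeft e h f).hom ≫ 𝟙 _ ≫ (legLeft e g (h ≫ f)).hom ≫ 𝟙 _ :=
      congrArg (fun m => (m.unop2.as.app a).toNatTrans.app f) (e.nat_comp g h)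
    simp only [Category.comp_id, Category.id_comp] at h
    exact h
  right_naturality_left {x b b' f f'} σ k := by
    have h := ((e.app x).unop.naturality k).hom.toNatTrans.naturality σ
    have : (leg e x b).map σ ▷ F.map k ≫ (legRight e f' k).inv =
        (legRight e f k).inv ≫ (leg e x b').map (σ ▷ t.map k) := by
      rw [Iso.comp_inv_eq, Category.assoc, Iso.eq_inv_comp]
      exact h.symm
    exact this
  right_naturality_right {x b b'} f {k k'} θ := by
    have h := congrArg (fun m => m.toNatTrans.app f) ((e.app x).unop.naturality_naturality θ)
    have : (leg e x b).obj f ◁ F.map₂ θ ≫ (legRight e f k').inv =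
        (legRight e f k).inv ≫ (leg e x b').map (f ◁ t.map₂ θ) := by
      rw [Iso.comp_inv_eq, Category.assoc, Iso.eq_inv_comp]
      exact h.symm
    exact this
  right_id {x b} f := by
    have h : (legRight e f (𝟙 b)).hom ≫ (leg e x b).obj f ◁ (F.mapId b).hom ≫ (ρ_ _).hom =
        (leg e x b).map (f ◁ (t.mapId b).hom ≫ (ρ_ f).hom) ≫ 𝟙 _ ≫ 𝟙 _ :=
      congrArg (fun m => m.toNatTrans.app f) ((e.app x).unop.naturality_id b)
    have : (legRight e f (𝟙 b)).inv ≫ (leg e x b).map (f ◁ (t.mapId b).hom) ≫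
        (leg e x b).map (ρ_ f).hom = (leg e x b).obj f ◁ (F.mapId b).hom ≫ (ρ_ _).hom := by
      rw [Iso.inv_comp_eq, h]
      simp
    exact this
  right_comp {x a b c} f k l := by
    have h : (legRight e f (k ≫ l)).hom ≫ (leg e x a).obj f ◁ (F.mapComp k l).hom ≫
        (α_ _ _ _).inv = (leg e x c).map (f ◁ (t.mapComp k l).hom ≫ (α_ _ _ _).inv) ≫ 𝟙 _ ≫
          (legRight e (f ≫ t.map k) l).hom ≫ 𝟙 _ ≫ (legRight e f k).hom ▷ F.map l ≫ 𝟙 _ :=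
      congrArg (fun m => m.toNatTrans.app f) ((e.app x).unop.naturality_comp k l)
    have : (legRight e f (k ≫ l)).inv ≫ (leg e x c).map (f ◁ (t.mapComp k l).hom) =
        (leg e x a).obj f ◁ (F.mapComp k l).hom ≫ (α_ _ _ _).inv ≫
          (legRight e f k).inv ▷ F.map l ≫ (legRight e (f ≫ t.map k) l).inv ≫
            (leg e x c).map (α_ _ _ _).hom := by
      rw [Iso.inv_comp_eq, reassoc_of% h]
      simp [← CategoryTheory.Functor.map_comp]
    exact this
  middle {x x' a a'} g f k := by
    have h : (legLeft e g (f ≫ t.map k)).hom ≫ 𝟙 _ ≫ (leg e x a').map (α_ g f (t.map k)).inv ≫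
        𝟙 _ ≫ (legRight e (g ≫ f) k).hom ≫ 𝟙 _ = (𝟙 _ ≫ L.map g ◁ (legRight e f k).hom ≫ 𝟙 _ ≫
          (α_ _ _ _).inv ≫ 𝟙 _) ≫ (legLeft e g f).hom ▷ F.map k :=
      congrArg (fun m => m.toNatTrans.app f) ((e.nat g).hom.unop2.as.naturality k)
    simp only [Category.comp_id, Category.id_comp] at h
    have : L.map g ◁ (legRight e f k).inv ≫ (legLeft e g (f ≫ t.map k)).hom =
        (α_ _ _ _).inv ≫ (legLeft e g f).hom ▷ F.map k ≫ (legRight e (g ≫ f) k).inv ≫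
          (leg e x a').map (α_ _ _ _).hom := by
      rw [← cancel_epi (L.map g ◁ (legRight e f k).hom), ← reassoc_of% h]
      simp [← CategoryTheory.Functor.map_comp]
    exact this

end Evaluation

/-! ### The cones of a transformation `S t ⟶ F` -/

section Legs

variable {A : Type u₁} [Bicategory.{w₁, v₁} A] {B : Type u₂} [Bicategory.{w, v} B]
  {H : Type u₃} [Bicategory.{w, v} H] {t : A ⥤ᵖ B} {F : A ⥤ᵖ H} {S : B ⥤ᵖ H}

section

variable (β : CompTrans S t F)

/-- The transformation `B(b, t -) ⟶ H(S b, F -)`, `f ↦ S f ≫ β`, induced by `β : S t ⟶ F`. -/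
def legTrans (b : B) : t.comp (representable b) ⟶ F.comp (representable (S.obj b)) where
  app a := (comparison S (β.app a) b).toCatHom
  naturality {a a'} k := Cat.Hom.isoMk (NatIso.ofComponents
    (fun (f : b ⟶ t.obj a) => β.pasteIso f k) (fun {f f'} σ =>
      β.pasteIso_naturality_left (v := f) (v' := f') σ k))
  naturality_naturality η := catHom₂_ext fun (f : b ⟶ t.obj _) =>
    β.pasteIso_naturality_right f η
  naturality_id a := catHom₂_ext fun (f : b ⟶ t.obj a) => by
    have : (β.pasteIso f (𝟙 a)).hom ≫ (S.map f ≫ β.app a) ◁ (F.mapId a).hom ≫ (ρ_ _).hom =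
        S.map₂ (f ◁ (t.mapId a).hom ≫ (ρ_ f).hom) ▷ β.app a ≫ 𝟙 _ ≫ 𝟙 _ := by
      rw [β.pasteIso_id]; simp
    exact this
  naturality_comp {a b' c} k l := catHom₂_ext fun (f : b ⟶ t.obj a) => by
    have : (β.pasteIso f (k ≫ l)).hom ≫ (S.map f ≫ β.app a) ◁ (F.mapComp k l).hom ≫
        (α_ _ _ _).inv = S.map₂ (f ◁ (t.mapComp k l).hom ≫ (α_ _ _ _).inv) ▷ β.app c ≫ 𝟙 _ ≫
        (β.pasteIso (f ≫ t.map k) l).hom ≫ 𝟙 _ ≫ (β.pasteIso f k).hom ▷ F.map l ≫ 𝟙 _ := by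
      rw [β.pasteIso_comp]; simp
    exact this

/-- The isomorphism `S g ≫ (S f ≫ z) ≅ S (g ≫ f) ≫ z`. -/
def preIso {b b' c : B} (g : b ⟶ b') (f : b' ⟶ c) {x : H} (z : S.obj c ⟶ x) :
    S.map g ≫ S.map f ≫ z ≅ S.map (g ≫ f) ≫ z :=
  (α_ _ _ _).symm ≪≫ whiskerRightIso (S.mapComp g f).symm z

/-- Naturality of `legTrans` in `b`. -/
def legTransNat {b b' : B} (g : b ⟶ b') :
    legTrans β b' ≫ (restrictedRepresentables F).map (S.map g).op ≅
      (restrictedRepresentables t).map g.op ≫ legTrans β b :=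
  StrongTrans.isoMk (fun a => Cat.Hom.isoMk (NatIso.ofComponents
    (fun (f : b' ⟶ t.obj a) => preIso g f (β.app a)) (fun {f f'} σ => by
      have {f f' : b' ⟶ t.obj a} (σ : f ⟶ f') : S.map g ◁ S.map₂ σ ▷ β.app a ≫
          (preIso g f' (β.app a)).hom =
        (preIso g f (β.app a)).hom ≫ S.map₂ (g ◁ σ) ▷ β.app a := by
        simp [preIso]
      exact this σ))) (fun {a a'} k => catHom₂_ext fun (f : b' ⟶ t.obj a) => by
    have h := β.pasteIso_pre g f k
    have : (preIso g (f ≫ t.map k) (β.app a')).hom ≫ 𝟙 _ ≫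
        S.map₂ (α_ g f (t.map k)).inv ▷ β.app a' ≫ 𝟙 _ ≫ (β.pasteIso (g ≫ f) k).hom ≫ 𝟙 _ =
        (𝟙 _ ≫ S.map g ◁ (β.pasteIso f k).hom ≫ 𝟙 _ ≫ (α_ _ _ _).inv ≫ 𝟙 _) ≫
          (preIso g f (β.app a)).hom ▷ F.map k := by
      rw [← cancel_mono ((preIso g f (β.app a)).inv ▷ F.map k)]
      simp only [Category.id_comp, Category.comp_id, Category.assoc, hom_inv_whiskerRight]
      simp [preIso, h]
    exact this)

/-- The transformation `H(S b, F -) ⟶ B(b, t -)` in `[A, Cat]ᵒᵖ`, natural in `b`, induced by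
`β : S t ⟶ F`. -/
def legs : CompTrans (leftOpPseudofunctor (restrictedRepresentables F)) S
    (leftOpPseudofunctor (restrictedRepresentables t)) where
  app b := (legTrans β b).op
  nat g := (legTransNat β g).op2
  nat_nat {b b' g g'} η := congrArg op2 <| StrongTrans.homCategory.ext fun a =>
    catHom₂_ext fun (f : b' ⟶ t.obj a) => by
    have : S.map₂ η ▷ (S.map f ≫ β.app a) ≫ (preIso g' f (β.app a)).hom =
       (preIso g f (β.app a)).hom ≫ S.map₂ (η ▷ f) ▷ β.app a := by
      simp [preIso]
    exact this
  nat_id b := congrArg op2 <| StrongTrans.homCategory.ext fun a =>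
    catHom₂_ext fun (f : b ⟶ t.obj a) => by
    have : (preIso (𝟙 b) f (β.app a)).hom ≫ S.map₂ ((λ_ f).hom ≫ 𝟙 _) ▷ β.app a  =
        (S.mapId b).hom ▷ (S.map f ≫ β.app a) ≫ ((λ_ _).hom ≫ 𝟙 _) ≫ 𝟙 _ ≫ 𝟙 _ := by
      simp [preIso]
    exact this
  nat_comp {b b' c} g h := congrArg op2 <| StrongTrans.homCategory.ext fun a =>
    catHom₂_ext fun (f : c ⟶ t.obj a) => by
    have : (preIso (g ≫ h) f (β.app a)).hom ≫ S.map₂ ((α_ g h f).hom ≫ 𝟙 _) ▷ β.app a =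
        (S.mapComp g h).hom ▷ (S.map f ≫ β.app a) ≫ ((α_ _ _ _).hom ≫ 𝟙 _) ≫ 𝟙 _ ≫
          S.map g ◁ (preIso h f (β.app a)).hom ≫ 𝟙 _ ≫ (preIso g (h ≫ f) (β.app a)).hom ≫ 𝟙 _ := by
      simp [preIso]
    exact this

end

section Functor

/-- The modification `S f ◁ Γ` between the legs of `β` and of `β'`. -/
def legTransMap {β β' : CompTrans S t F} (Γ : β.toTrans ⟶ β'.toTrans) (b : B) :
    legTrans β b ⟶ legTrans β' b where
  as :=
    { app a := ⟨{
          app := fun (f : b ⟶ t.obj a) => S.map f ◁ Γ.as.app a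
          naturality := fun {f f'} σ => by
            have {f f' : b ⟶ t.obj a} (σ : f ⟶ f') {x x' : S.obj (t.obj a) ⟶ F.obj a}
                (m : x ⟶ x') : S.map₂ σ ▷ x ≫ S.map f' ◁ m = S.map f ◁ m ≫ S.map₂ σ ▷ x' :=
              (whisker_exchange _ _).symm
            exact this σ (Γ.as.app a) }⟩
      naturality {a a'} k := catHom₂_ext fun (f : b ⟶ t.obj a) => by
        have h : S.map (t.map k) ◁ Γ.as.app a' ≫ (β'.nat k).hom =
          (β.nat k).hom ≫ Γ.as.app a ▷ F.map k := Γ.as.naturality k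
        have (m : β.app a ⟶ β'.app a) (m' : β.app a' ⟶ β'.app a')
            (h : S.map (t.map k) ◁ m' ≫ (β'.nat k).hom = (β.nat k).hom ≫ m ▷ F.map k) :
            S.map (f ≫ t.map k) ◁ m' ≫ (β'.pasteIso f k).hom =
              (β.pasteIso f k).hom ≫ (S.map f ◁ m) ▷ F.map k := by
          have h1 := congrArg (S.map f ◁ ·) h
          simp only [Bicategory.whiskerLeft_comp] at h1
          simp [CompTrans.pasteIso_hom, whisker_exchange_assoc, reassoc_of% h1]
        exact this _ _ h }

variable (t F S) in
/-- The functor from transformations `S t ⟶ F` to transformations `H(S b, F -) ⟶ B(b, t -)` in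
`[A, Cat]ᵒᵖ`, natural in `b`, that takes `β` to its legs. -/
def legsFunctor : (t.comp S ⟶ F) ⥤ (S.comp (leftOpPseudofunctor (restrictedRepresentables F)) ⟶
    leftOpPseudofunctor (restrictedRepresentables t)) where
  obj β := (legs (CompTrans.ofTrans β)).toTrans
  map {β β'} Γ :=
    { as :=
      { app b := op2 (legTransMap (β := CompTrans.ofTrans β) (β' := CompTrans.ofTrans β') Γ b)
        naturality {b b'} g := congrArg op2 <| StrongTrans.homCategory.ext fun a =>
          catHom₂_ext fun (f : b' ⟶ t.obj a) => by
          have {x x' : S.obj (t.obj a) ⟶ F.obj a} (m : x ⟶ x') :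
              S.map g ◁ S.map f ◁ m ≫ (preIso g f x').hom =
                (preIso g f x).hom ≫ S.map (g ≫ f) ◁ m := by
            simp [preIso, ← whisker_exchange]
          exact this (Γ.as.app a) } }
  map_id β := StrongTrans.homCategory.ext fun b => congrArg op2 <|
    StrongTrans.homCategory.ext fun a => catHom₂_ext fun (f : b ⟶ t.obj a) => by
      have {x : S.obj (t.obj a) ⟶ F.obj a} : S.map f ◁ 𝟙 x = 𝟙 _ := by simp
      exact this
  map_comp Γ Θ := StrongTrans.homCategory.ext fun b => congrArg op2 <|
    StrongTrans.homCategory.ext fun a => catHom₂_ext fun (f : b ⟶ t.obj a) => by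
      have {x y z : S.obj (t.obj a) ⟶ F.obj a} (p : x ⟶ y) (q : y ⟶ z) :
        S.map f ◁ (p ≫ q) = S.map f ◁ p ≫ S.map f ◁ q := by simp
      exact this _ _

/-- Whiskering with the isomorphic copy `S 𝟙` of an identity is faithful. -/
theorem whiskerLeft_map_id_injective {b : B} {x : H} {z z' : S.obj b ⟶ x} {m m' : z ⟶ z'}
    (h : S.map (𝟙 b) ◁ m = S.map (𝟙 b) ◁ m') : m = m' := by
  have key (m : z ⟶ z') : m = (λ_ z).inv ≫ (S.mapId b).inv ▷ z ≫ S.map (𝟙 b) ◁ m ≫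
      (S.mapId b).hom ▷ z' ≫ (λ_ z').hom := by
    rw [whisker_exchange_assoc]
    simp
  rw [key m, key m', h]

instance : (legsFunctor t F S).Faithful where
  map_injective {_ _ _ _} h := StrongTrans.homCategory.ext fun a =>
    whiskerLeft_map_id_injective <|
      congrArg (fun m => ((m.as.app (t.obj a)).unop2.as.app a).toNatTrans.app (𝟙 (t.obj a))) h

/-- The isomorphism `S 𝟙 ≫ z ≅ z`. -/
def mapIdComp (S : B ⥤ᵖ H) {b : B} {x : H} (z : S.obj b ⟶ x) : S.map (𝟙 b) ≫ z ≅ z :=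
  whiskerRightIso (S.mapId b) z ≪≫ λ_ z

theorem preIso_rightUnitor {b c : B} (f : b ⟶ c) {x : H} (z : S.obj c ⟶ x) :
    (preIso f (𝟙 c) z).hom ≫ S.map₂ (ρ_ f).hom ▷ z = S.map f ◁ (mapIdComp S z).hom := by
  simp [preIso, mapIdComp]

theorem pasteIso_leftUnitor (β : CompTrans S t F) {a a' : A} (k : a ⟶ a') :
    (β.pasteIso (𝟙 _) k).hom ≫ (mapIdComp S (β.app a)).hom ▷ F.map k =
      S.map₂ (λ_ (t.map k)).hom ▷ β.app a' ≫ (β.nat k).hom := by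
  simp [CompTrans.pasteIso_hom, mapIdComp, reassoc_of% whiskerLeft_exchange]

section

variable {β β' : t.comp S ⟶ F}
  (m : (legsFunctor t F S).obj β ⟶ (legsFunctor t F S).obj β')

/-- The values of a modification `m` between the legs of `β` and of `β'`. -/
def legsModValue {b : B} {a : A} (f : b ⟶ t.obj a) :
    S.map f ≫ β.app a ⟶ S.map f ≫ β'.app a :=
  ((m.as.app b).unop2.as.app a).toNatTrans.app f

theorem legsModValue_naturality {b : B} {a : A} {f f' : b ⟶ t.obj a} (σ : f ⟶ f') :
    S.map₂ σ ▷ β.app a ≫ legsModValue m f' = legsModValue m f ≫ S.map₂ σ ▷ β'.app a :=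
  ((m.as.app b).unop2.as.app a).toNatTrans.naturality σ

theorem legsModValue_left {b b' : B} {a : A} (g : b ⟶ b') (f : b' ⟶ t.obj a) :
    S.map g ◁ legsModValue m f ≫ (preIso g f (β'.app a)).hom =
      (preIso g f (β.app a)).hom ≫ legsModValue m (g ≫ f) :=
  congrArg (fun k => (k.unop2.as.app a).toNatTrans.app f) (m.as.naturality g)

theorem legsModValue_right {b : B} {a a' : A} (f : b ⟶ t.obj a) (k : a ⟶ a') :
    legsModValue m (f ≫ t.map k) ≫ ((CompTrans.ofTrans β').pasteIso f k).hom =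
      ((CompTrans.ofTrans β).pasteIso f k).hom ≫ legsModValue m f ▷ F.map k :=
  congrArg (fun k => k.toNatTrans.app f) ((m.as.app b).unop2.as.naturality k)

/-- The components of the modification `β ⟶ β'` with legs `m`, namely the values of `m` at
identities. -/
def legsPreimage (a : A) : β.app a ⟶ β'.app a :=
  (mapIdComp S (β.app a)).inv ≫ legsModValue m (𝟙 (t.obj a)) ≫ (mapIdComp S (β'.app a)).hom

theorem whiskerLeft_legsPreimage {b : B} {a : A} (f : b ⟶ t.obj a) :
    S.map f ◁ legsPreimage m a = legsModValue m f := by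
  have h1 : legsModValue m (f ≫ 𝟙 (t.obj a)) ≫ S.map₂ (ρ_ f).hom ▷ β'.app a =
      S.map₂ (ρ_ f).hom ▷ β.app a ≫ legsModValue m f := (legsModValue_naturality m _).symm
  have h2 {x x' : S.obj (t.obj a) ⟶ F.obj a} (u : S.map (𝟙 (t.obj a)) ≫ x ⟶
      S.map (𝟙 (t.obj a)) ≫ x') (w : S.map f ≫ x ⟶ S.map f ≫ x')
      (h : S.map f ◁ u ≫ (preIso f (𝟙 _) x').hom ≫ S.map₂ (ρ_ f).hom ▷ x' =
        (preIso f (𝟙 _) x).hom ≫ S.map₂ (ρ_ f).hom ▷ x ≫ w) :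
      S.map f ◁ ((mapIdComp S x).inv ≫ u ≫ (mapIdComp S x').hom) = w := by
    rw [preIso_rightUnitor, ← Category.assoc, preIso_rightUnitor] at h
    rw [Bicategory.whiskerLeft_comp, Bicategory.whiskerLeft_comp, h, whiskerLeft_inv_hom_assoc]
  refine h2 _ _ ?_
  rw [← h1, ← reassoc_of% legsModValue_left]

theorem legsPreimage_naturality {a a' : A} (k : a ⟶ a') :
    S.map (t.map k) ◁ legsPreimage m a' ≫ ((CompTrans.ofTrans β').nat k).hom =
      ((CompTrans.ofTrans β).nat k).hom ≫ legsPreimage m a ▷ F.map k := by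
  have h := legsModValue_right m (𝟙 (t.obj a)) k
  have h' := legsModValue_naturality m (λ_ (t.map k)).hom
  have key (γ γ' : CompTrans S t F) (u : S.map (t.map k) ≫ γ.app a' ⟶ S.map (t.map k) ≫ γ'.app a')
      (u' : S.map (𝟙 (t.obj a) ≫ t.map k) ≫ γ.app a' ⟶ S.map (𝟙 (t.obj a) ≫ t.map k) ≫ γ'.app a')
      (w : S.map (𝟙 (t.obj a)) ≫ γ.app a ⟶ S.map (𝟙 (t.obj a)) ≫ γ'.app a)
      (h : u' ≫ (γ'.pasteIso (𝟙 _) k).hom = (γ.pasteIso (𝟙 _) k).hom ≫ w ▷ F.map k)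
      (h' : S.map₂ (λ_ (t.map k)).hom ▷ γ.app a' ≫ u =
        u' ≫ S.map₂ (λ_ (t.map k)).hom ▷ γ'.app a') :
      u ≫ (γ'.nat k).hom = (γ.nat k).hom ≫ ((mapIdComp S (γ.app a)).inv ≫ w ≫
        (mapIdComp S (γ'.app a)).hom) ▷ F.map k := by
    have h1 := pasteIso_leftUnitor γ k
    have h2 := pasteIso_leftUnitor γ' k
    rw [← cancel_epi (S.map₂ (λ_ (t.map k)).hom ▷ γ.app a'), reassoc_of% h', ← h2, reassoc_of% h,
      ← reassoc_of% h1]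
    simp [← comp_whiskerRight]
  rw [whiskerLeft_legsPreimage]
  exact key (CompTrans.ofTrans β) (CompTrans.ofTrans β') _ _ _ h h'

/-- By the Yoneda lemma in `b`, a modification between the legs is determined by its values at
identities. -/
instance : (legsFunctor t F S).Full where
  map_surjective {_ _} m :=
    ⟨⟨⟨legsPreimage m, legsPreimage_naturality m⟩⟩,
      StrongTrans.homCategory.ext fun b => congrArg op2 <|
        StrongTrans.homCategory.ext fun a => catHom₂_ext fun (f : b ⟶ t.obj a) =>
          whiskerLeft_legsPreimage m f⟩

end

end Functor

/-! ### Universal legs make an extension universal -/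

section Exchange

variable {L : B ⥤ᵖ H}

/-- The isomorphism `S f ≫ (α ≫ z) ≅ α ≫ (L f ≫ z)` given by the naturality of `α : S ⟶ L`. -/
def exchangeIso (α : S ⟶ L) {b c : B} (f : b ⟶ c) {x : H} (z : L.obj c ⟶ x) :
    S.map f ≫ α.app c ≫ z ≅ α.app b ≫ L.map f ≫ z :=
  (α_ _ _ _).symm ≪≫ whiskerRightIso (α.naturality f) z ≪≫ α_ _ _ _

theorem exchangeIso_naturality (α : S ⟶ L) {b c : B} {f f' : b ⟶ c} (σ : f ⟶ f') {x : H}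
    (z : L.obj c ⟶ x) : S.map₂ σ ▷ (α.app c ≫ z) ≫ (exchangeIso α f' z).hom =
      (exchangeIso α f z).hom ≫ α.app b ◁ L.map₂ σ ▷ z := by
  have := congrArg (· ▷ z) (α.naturality_naturality σ)
  simp only [comp_whiskerRight] at this
  simp [exchangeIso, reassoc_of% this]

theorem exchangeIso_modification {α α' : S ⟶ L} (Γ : α ⟶ α') {b c : B} (f : b ⟶ c) {x : H}
    (z : L.obj c ⟶ x) : S.map f ◁ Γ.as.app c ▷ z ≫ (exchangeIso α' f z).hom =
      (exchangeIso α f z).hom ≫ Γ.as.app b ▷ (L.map f ≫ z) := by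
  simp [exchangeIso]

theorem exchangeIso_preIso (α : S ⟶ L) {b b' c : B} (g : b ⟶ b') (f : b' ⟶ c) {x : H}
    (z : L.obj c ⟶ x) : (preIso g f (α.app c ≫ z)).hom ≫ (exchangeIso α (g ≫ f) z).hom =
      S.map g ◁ (exchangeIso α f z).hom ≫ (exchangeIso α g (L.map f ≫ z)).hom ≫
        α.app b ◁ (preIso g f z).hom := by
  rw [← cancel_epi (preIso g f (α.app c ≫ z)).inv,
    ← cancel_mono (α.app b ◁ (preIso g f z).inv)]
  simp [exchangeIso, preIso]

/-- Compatibility of `exchangeIso` with pasting a 2-cell `v`. -/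
theorem exchangeIso_paste (α : S ⟶ L) {b c c' : B} {x x' : H} (f : b ⟶ c) (k : c ⟶ c')
    (z : L.obj c ⟶ x) (z' : L.obj c' ⟶ x') (l : x ⟶ x') (v : L.map k ≫ z' ⟶ z ≫ l) :
    (exchangeIso α (f ≫ k) z').hom ≫ α.app b ◁ ((L.mapComp f k).hom ▷ z' ≫ (α_ _ _ _).hom ≫
        L.map f ◁ v ≫ (α_ _ _ _).inv) ≫ (α_ _ _ _).inv =
      ((S.mapComp f k).hom ▷ (α.app c' ≫ z') ≫ (α_ _ _ _).hom ≫
        S.map f ◁ ((exchangeIso α k z').hom ≫ α.app c ◁ v ≫ (α_ _ _ _).inv) ≫ (α_ _ _ _).inv) ≫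
        (exchangeIso α f z).hom ▷ l := by
  have h := whisker_exchange (α.naturality f).hom v
  rw [← cancel_mono (α_ _ _ _).hom] at h
  simp only [comp_whiskerLeft, whiskerRight_comp, Category.assoc, Iso.inv_hom_id,
    Category.comp_id] at h
  rw [← Iso.eq_inv_comp] at h
  have h' : (α_ (α.app b) (L.map f) z).hom ▷ l = (α_ _ _ _).hom ≫ (α_ _ _ _).hom ≫
      α.app b ◁ (α_ (L.map f) z l).inv ≫ (α_ (α.app b) (L.map f ≫ z) l).inv := by simp
  simp [exchangeIso]
  rw [h', reassoc_of% h]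
  simp

theorem exchangeIso_pasteIso (α : S ⟶ L) (e : t.comp L ⟶ F) {b : B} {a a' : A}
    (f : b ⟶ t.obj a) (k : a ⟶ a') :
    (exchangeIso α (f ≫ t.map k) (e.app a')).hom ≫
        α.app b ◁ ((CompTrans.ofTrans e).pasteIso f k).hom ≫ (α_ _ _ _).inv =
      ((CompTrans.ofTrans (precompMap t α ≫ e)).pasteIso f k).hom ≫
        (exchangeIso α f (e.app a)).hom ▷ F.map k := by
  have h {z : L.obj (t.obj a) ⟶ F.obj a} {z' : L.obj (t.obj a') ⟶ F.obj a'}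
      (v : L.map (t.map k) ≫ z' ⟶ z ≫ F.map k) :
      (α_ _ _ _).inv ≫ (α.naturality (t.map k)).hom ▷ z' ≫ (α_ _ _ _).hom ≫ α.app _ ◁ v ≫
        (α_ _ _ _).inv = (exchangeIso α (t.map k) z').hom ≫ α.app _ ◁ v ≫ (α_ _ _ _).inv := by
    simp [exchangeIso]
  have h' := h (e.naturality k).hom
  refine (exchangeIso_paste α f (t.map k) (e.app a) (e.app a') (F.map k)
    (e.naturality k).hom).trans ?_
  rw [← h']
  rfl

/-- The legs of `α t ≫ e` are those of `e`, composed with `α`. -/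
def legsCompIso (α : S ⟶ L) (e : t.comp L ⟶ F) :
    (legsFunctor t F S).obj (precompMap t α ≫ e) ≅
      whiskerTrans _ α ≫ (legsFunctor t F L).obj e :=
  StrongTrans.isoMk (fun b => Iso.op2 (StrongTrans.isoMk (fun a => Cat.Hom.isoMk
    (NatIso.ofComponents (fun (f : b ⟶ t.obj a) => exchangeIso α f (e.app a))
      (fun {f f'} σ => exchangeIso_naturality α (b := b) (c := t.obj a) (f := f) (f' := f') σ _)))
    (fun {a a'} k => catHom₂_ext fun (f : b ⟶ t.obj a) => by
      have {X Y Z U : S.obj b ⟶ F.obj a'} (p : X ⟶ Y) (q : Y ⟶ Z) (r : Z ⟶ U) :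
        p ≫ 𝟙 _ ≫ q ≫ 𝟙 _ ≫ r ≫ 𝟙 _ = p ≫ q ≫ r := by simp
      exact (this _ _ _).trans (exchangeIso_pasteIso α e f k))))
    (fun {b b'} g => congrArg op2 <|
        StrongTrans.homCategory.ext fun a => catHom₂_ext fun (f : b' ⟶ t.obj a) => by
      have {x : H} (z : L.obj (t.obj a) ⟶ x) : S.map g ◁ (exchangeIso α f z).hom ≫ 𝟙 _ ≫
          ((𝟙 _ ≫ (α_ _ _ _).inv) ≫ (α.naturality g).hom ▷ (L.map f ≫ z) ≫ (α_ _ _ _).hom ≫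
            𝟙 _) ≫ 𝟙 _ ≫ α.app b ◁ (preIso g f z).hom ≫ 𝟙 _ =
        (preIso g f (α.app _ ≫ z)).hom ≫ (exchangeIso α (g ≫ f) z).hom := by
        rw [exchangeIso_preIso]
        simp [exchangeIso]
      exact this (e.app a))

/-- If the legs of `e : L t ⟶ F` are universal at every `b`, then `e` exhibits `L` as a right
pseudo-Kan extension. The functors `α ↦ α t ≫ e`, followed by the fully faithful `legsFunctor`, is
the comparison functor of a pointwise universal transformation, hence an equivalence; so both
factors are equivalences. -/
theorem isUniversal_precomposition {e : t.comp L ⟶ F} (h : ∀ b, IsUniversal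
    (leftOpPseudofunctor (restrictedRepresentables F)) ((legs (CompTrans.ofTrans e)).app b)) :
    IsUniversal (precomposition t H) e := by
  refine ⟨fun S => ?_⟩
  have i : comparison (precomposition t H) e S ⋙ legsFunctor t F S ≅
      transComparison ((legsFunctor t F L).obj e) S :=
    NatIso.ofComponents (fun α => legsCompIso α e) (fun {α α'} Γ =>
      StrongTrans.homCategory.ext fun b => congrArg op2 <|
        StrongTrans.homCategory.ext fun a => catHom₂_ext fun (f : b ⟶ t.obj a) =>
          exchangeIso_modification Γ f (e.app a))
  have h1 : (transComparison ((legsFunctor t F L).obj e) S).IsEquivalence :=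
    CompTrans.isEquivalence_transComparison h
  have h2 := @Functor.isEquivalence_of_iso _ _ _ _ _ _ i.symm h1
  have h3 : (legsFunctor t F S).EssSurj :=
    ⟨fun x => ⟨_, ⟨(comparison (precomposition t H) e S ⋙ legsFunctor t F S).objObjPreimageIso x⟩⟩⟩
  have h4 : (legsFunctor t F S).IsEquivalence := { }
  exact @Functor.isEquivalence_of_comp_right _ _ _ _ _ _ _ (legsFunctor t F S) h4 h2

end Exchange

end Legs

/-! ### Evaluation of diagrams of functor categories -/

section Evaluation

variable {A : Type u₁} [Bicategory.{w₁, v₁} A] (V : A ⥤ᵖ Cat.{s, s}) (C : Cat.{s, s})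

/-- Evaluation at `c : C`, as a transformation `Cat(C, V -) ⟶ V`. -/
def catEval (c : C) : V.comp (representable C) ⟶ V where
  app a := Functor.toCatHom (C := (C ⟶ V.obj a))
    { obj := fun f => f.toFunctor.obj c
      map := fun η => η.toNatTrans.app c }
  naturality {a a'} k := Cat.Hom.isoMk (NatIso.ofComponents
    (fun (f : C ⟶ V.obj a) => Iso.refl ((f ≫ V.map k).toFunctor.obj c)) (fun {f f'} σ => by
      have {f f' : C ⟶ V.obj a} (σ : f ⟶ f') : (σ ▷ V.map k).toNatTrans.app c ≫ 𝟙 _ =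
        𝟙 _ ≫ (V.map k).toFunctor.map (σ.toNatTrans.app c) := by simp
      exact this σ))
  naturality_naturality {a a' k k'} η := catHom₂_ext fun (f : C ⟶ V.obj a) => by
    have : (V.map₂ η).toNatTrans.app (f.toFunctor.obj c) ≫ 𝟙 _ =
      𝟙 _ ≫ (V.map₂ η).toNatTrans.app (f.toFunctor.obj c) := by simp
    exact this
  naturality_id a := catHom₂_ext fun (f : C ⟶ V.obj a) => by
    have : 𝟙 _ ≫ (V.mapId a).hom.toNatTrans.app (f.toFunctor.obj c) =
      ((V.mapId a).hom.toNatTrans.app (f.toFunctor.obj c) ≫ 𝟙 _) ≫ 𝟙 _ ≫ 𝟙 _ := by simp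
    exact this
  naturality_comp {a b d} k l := catHom₂_ext fun (f : C ⟶ V.obj a) => by
    have : 𝟙 _ ≫ (V.mapComp k l).hom.toNatTrans.app (f.toFunctor.obj c) =
      ((V.mapComp k l).hom.toNatTrans.app (f.toFunctor.obj c) ≫ 𝟙 _) ≫ 𝟙 _ ≫ 𝟙 _ ≫ 𝟙 _ ≫
        (V.map l).toFunctor.map (𝟙 _) ≫ 𝟙 _ := by simp
    exact this

/-- The transformations `catEval V C c`, functorially in `c : C`. -/
def catEvals : C ⥤ (V.comp (representable C) ⟶ V) where
  obj c := catEval V C c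
  map {c c'} φ :=
    { as :=
      { app a := ⟨{
          app := fun (f : C ⟶ V.obj a) => f.toFunctor.map φ
          naturality := fun {f f'} σ => by
            have {f f' : C ⟶ V.obj a} (σ : f ⟶ f') : σ.toNatTrans.app c ≫ f'.toFunctor.map φ =
              f.toFunctor.map φ ≫ σ.toNatTrans.app c' := by simp
            exact this σ }⟩
        naturality {a a'} k := catHom₂_ext fun (f : C ⟶ V.obj a) => by
          have : (f ≫ V.map k).toFunctor.map φ ≫ 𝟙 _ =
            𝟙 _ ≫ (V.map k).toFunctor.map (f.toFunctor.map φ) := by simp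
          exact this } }
  map_id c := StrongTrans.homCategory.ext fun a => catHom₂_ext fun (f : C ⟶ V.obj a) =>
    f.toFunctor.map_id c
  map_comp φ ψ := StrongTrans.homCategory.ext fun a => catHom₂_ext fun (f : C ⟶ V.obj a) =>
    f.toFunctor.map_comp φ ψ

variable {C V} {W : A ⥤ᵖ Cat.{s, s}}

variable (C V W) in
/-- The functor `[A, Cat](W, Cat(C, V -)) ⥤ Cat(C, [A, Cat](W, V))` that exchanges the two
variables. It is in fact an equivalence; full faithfulness is enough below. -/
def swap : (W ⟶ V.comp (representable C)) ⥤ (C ⥤ (W ⟶ V)) :=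
  precomposing W _ V ⋙ (Functor.whiskeringLeft _ _ _).obj (catEvals V C)

instance : (swap V C W).Faithful where
  map_injective {_ _ _ _} h := StrongTrans.homCategory.ext fun a =>
    catHom₂_ext fun w => catHom₂_ext fun c =>
      congrArg (fun n => ((NatTrans.app n c).as.app a).toNatTrans.app w) h

instance : (swap V C W).Full where
  map_surjective {Z Z'} n := by
    refine ⟨⟨⟨fun a => ⟨⟨fun w => ⟨⟨fun c => ((n.app c).as.app a).toNatTrans.app w, ?_⟩⟩, ?_⟩⟩,
      fun {a a'} k => catHom₂_ext fun w => catHom₂_ext fun c => ?_⟩⟩, ?_⟩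
    · intro c c' φ
      exact congrArg (fun m => (m.as.app a).toNatTrans.app w) (n.naturality φ)
    · intro w w' σ
      exact catHom₂_ext fun c => ((n.app c).as.app a).toNatTrans.naturality σ
    · have key {X X' Y Y' : V.obj a'} {p : X ⟶ X'} {q' : X' ⟶ Y'} {q : X ⟶ Y} {r : Y ⟶ Y'}
          (h : p ≫ 𝟙 _ ≫ q' ≫ 𝟙 _ ≫ 𝟙 _ ≫ 𝟙 _ = (𝟙 _ ≫ q ≫ 𝟙 _ ≫ 𝟙 _ ≫ 𝟙 _) ≫ r) :
          p ≫ q' = q ≫ r := by simpa using h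
      exact key (congrArg (fun m => m.toNatTrans.app w) ((n.app c).as.naturality k))
    · rfl

end Evaluation

/-! ### Representables preserve universal legs -/

section Representable

variable {A : Type u₁} [Bicategory.{w₁, v₁} A] {B : Type u₂} [Bicategory.{s, s} B]
  {H : Type u₃} [Bicategory.{s, s} H] {t : A ⥤ᵖ B} {F : A ⥤ᵖ H} {L : B ⥤ᵖ H}
  (e : t.comp L ⟶ F) (X : H) (C : Cat.{s, s}) (b : B)

/-- The functor `H(x, L b) ⥤ [A, Cat](B(b, t -), H(x, F -))` given by composition with the legs of
`e`. It is an equivalence for all `x` exactly when the legs are universal at `b`. -/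
def pointwiseComparison (x : H) :
    (x ⟶ L.obj b) ⥤ (t.comp (representable b) ⟶ F.comp (representable x)) :=
  comparison (leftOpPseudofunctor (restrictedRepresentables F))
    ((legs (CompTrans.ofTrans e)).app b) x ⋙ unopFunctor _ _

theorem associator_paste {b c c' : B} {X x x' : H} (v : X ⟶ L.obj b) (f : b ⟶ c)
    (k : c ⟶ c') (z : L.obj c ⟶ x) (z' : L.obj c' ⟶ x') (l : x ⟶ x')
    (n : L.map k ≫ z' ⟶ z ≫ l) :
    (α_ v (L.map (f ≫ k)) z').hom ≫ v ◁ ((L.mapComp f k).hom ▷ z' ≫ (α_ _ _ _).hom ≫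
        L.map f ◁ n ≫ (α_ _ _ _).inv) ≫ (α_ _ _ _).inv =
      ((v ◁ (L.mapComp f k).hom ≫ (α_ _ _ _).inv) ▷ z' ≫ (α_ _ _ _).hom ≫ (v ≫ L.map f) ◁ n ≫
        (α_ _ _ _).inv) ≫ (α_ _ _ _).hom ▷ l := by
  simp

/-- The legs of `H(X, e)` composed with `v : C ⥤ H(X, L b)` and evaluated at `c : C` are the legs of
`e` composed with `v c`. -/
def pointwiseIso (v : C ⟶ (representable X).obj (L.obj b)) (c : C) :
    (pointwiseComparison (postcompMap (representable X) e) b C).obj v ≫ catEval _ C c ≅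
      (pointwiseComparison e b X).obj (v.toFunctor.obj c) :=
  StrongTrans.isoMk (fun a => Cat.Hom.isoMk (NatIso.ofComponents
    (fun (f : b ⟶ t.obj a) => α_ (v.toFunctor.obj c : X ⟶ L.obj b) (L.map f) (e.app a))
    (fun {f f'} σ => by
      have {f f' : b ⟶ t.obj a} (σ : f ⟶ f') {x : H} (v : X ⟶ L.obj b) (z : L.obj (t.obj a) ⟶ x) :
        (v ◁ L.map₂ σ) ▷ z ≫ (α_ v (L.map f') z).hom =
          (α_ v (L.map f) z).hom ≫ v ◁ L.map₂ σ ▷ z := by simp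
      exact this σ (v.toFunctor.obj c) (e.app a))))
    (fun {a a'} k => catHom₂_ext fun (f : b ⟶ t.obj a) => by
      have h := associator_paste (v.toFunctor.obj c : X ⟶ L.obj b) f (t.map k) (e.app a) (e.app a')
        (F.map k) (e.naturality k).hom
      have gen {x₁ x₂ x₃ x₄ x₅ x₆ x₇ x₈ : X ⟶ F.obj a'} {p : x₁ ⟶ x₂} {q : x₂ ⟶ x₃} {r : x₃ ⟶ x₄}
        {p' : x₁ ⟶ x₅} {q' : x₅ ⟶ x₆} {r' : x₆ ⟶ x₇} {y : x₇ ⟶ x₈} {u : x₈ ⟶ x₄}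
        (h : p ≫ q ≫ r = (p' ≫ q' ≫ r' ≫ y) ≫ u) : p ≫ 𝟙 _ ≫ q ≫ 𝟙 _ ≫ r ≫ 𝟙 _ =
          (𝟙 _ ≫ (𝟙 _ ≫ (p' ≫ 𝟙 _ ≫ (q' ≫ r' ≫ y) ≫ 𝟙 _) ≫ 𝟙 _ ≫ 𝟙 _ ≫ 𝟙 _) ≫ 𝟙 _ ≫ 𝟙 _ ≫ 𝟙 _) ≫
            u := by
        simpa using h
      exact gen h)

/-- The identification of the hom-category of `Cat` with the functor category. -/
def catHomFunctor (C D : Cat.{v, u}) : (C ⟶ D) ⥤ (C ⥤ D) where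
  obj f := f.toFunctor
  map η := η.toNatTrans

instance isEquivalence_catHomFunctor (C D : Cat.{v, u}) : (catHomFunctor C D).IsEquivalence :=
  .mk' { obj := fun f => f.toCatHom, map := fun η => η.toCatHom₂ } (Iso.refl _) (Iso.refl _)

/-- Up to exchanging variables, the comparison functor of `H(X, e)` at `C` is postcomposition of
functors `C ⥤ H(X, L b)` with the comparison functor of `e` at `X`. -/
def pointwiseSwapIso :
    pointwiseComparison (postcompMap (representable X) e) b C ⋙ swap _ C _ ≅
      catHomFunctor _ _ ⋙
        (Functor.whiskeringRight _ _ _).obj (pointwiseComparison e b X) :=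
  NatIso.ofComponents (fun v => NatIso.ofComponents (fun c => pointwiseIso e X C b v c)
    (fun {c c'} φ => StrongTrans.homCategory.ext fun a => catHom₂_ext fun (f : b ⟶ t.obj a) => by
      have {v v' : X ⟶ L.obj b} (φ : v ⟶ v') {x : H} (z : L.obj (t.obj a) ⟶ x) :
        φ ▷ L.map f ▷ z ≫ (α_ v' (L.map f) z).hom =
          (α_ v (L.map f) z).hom ≫ φ ▷ (L.map f ≫ z) := by simp
      exact this (v.toFunctor.map φ) (e.app a)))
    (fun {v v'} σ => NatTrans.ext <| funext fun c => StrongTrans.homCategory.ext fun a =>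
      catHom₂_ext fun (f : b ⟶ t.obj a) => by
      have {v v' : X ⟶ L.obj b} (φ : v ⟶ v') {x : H} (z : L.obj (t.obj a) ⟶ x) :
        φ ▷ L.map f ▷ z ≫ (α_ v' (L.map f) z).hom =
          (α_ v (L.map f) z).hom ≫ φ ▷ (L.map f ≫ z) := by simp
      exact this (σ.toNatTrans.app c) (e.app a))

variable {e b} in
/-- If the legs of `e` are universal at `b`, so are those of `H(X, e)`. -/
theorem isUniversal_legs_postcompMap (h : IsUniversal
    (leftOpPseudofunctor (restrictedRepresentables F)) ((legs (CompTrans.ofTrans e)).app b)) :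
    IsUniversal (leftOpPseudofunctor (restrictedRepresentables (F.comp (representable X))))
      ((legs (CompTrans.ofTrans (postcompMap (representable X) e))).app b) := by
  refine ⟨fun C => ?_⟩
  have h1 : (pointwiseComparison e b X).IsEquivalence :=
    @Functor.isEquivalence_trans _ _ _ _ _ _ _ _ (h.isEquivalence X)
      (isEquivalence_unopFunctor _ _)
  have gen {E : Type s} [Category.{s} E] {D : Type s} [Category.{s} D] {D' : Type _}
      [Category D'] (K : D ⥤ D') (hK : K.IsEquivalence) :
      ((Functor.whiskeringRight E D D').obj K).IsEquivalence := inferInstance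
  have h2 : (catHomFunctor C ((representable X).obj (L.obj b)) ⋙
      (Functor.whiskeringRight _ _ _).obj (pointwiseComparison e b X)).IsEquivalence :=
    @Functor.isEquivalence_trans _ _ _ _ _ _ _ _ (isEquivalence_catHomFunctor _ _) (gen _ h1)
  have h3 := @Functor.isEquivalence_of_iso _ _ _ _ _ _ (pointwiseSwapIso e X C b).symm h2
  have h4 : (swap (F.comp (representable X)) C (t.comp (representable b))).EssSurj :=
    ⟨fun x => ⟨_, ⟨(pointwiseComparison (postcompMap (representable X) e) b C ⋙
      swap _ C _).objObjPreimageIso x⟩⟩⟩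
  have h5 : (swap (F.comp (representable X)) C (t.comp (representable b))).IsEquivalence := { }
  have h6 := @Functor.isEquivalence_of_comp_right _ _ _ _ _ _ _ _ h5 h3
  exact @Functor.isEquivalence_of_comp_right _ _ _ _ _ _ _ (unopFunctor _ _)
    (isEquivalence_unopFunctor _ _) h6

end Representable

/-! ### Extensions preserved by representables have universal legs -/

section Pointwise

variable {A : Type u₁} [Bicategory.{w₁, v₁} A] {B : Type u₂} [Bicategory.{s, s} B]
  {H : Type u₃} [Bicategory.{s, s} H] {t : A ⥤ᵖ B} {F : A ⥤ᵖ H} {L : B ⥤ᵖ H}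
  (e : t.comp L ⟶ F) (X : H) (b : B)

/-- Coherence behind `valueCompIso`: pasting `n` onto a 1-cell `p ≅ v ≫ L f`. -/
theorem value_paste {b c c' : B} {X x x' : H} {v : X ⟶ L.obj b} {f : b ⟶ c} {k : c ⟶ c'}
    {z : L.obj c ⟶ x} {z' : L.obj c' ⟶ x'} {l : x ⟶ x'} (n : L.map k ≫ z' ⟶ z ≫ l)
    {p : X ⟶ L.obj c} {p' : X ⟶ L.obj c'} {i : p ⟶ v ≫ L.map f} {i' : p' ⟶ v ≫ L.map (f ≫ k)}
    {m : p' ⟶ p ≫ L.map k}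
    (h : i' ≫ v ◁ (L.mapComp f k).hom ≫ (α_ _ _ _).inv = m ≫ i ▷ L.map k) :
    (i' ▷ z' ≫ (α_ _ _ _).hom) ≫ v ◁ ((L.mapComp f k).hom ▷ z' ≫ (α_ _ _ _).hom ≫
        L.map f ◁ n ≫ (α_ _ _ _).inv) ≫ (α_ _ _ _).inv =
      (m ▷ z' ≫ (α_ _ _ _).hom ≫ p ◁ n ≫ (α_ _ _ _).inv) ≫
        (i ▷ z ≫ (α_ _ _ _).hom) ▷ l := by
  have h1 := associator_paste v f k z z' l n
  rw [Category.assoc, h1, Category.assoc, ← comp_whiskerRight_assoc, h]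
  simp [reassoc_of% whiskerLeft_exchange]

/-- A transformation `θ : B(b, -) ⟶ H(X, L -)`, restricted along `t` and composed with `H(X, e)`, is
the composite of the legs of `e` with the value `θ 𝟙 : X ⟶ L b`. -/
def valueCompIso (θ : representable b ⟶ L.comp (representable X)) :
    precompMap t θ ≫ postcompMap (representable X) e ≅
      (pointwiseComparison e b X).obj (value θ (𝟙 b)) :=
  StrongTrans.isoMk (fun a => Cat.Hom.isoMk (NatIso.ofComponents
    (fun (f : b ⟶ t.obj a) => whiskerRightIso (B := H) (f := value θ f)
      (g := (value θ (𝟙 b) : X ⟶ L.obj b) ≫ L.map f) (valueIso θ f) (e.app a) ≪≫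
        α_ (value θ (𝟙 b) : X ⟶ L.obj b) (L.map f) (e.app a))
    (fun {f f'} σ => by
      have {f f' : b ⟶ t.obj a} {σ : f ⟶ f'} {x : H} (v : X ⟶ L.obj b) {p p' : X ⟶ L.obj (t.obj a)}
        {m : p ⟶ p'} {i : p ⟶ v ≫ L.map f} {i' : p' ⟶ v ≫ L.map f'} (z : L.obj (t.obj a) ⟶ x)
        (h : m ≫ i' = i ≫ v ◁ L.map₂ σ) :
        m ▷ z ≫ i' ▷ z ≫ (α_ v (L.map f') z).hom =
          (i ▷ z ≫ (α_ v (L.map f) z).hom) ≫ v ◁ L.map₂ σ ▷ z := by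
        rw [← comp_whiskerRight_assoc, h]
        simp
      exact this _ (e.app a) (valueIso_naturality θ (d := t.obj a) (f := f) (f' := f') σ))))
    (fun {a a'} k => catHom₂_ext fun (f : b ⟶ t.obj a) => by
      have h := value_paste (e.naturality k).hom (valueIso_comp θ f (t.map k))
      have gen {x₁ x₂ x₃ x₄ x₅ x₆ : X ⟶ F.obj a'} {p : x₁ ⟶ x₂} {q : x₂ ⟶ x₃} {r : x₃ ⟶ x₄}
        {p' : x₁ ⟶ x₅} {q' : x₅ ⟶ x₆} {u : x₆ ⟶ x₄} (h : p ≫ q ≫ r = (p' ≫ q') ≫ u) :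
        p ≫ 𝟙 _ ≫ q ≫ 𝟙 _ ≫ r ≫ 𝟙 _ = (𝟙 _ ≫ p' ≫ 𝟙 _ ≫ q' ≫ 𝟙 _) ≫ u := by
        simpa using h
      exact gen h)

variable {e} in
/-- If `H(X, e)` is universal for every `X`, the legs of `e` are universal: on transformations out
of `B(b, -)`, the comparison functor of `H(X, e)` is by the Yoneda lemma the functor
`pointwiseComparison e b X`. -/
theorem isUniversal_legs_of_forall_representable (h : ∀ X : H,
    IsUniversal (precomposition t Cat.{s, s}) (postcompMap (representable X) e)) (b : B) :
    IsUniversal (leftOpPseudofunctor (restrictedRepresentables F))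
      ((legs (CompTrans.ofTrans e)).app b) := by
  refine ⟨fun X => ?_⟩
  have i : comparison (precomposition t Cat.{s, s}) (postcompMap (representable X) e)
      (representable b) ≅ yonedaEval b (L.comp (representable X)) ⋙ pointwiseComparison e b X :=
    NatIso.ofComponents (fun θ => valueCompIso e X b θ) (fun {θ θ'} m =>
      StrongTrans.homCategory.ext fun a => catHom₂_ext fun (f : b ⟶ t.obj a) => by
      have {v v' : X ⟶ L.obj b} {p p' : X ⟶ L.obj (t.obj a)} {m : p ⟶ p'} {n : v ⟶ v'}
          {i : p ⟶ v ≫ L.map f} {i' : p' ⟶ v' ≫ L.map f} {x : H} (z : L.obj (t.obj a) ⟶ x)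
          (h : m ≫ i' = i ≫ n ▷ L.map f) : m ▷ z ≫ i' ▷ z ≫ (α_ v' (L.map f) z).hom =
            (i ▷ z ≫ (α_ v (L.map f) z).hom) ≫ n ▷ (L.map f ≫ z) := by
        rw [← comp_whiskerRight_assoc, h]
        simp
      exact this (e.app a) (valueIso_modification m f))
  have h1 := @Functor.isEquivalence_of_iso _ _ _ _ _ _ i ((h X).isEquivalence (representable b))
  have h2 : (pointwiseComparison e b X).IsEquivalence :=
    @Functor.isEquivalence_of_comp_left _ _ _ _ _ _ (yonedaEval b (L.comp (representable X))) _
      inferInstance h1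
  exact @Functor.isEquivalence_of_comp_right _ _ _ _ _ _ _ (unopFunctor _ _)
    (isEquivalence_unopFunctor _ _) h2

end Pointwise

/-! ### Bilimits and universal legs -/

section Legs

variable {A : Type u₁} [Bicategory.{w₁, v₁} A] {B : Type u₂} [Bicategory.{w, v} B]
  {H : Type u₃} [Bicategory.{w, v} H] {t : A ⥤ᵖ B} {F : A ⥤ᵖ H} {L : B ⥤ᵖ H}

/-- The legs of the transformation `L t ⟶ F` determined by a family of cones `e` are the given
cones. -/
def legsToCompTransIso (e : CompTrans (leftOpPseudofunctor (restrictedRepresentables F)) L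
    (leftOpPseudofunctor (restrictedRepresentables t))) (b : B) :
    legTrans (biTransOfLegs e).toCompTrans b ≅ (e.app b).unop :=
  StrongTrans.isoMk (fun a => Cat.Hom.isoMk ((biTransOfLegs e).comparisonIso b a))
    (fun {a a'} k => catHom₂_ext fun (f : b ⟶ t.obj a) => by
      have h := (biTransOfLegs e).pasteIso_unitIso f k
      exact ((Iso.comp_inv_eq (legRight e f k)).1 ((Category.assoc _ _ _).trans h)).symm)

end Legs

section Bilimits

variable {A B : Type s} [Bicategory.{s, s} A] [Bicategory.{s, s} B]
  {H : Type u} [Bicategory.{s, s} H] {t : A ⥤ᵖ B} {F : A ⥤ᵖ H}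

/-- Universal legs at `b` form a cone exhibiting `R b` as a bilimit with weight `B(b, t -)`. -/
theorem isWeightedBilimit_of_isUniversal_legs {R : B ⥤ᵖ H} {e : t.comp R ⟶ F} {b : B}
    (h : IsUniversal (leftOpPseudofunctor (restrictedRepresentables F))
      ((legs (CompTrans.ofTrans e)).app b)) : IsWeightedBilimit (homWeight t b) F (R.obj b) := by
  obtain ⟨E, -⟩ := exists_yoneda_equivalence (c := R.obj b)
    (V := (weightedCones F).obj (op (homWeight t b))) (legTrans (CompTrans.ofTrans e) b)
    (fun d => @Functor.isEquivalence_trans _ _ _ _ _ _ _ _ (h.isEquivalence d)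
      (isEquivalence_unopFunctor _ _))
  exact ⟨E⟩

/-- The equivalences `H(-, P b) ≃ [A, Cat](B(b, t -), H(-, F))` are universal arrows for the Yoneda
embedding, so they assemble into a pseudofunctor. -/
theorem exists_isBilimitPseudofunctor {P : B → H}
    (h : ∀ b, IsWeightedBilimit (homWeight t b) F (P b)) :
    ∃ L : B ⥤ᵖ H, (∀ b, L.obj b = P b) ∧ IsBilimitPseudofunctor t F L := by
  let E b : yoneda₀ (P b) ≌ (weightedCones F).obj (op (homWeight t b)) := (h b).some
  let G := (leftOpPseudofunctor (restrictedRepresentables t)).comp (weightedCones F)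
  have hE (b : B) : IsUniversal (yoneda (B := H)) (P := P b) (Z := G.obj b) (E b).hom :=
    isUniversal_yoneda (isEquiv_hom (E b))
  have hΦ : IsEquiv (universalLiftArrow (y := yoneda) (G := G) hE) := isEquiv_of_app
    fun b => isEquiv_hom (E b)
  obtain ⟨Φ, -⟩ := hΦ.exists_hom_eq
  exact ⟨universalLift (y := yoneda) (G := G) hE, fun b => rfl, ⟨Φ⟩⟩

/-- For the pseudofunctor `L` of bilimits, transposing the equivalence `H(X, L b) ≃ cones` twice, by
the Yoneda lemma in `X` and then in `b`, yields a transformation `L t ⟶ F` with universal legs. -/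
theorem IsBilimitPseudofunctor.exists_isUniversal_legs {L : B ⥤ᵖ H}
    (h : IsBilimitPseudofunctor t F L) : ∃ e : t.comp L ⟶ F, ∀ b,
      IsUniversal (leftOpPseudofunctor (restrictedRepresentables F))
        ((legs (CompTrans.ofTrans e)).app b) := by
  obtain ⟨Φ⟩ := h
  let τ := biTransOfLegs (biTransOfCells Φ.hom).toCompTrans
  refine ⟨τ.toCompTrans.toTrans, fun b => ?_⟩
  exact (isUniversal_biTransOfCells Φ.hom b ((isEquiv_hom Φ).app b)).of_iso
    (legsToCompTransIso (biTransOfCells Φ.hom).toCompTrans b).symm.op2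

end Bilimits

end PseudoKan

theorem mainTheorem3 {A B : Type s} [Bicategory.{s, s} A] [Bicategory.Strict A]
    [Bicategory.{s, s} B] [Bicategory.Strict B] {H : Type u} [Bicategory.{s, s} H]
    [Bicategory.Strict H] (F : A ⥤ᵖ H) (t : A ⥤ᵖ B) :
    (PseudoKan.HasPointwisePseudoRan t F ↔
      ∀ b : B, PseudoKan.HasWeightedBilimit (PseudoKan.homWeight t b) F) ∧
    (∀ P : B → H, (∀ b : B, PseudoKan.IsWeightedBilimit (PseudoKan.homWeight t b) F (P b)) →
      ∃ L : B ⥤ᵖ H, (∀ b : B, L.obj b = P b) ∧ PseudoKan.IsBilimitPseudofunctor t F L) ∧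
    (∀ (R : B ⥤ᵖ H) (e : t.comp R ⟶ F), PseudoKan.IsPseudoRan t F R e →
      ∀ L : B ⥤ᵖ H, PseudoKan.IsBilimitPseudofunctor t F L → Nonempty (R ≌ L)) := by
  open PseudoKan in
  refine ⟨⟨?_, fun h => ?_⟩, fun P => exists_isBilimitPseudofunctor, fun R e he L hL => ?_⟩
  · rintro ⟨R, e, -, hR⟩ b
    exact ⟨R.obj b, isWeightedBilimit_of_isUniversal_legs
      (isUniversal_legs_of_forall_representable (fun X => isRightReflection_iff.1 (hR X)) b)⟩
  · choose P hP using h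
    obtain ⟨L, -, hL⟩ := exists_isBilimitPseudofunctor hP
    obtain ⟨e, he⟩ := hL.exists_isUniversal_legs
    exact ⟨L, e, isRightReflection_iff.2 (isUniversal_precomposition he), fun X =>
      isRightReflection_iff.2 (isUniversal_precomposition fun b =>
        isUniversal_legs_postcompMap X (he b))⟩
  · obtain ⟨e', he'⟩ := hL.exists_isUniversal_legs
    exact (isRightReflection_iff.1 he).nonempty_equivalence (isUniversal_precomposition he')
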